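/- Let $K(\theta)=|\sin\theta|$. For $\lambda>0$, an \emph{equilibrium density} is a function $f\ge 0$ of the angle with $f(\theta+\pi)=f(\theta)$, $\int_0^{2\pi}f=1$ and $$f(\theta)=\frac{e^{-U(f)(\theta)}}{\int_0^{2\pi}e^{-U(f)(\theta')}\,d\theta'},\qquad U(f)(\theta)=\lambda\int_0^{2\pi}K(\theta-\theta')f(\theta')\,d\theta'.$$ Let $H$ be the Hilbert space of all $V\in H^1(0,2\pi)$ with $V(\theta+\pi)=V(\theta)$ and $V(2\pi-\theta)=V(\theta)$ a.e. and $\int_0^{2\pi}V=0$, with the $H^1$ inner product. Put $\tilde K=K-\frac1{2\pi}\int_0^{2\pi}K$ and $$\Gamma:H\to H,\qquad \Gamma(V)(\theta)=\frac{\int_0^{2\pi}\tilde K(\theta-\theta')e^{-V(\theta')}\,d\theta'}{\int_0^{2\pi}e^{-V(\theta')}\,d\theta'} .$$ Then the following hold. 1. (Fourier coefficients.) $|\sin\theta|=\sum_{m\ge0}k_m\cos(2m\theta)$ for every $\theta$, with $k_0=\frac2\pi$ and $k_m=-\frac{4}{\pi(4m^2-1)}$ for $m\ge1$ (the cosine Fourier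 coefficients of $K$). Hence $-\frac{2}{k_m}=\frac{(4m^2-1)\pi}{2}=:\lambda_m$ for $m\ge 1$, and $\big(\sum_{m\ge1}|k_m|\big)^{-1}=\frac\pi2$. 2. (Uniqueness.) For $0<\lambda<\frac\pi2$ the only equilibrium density is the constant $f\equiv\frac1{2\pi}$. 3. (Reformulation.) For every $\lambda>0$, the relation $f=e^{-V}/\int_0^{2\pi}e^{-V}$ a.e. is a one-to-one correspondence between the equilibrium densities $f$ with $f(2\pi-\theta)=f(\theta)$ and the solutions $V\in H$ of $V=\lambda\Gamma(V)$. 4. (Bifurcation values.) For $\lambda_*>0$, every neighbourhood of $(\lambda_*,0)$ in $\mathbb R\times H$ contains some $(\lambda,V)$ with $V=\lambda\Gamma(V)$, $V\ne0$, if and only if $\lambda_*=\lambda_m$ for some $m\ge1$. 5. (Supercritical pairs.) For every $m\ge1$ a pair of solutions bifurcates supercritically at $\lambda_m$. That is, with $\phi_m(\theta)=\cos(2m\theta)$, there are $\delta>0$, a neighbourhood $\mathcal U$ of $(\lambda_m,0)$ in $\mathbb R\times H$, and continuous $\mu:(-\delta,\delta)\to\mathbb R$, $z:(-\delta,\delta)\to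 H$ with $\mu(0)=0$, $z(0)=0$ and $\langle\phi_m,z(t)\rangle_H=0$ for all $t$, such that the set of $(\lambda,V)\in\mathcal U$ with $V=\lambda\Gamma(V)$ is $$\{(\lambda_m+\mu(t),\,t(\phi_m+z(t))):|t|<\delta\}\cup\{(\lambda,0)\in\mathcal U\},$$ and $\mu(t)>0$ for $0<|t|<\delta$. Moreover, for every sufficiently small $r>0$ there is $\varepsilon>0$ such that $V=\lambda\Gamma(V)$ has exactly two solutions with $0<\|V\|_H<r$ when $\lambda_m<\lambda<\lambda_m+\varepsilon$, and none when $\lambda_m-\varepsilon<\lambda\le\lambda_m$. 6. (Stability.) Call a solution $(\lambda,V)$ stable if $\Gamma$ is Fréchet differentiable at $V$ and the (complex) spectrum of $I-\lambda D\Gamma(V)$ on $H$ lies in $\{\operatorname{Re}w>0\}$, and unstable if $\Gamma$ is Fréchet differentiable at $V$ and this spectrum meets $\{\operatorname{Re}w<0\}$. With $\delta$ in 5 suitably chosen, the solutions $t(\phi_m+z(t))$, $0<|t|<\delta$, are stable if $m=1$ (bifurcation from $\lambda_1=\frac{3\pi}2$) and unstable if $m\ge2$. -/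

import Mathlib

open MeasureTheory Set Filter Topology
open scoped Real ContDiff

noncomputable section

namespace Onsager

/-! ### Kernels and equilibrium densities on the circle -/

/-- The two-dimensional Onsager kernel `K(θ) = |sin θ|`. -/
def kernel (θ : ℝ) : ℝ := |Real.sin θ|

/-- The coefficients `k_m` of the expansion `K(θ) = ∑ k_m cos(2mθ)` of a `π`-periodic even `K`. -/
def fourierCos (K : ℝ → ℝ) (m : ℕ) : ℝ :=
  if m = 0 then (2 * π)⁻¹ * ∫ θ in (0 : ℝ)..2 * π, K θ
  else π⁻¹ * ∫ θ in (0 : ℝ)..2 * π, K θ * Real.cos (2 * m * θ)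

/-- The interaction potential `U(f)(θ) = lam ∫₀^{2π} K(θ - θ') f(θ') dθ'`. -/
def potential (K : ℝ → ℝ) (lam : ℝ) (f : ℝ → ℝ) (θ : ℝ) : ℝ :=
  lam * ∫ θ' in (0 : ℝ)..2 * π, K (θ - θ') * f θ'

/-- `f` (as a function of the angle) is an equilibrium probability density: a stationary solution
of the Doi-Onsager model with kernel `K` and parameter `lam`. -/
structure IsEquilibrium (K : ℝ → ℝ) (lam : ℝ) (f : ℝ → ℝ) : Prop where
  nonneg : ∀ θ, 0 ≤ f θ
  periodic : ∀ θ, f (θ + π) = f θ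
  integrable : IntervalIntegrable f volume 0 (2 * π)
  mass : ∫ θ in (0 : ℝ)..2 * π, f θ = 1
  eq : ∀ θ, f θ = Real.exp (-potential K lam f θ) /
    ∫ θ' in (0 : ℝ)..2 * π, Real.exp (-potential K lam f θ')

/-! ### The Sobolev space `H` -/

/-- Lebesgue measure on one period. -/
abbrev per : Measure ℝ := volume.restrict (Ioc 0 (2 * π))

/-- Smooth functions with compact support in the open interval `(0, 2π)`. -/
def IsTest (φ : ℝ → ℝ) : Prop :=
  ContDiff ℝ ∞ φ ∧ HasCompactSupport φ ∧ tsupport φ ⊆ Ioo 0 (2 * π)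

/-- `v` is the weak derivative of `u` on `(0, 2π)`. -/
def HasWeakDeriv (u v : ℝ → ℝ) : Prop :=
  ∀ φ : ℝ → ℝ, IsTest φ →
    ∫ θ in (0 : ℝ)..2 * π, u θ * deriv φ θ = -∫ θ in (0 : ℝ)..2 * π, v θ * φ θ

/-- The conditions defining `H`: `u` has weak derivative `v`, mean zero, is `π`-periodic and
even about `π` (almost everywhere). -/
structure IsAdmissible (u v : ℝ → ℝ) : Prop where
  weak : HasWeakDeriv u v
  mean : ∫ θ in (0 : ℝ)..2 * π, u θ = 0
  periodic : ∀ᵐ θ ∂(volume.restrict (Ioo 0 π)), u (θ + π) = u θ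
  even : ∀ᵐ θ ∂(volume.restrict (Ioo 0 (2 * π))), u (2 * π - θ) = u θ

lemma ae_shift {P : ℝ → Prop} (h : ∀ᵐ θ ∂per, P θ) :
    ∀ᵐ θ ∂(volume.restrict (Ioo 0 π)), P (θ + π) := by
  rw [ae_restrict_iff' measurableSet_Ioo]
  rw [ae_restrict_iff' measurableSet_Ioc] at h
  filter_upwards [(quasiMeasurePreserving_add_right volume π).ae h] with θ hθ hm
  exact hθ ⟨by linarith [hm.1, Real.pi_pos], by linarith [hm.2]⟩

lemma ae_half {P : ℝ → Prop} (h : ∀ᵐ θ ∂per, P θ) :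
    ∀ᵐ θ ∂(volume.restrict (Ioo 0 π)), P θ :=
  ae_restrict_of_ae_restrict_of_subset
    (Ioo_subset_Ioc_self.trans (Ioc_subset_Ioc_right (by linarith [Real.pi_pos]))) h

lemma ae_refl {P : ℝ → Prop} (h : ∀ᵐ θ ∂per, P θ) :
    ∀ᵐ θ ∂(volume.restrict (Ioo 0 (2 * π))), P (2 * π - θ) := by
  rw [ae_restrict_iff' measurableSet_Ioo]
  rw [ae_restrict_iff' measurableSet_Ioc] at h
  filter_upwards [(quasiMeasurePreserving_sub_left volume (2 * π)).ae h] with θ hθ hm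
  exact hθ ⟨by linarith [hm.2], by linarith [hm.1]⟩

lemma ae_open {P : ℝ → Prop} (h : ∀ᵐ θ ∂per, P θ) :
    ∀ᵐ θ ∂(volume.restrict (Ioo 0 (2 * π))), P θ :=
  ae_restrict_of_ae_restrict_of_subset Ioo_subset_Ioc_self h

lemma period_nonneg : (0 : ℝ) ≤ 2 * π := by positivity

lemma integral_per (F : ℝ → ℝ) : ∫ θ in (0 : ℝ)..2 * π, F θ = ∫ θ, F θ ∂per :=
  intervalIntegral.integral_of_le period_nonneg

lemma IsAdmissible.congr {u v u' v' : ℝ → ℝ} (h : IsAdmissible u v) (hu : u' =ᵐ[per] u)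
    (hv : v' =ᵐ[per] v) : IsAdmissible u' v' where
  weak φ hφ := by
    have := h.weak φ hφ
    rw [integral_per, integral_per] at this ⊢
    have e1 : ∫ θ, u' θ * deriv φ θ ∂per = ∫ θ, u θ * deriv φ θ ∂per :=
      integral_congr_ae (hu.mul (EventuallyEq.refl _ (deriv φ)))
    have e2 : ∫ θ, v' θ * φ θ ∂per = ∫ θ, v θ * φ θ ∂per :=
      integral_congr_ae (hv.mul (EventuallyEq.refl _ φ))
    rw [e1, e2, this]
  mean := by
    have := h.mean
    rw [integral_per] at this ⊢
    rw [integral_congr_ae hu, this]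
  periodic := by
    filter_upwards [ae_shift hu, ae_half hu, h.periodic] with θ h1 h2 h3
    rw [h1, h2, h3]
  even := by
    filter_upwards [ae_refl hu, ae_open hu, h.even] with θ h1 h2 h3
    rw [h1, h2, h3]

lemma IsTest.bounds {φ : ℝ → ℝ} (h : IsTest φ) :
    (∃ C, ∀ x, ‖φ x‖ ≤ C) ∧ (∃ C, ∀ x, ‖deriv φ x‖ ≤ C) ∧ Continuous φ ∧ Continuous (deriv φ) := by
  have hc : Continuous (deriv φ) := h.1.continuous_deriv (by simp)
  exact ⟨h.2.1.exists_bound_of_continuous h.1.continuous,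
    h.2.1.deriv.exists_bound_of_continuous hc, h.1.continuous, hc⟩

lemma IsTest.integrable_mul {φ g : ℝ → ℝ} (h : IsTest φ) (hg : Integrable g per) :
    Integrable (fun θ => g θ * φ θ) per ∧ Integrable (fun θ => g θ * deriv φ θ) per := by
  obtain ⟨⟨C, hC⟩, ⟨D, hD⟩, h1, h2⟩ := h.bounds
  exact ⟨hg.mul_bdd h1.aestronglyMeasurable (Eventually.of_forall hC),
    hg.mul_bdd h2.aestronglyMeasurable (Eventually.of_forall hD)⟩

lemma IsAdmissible.zero : IsAdmissible (fun _ => 0) (fun _ => 0) where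
  weak φ _ := by simp
  mean := by simp
  periodic := by simp
  even := by simp

lemma IsAdmissible.add {u v u' v' : ℝ → ℝ} (h : IsAdmissible u v) (h' : IsAdmissible u' v')
    (hu : Integrable u per) (hv : Integrable v per) (hu' : Integrable u' per)
    (hv' : Integrable v' per) :
    IsAdmissible (fun θ => u θ + u' θ) (fun θ => v θ + v' θ) where
  weak φ hφ := by
    have e1 := h.weak φ hφ
    have e2 := h'.weak φ hφ
    simp only [integral_per, add_mul] at e1 e2 ⊢
    rw [integral_add (hφ.integrable_mul hu).2 (hφ.integrable_mul hu').2,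
      integral_add (hφ.integrable_mul hv).1 (hφ.integrable_mul hv').1, e1, e2]
    ring
  mean := by
    have e1 := h.mean
    have e2 := h'.mean
    simp only [integral_per] at e1 e2 ⊢
    rw [integral_add hu hu', e1, e2, add_zero]
  periodic := by
    filter_upwards [h.periodic, h'.periodic] with θ h1 h2
    rw [h1, h2]
  even := by
    filter_upwards [h.even, h'.even] with θ h1 h2
    rw [h1, h2]

lemma IsAdmissible.smul {u v : ℝ → ℝ} (c : ℝ) (h : IsAdmissible u v) :
    IsAdmissible (fun θ => c * u θ) (fun θ => c * v θ) where
  weak φ hφ := by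
    simp only [mul_assoc, intervalIntegral.integral_const_mul, h.weak φ hφ]
    ring
  mean := by simp only [intervalIntegral.integral_const_mul, h.mean, mul_zero]
  periodic := by
    filter_upwards [h.periodic] with θ h1
    rw [h1]
  even := by
    filter_upwards [h.even] with θ h1
    rw [h1]

/-- Square integrable functions on one period. -/
abbrev L2per : Type := Lp ℝ 2 per

lemma L2per.integrable (u : L2per) : Integrable u per :=
  (Lp.memLp u).integrable (by norm_num)

/-- The Hilbert space `H` of mean-zero, `π`-periodic, even functions in `H¹(0, 2π)`, a function
being stored together with its weak derivative; the inner product inherited from `L² × L²` is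
`∫ u w + ∫ u' w'`, that of `H¹`. -/
def symmetricH1 : Submodule ℝ (WithLp 2 (L2per × L2per)) where
  carrier := {p | IsAdmissible p.fst p.snd}
  zero_mem' := IsAdmissible.zero.congr (Lp.coeFn_zero ..) (Lp.coeFn_zero ..)
  add_mem' hp hq :=
    (hp.add hq (L2per.integrable _) (L2per.integrable _) (L2per.integrable _)
      (L2per.integrable _)).congr (Lp.coeFn_add ..) (Lp.coeFn_add ..)
  smul_mem' c _ hp := (IsAdmissible.smul c hp).congr (Lp.coeFn_smul ..) (Lp.coeFn_smul ..)

/-- The space `H` as a type. -/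
abbrev H : Type := symmetricH1

/-- The underlying function of an element of `H` (defined up to null sets on `(0, 2π]`). -/
def H.fn (V : H) : ℝ → ℝ := (V : WithLp 2 (L2per × L2per)).fst

/-- The element of `H` given by the function `u` with weak derivative `v`. -/
def H.mk (u v : ℝ → ℝ) (hu : MemLp u 2 per) (hv : MemLp v 2 per) (h : IsAdmissible u v) : H :=
  ⟨WithLp.toLp 2 (hu.toLp u, hv.toLp v), h.congr hu.coeFn_toLp hv.coeFn_toLp⟩

lemma H.fn_mk (u v : ℝ → ℝ) (hu : MemLp u 2 per) (hv : MemLp v 2 per) (h : IsAdmissible u v) :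
    (H.mk u v hu hv h).fn =ᵐ[per] u := hu.coeFn_toLp

/-! ### The functions `cos (2mθ)` in `H` -/

lemma IsTest.endpoints {φ : ℝ → ℝ} (h : IsTest φ) : φ 0 = 0 ∧ φ (2 * π) = 0 := by
  constructor
  · by_contra hne
    exact absurd (h.2.2 (subset_tsupport _ hne)).1 (lt_irrefl _)
  · by_contra hne
    exact absurd (h.2.2 (subset_tsupport _ hne)).2 (lt_irrefl _)

lemma hasWeakDeriv_of_off_countable {u v : ℝ → ℝ} {s : Set ℝ} (hs : s.Countable)
    (hu : Continuous u) (hv : Integrable v per) (h : ∀ x ∉ s, HasDerivAt u (v x) x) :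
    HasWeakDeriv u v := by
  intro φ hφ
  have hui : Integrable u per := hu.integrableOn_Ioc
  have i1 := (hφ.integrable_mul hv).1
  have i2 := (hφ.integrable_mul hui).2
  have key := integral_eq_of_hasDerivAt_off_countable_of_le (fun x => u x * φ x)
    (fun x => v x * φ x + u x * deriv φ x) period_nonneg hs
    (hu.mul hφ.1.continuous).continuousOn
    (fun x hx => (h x hx.2).mul
      ((hφ.1.differentiable (by simp)).differentiableAt.hasDerivAt))
    ((intervalIntegrable_iff_integrableOn_Ioc_of_le period_nonneg).2 (i1.add i2))
  rw [integral_per, integral_add i1 i2, hφ.endpoints.1, hφ.endpoints.2] at key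
  rw [integral_per, integral_per]
  linarith

lemma memLp_of_continuous {u : ℝ → ℝ} (hu : Continuous u) (C : ℝ) (hC : ∀ x, ‖u x‖ ≤ C) :
    MemLp u 2 per :=
  MemLp.of_bound hu.aestronglyMeasurable C (Eventually.of_forall hC)

lemma isAdmissible_cos (m : ℕ) (hm : m ≠ 0) :
    IsAdmissible (fun θ => Real.cos (2 * m * θ)) (fun θ => -(2 * m * Real.sin (2 * m * θ))) where
  weak := by
    refine hasWeakDeriv_of_off_countable countable_empty (by fun_prop)
      (Continuous.integrableOn_Ioc (by fun_prop)) fun x _ => ?_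
    have h1 : HasDerivAt (fun y : ℝ => 2 * (m : ℝ) * y) (2 * m) x := by
      simpa using (hasDerivAt_id x).const_mul (2 * (m : ℝ))
    exact ((Real.hasDerivAt_cos (2 * m * x)).comp x h1).congr_deriv (by ring)
  mean := by
    have hm' : (2 * (m : ℝ)) ≠ 0 := by positivity
    rw [intervalIntegral.integral_comp_mul_left (fun x => Real.cos x) hm', integral_cos]
    have : Real.sin (2 * (m : ℝ) * (2 * π)) = 0 := by
      have := Real.sin_nat_mul_pi (4 * m)
      push_cast at this
      have e : 2 * (m : ℝ) * (2 * π) = 4 * m * π := by ring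
      rw [e, this]
    simp [this]
  periodic := Eventually.of_forall fun θ => by
    have : 2 * (m : ℝ) * (θ + π) = 2 * m * θ + m * (2 * π) := by ring
    rw [this, Real.cos_add_nat_mul_two_pi]
  even := Eventually.of_forall fun θ => by
    have : 2 * (m : ℝ) * (2 * π - θ) = ((2 * m : ℕ) : ℝ) * (2 * π) - 2 * m * θ := by
      push_cast; ring
    rw [this, Real.cos_nat_mul_two_pi_sub]

/-- `cos (2mθ)` as an element of `H`, for `m ≥ 1` (the value at `m = 0` is `0`). -/
def cosMode (m : ℕ) : H :=
  if hm : m = 0 then 0 else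
    H.mk (fun θ => Real.cos (2 * m * θ)) (fun θ => -(2 * m * Real.sin (2 * m * θ)))
      (memLp_of_continuous (by fun_prop) 1 fun x => Real.abs_cos_le_one _)
      (memLp_of_continuous (by fun_prop) (2 * m) fun x => by
        rw [norm_neg, norm_mul, Real.norm_of_nonneg (by positivity)]
        exact mul_le_of_le_one_right (by positivity) (Real.abs_sin_le_one _))
      (isAdmissible_cos m hm)

/-! ### The nonlinear operator `Γ` -/

/-- The centred Onsager kernel: the kernel minus its mean. -/
def kernelC (θ : ℝ) : ℝ := kernel θ - (2 * π)⁻¹ * ∫ s in (0 : ℝ)..2 * π, kernel s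

/-- `∫₀^{2π} K̃(θ - θ') g(θ') dθ'` for the centred kernel `K̃`. -/
def conv (g : ℝ → ℝ) (θ : ℝ) : ℝ := ∫ θ' in (0 : ℝ)..2 * π, kernelC (θ - θ') * g θ'

/-- The formula for `Γ(V)(θ)`. -/
def gammaFun (V : ℝ → ℝ) (θ : ℝ) : ℝ :=
  conv (fun θ' => Real.exp (-V θ')) θ / ∫ θ' in (0 : ℝ)..2 * π, Real.exp (-V θ')

/-- The derivative of the Onsager kernel off its kinks. -/
def kernelD (θ : ℝ) : ℝ := Real.cos θ * SignType.sign (Real.sin θ)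

/-- The convolution with `kernelD`, which is the derivative of `conv g`. -/
def convD (g : ℝ → ℝ) (θ : ℝ) : ℝ := ∫ θ' in (0 : ℝ)..2 * π, kernelD (θ - θ') * g θ'

lemma continuous_kernelC : Continuous kernelC := by
  unfold kernelC kernel
  fun_prop

lemma measurable_kernelD : Measurable kernelD := by
  have : kernelD = fun θ => Real.cos θ *
      (if 0 < Real.sin θ then 1 else if Real.sin θ < 0 then -1 else 0) := by
    funext θ
    unfold kernelD
    rcases lt_trichotomy (Real.sin θ) 0 with h | h | h
    · simp [h, h.not_gt]
    · simp [h]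
    · simp [h]
  rw [this]
  refine Real.measurable_cos.mul (Measurable.ite ?_ measurable_const (Measurable.ite ?_
    measurable_const measurable_const))
  · exact measurableSet_lt measurable_const Real.measurable_sin
  · exact measurableSet_lt Real.measurable_sin measurable_const

lemma abs_kernelD_le (θ : ℝ) : ‖kernelD θ‖ ≤ 1 := by
  unfold kernelD
  rw [norm_mul, Real.norm_eq_abs, Real.norm_eq_abs]
  have h2 : |((SignType.sign (Real.sin θ) : SignType) : ℝ)| ≤ 1 := by
    rcases lt_trichotomy (Real.sin θ) 0 with h | h | h <;> simp [h]
  exact mul_le_one₀ (Real.abs_cos_le_one _) (abs_nonneg _) h2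

lemma exists_kernelC_bound : ∃ C, ∀ θ, ‖kernelC θ‖ ≤ C := by
  refine ⟨1 + ‖(2 * π)⁻¹ * ∫ s in (0 : ℝ)..2 * π, kernel s‖, fun θ => ?_⟩
  refine (norm_sub_le _ _).trans (add_le_add ?_ le_rfl)
  simpa [kernel] using Real.abs_sin_le_one θ

lemma kernelC_add_pi (θ : ℝ) : kernelC (θ + π) = kernelC θ := by
  simp [kernelC, kernel, Real.sin_add_pi]

lemma kernelC_add_two_pi (θ : ℝ) : kernelC (θ + 2 * π) = kernelC θ := by
  simp [kernelC, kernel]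

lemma kernelC_neg (θ : ℝ) : kernelC (-θ) = kernelC θ := by
  simp [kernelC, kernel]

lemma integral_kernelC : ∫ θ in (0 : ℝ)..2 * π, kernelC θ = 0 := by
  unfold kernelC
  rw [intervalIntegral.integral_sub
    (Continuous.intervalIntegrable (by unfold kernel; fun_prop) _ _) (by simp)]
  simp only [intervalIntegral.integral_const, smul_eq_mul, sub_zero]
  field_simp
  ring

lemma integral_kernelC_sub (s : ℝ) : ∫ θ in (0 : ℝ)..2 * π, kernelC (θ - s) = 0 := by
  rw [intervalIntegral.integral_comp_sub_right (fun x => kernelC x)]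
  have hp : Function.Periodic kernelC (2 * π) := kernelC_add_two_pi
  have := hp.intervalIntegral_add_eq (0 - s) 0
  rw [zero_add, integral_kernelC] at this
  have e : 2 * π - s = 0 - s + 2 * π := by ring
  rw [e, this]

lemma hasDerivAt_kernelC {x : ℝ} (hx : Real.sin x ≠ 0) : HasDerivAt kernelC (kernelD x) x := by
  have h := ((hasDerivAt_abs hx).comp x (Real.hasDerivAt_sin x)).sub_const
    ((2 * π)⁻¹ * ∫ s in (0 : ℝ)..2 * π, kernel s)
  rw [mul_comm (SignType.sign (Real.sin x) : ℝ)] at h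
  exact h

lemma hasWeakDeriv_kernelC_sub (s : ℝ) :
    HasWeakDeriv (fun θ => kernelC (θ - s)) (fun θ => kernelD (θ - s)) := by
  have hcount : {x : ℝ | Real.sin (x - s) = 0}.Countable := by
    refine (countable_range (fun n : ℤ => (n : ℝ) * π + s)).mono fun x hx => ?_
    obtain ⟨n, hn⟩ := Real.sin_eq_zero_iff.1 hx
    exact ⟨n, by simp [hn]⟩
  refine hasWeakDeriv_of_off_countable hcount
    (continuous_kernelC.comp (continuous_id.sub continuous_const)) ?_ fun x hx => ?_
  · exact Integrable.of_bound (measurable_kernelD.comp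
      (measurable_id.sub measurable_const)).aestronglyMeasurable 1
      (Eventually.of_forall fun x => abs_kernelD_le _)
  · have := (hasDerivAt_kernelC (x := x - s) hx).comp x ((hasDerivAt_id x).sub_const s)
    rw [mul_one] at this
    exact this

lemma integrable_kernel_prod {k g w : ℝ → ℝ} {C D : ℝ} (hk : Measurable k) (hC : ∀ x, ‖k x‖ ≤ C)
    (hw : Continuous w) (hD : ∀ x, ‖w x‖ ≤ D) (hg : Integrable g per) :
    Integrable (Function.uncurry fun θ θ' => w θ * (k (θ - θ') * g θ')) (per.prod per) := by
  have h1 : Integrable (fun p : ℝ × ℝ => g p.2) (per.prod per) := hg.comp_snd per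
  have h2 := h1.bdd_mul (c := C) (f := fun p : ℝ × ℝ => k (p.1 - p.2))
    (hk.comp (measurable_fst.sub measurable_snd)).aestronglyMeasurable
    (Eventually.of_forall fun p => hC _)
  exact h2.bdd_mul (c := D) (f := fun p : ℝ × ℝ => w p.1)
    (hw.measurable.comp measurable_fst).aestronglyMeasurable (Eventually.of_forall fun p => hD _)

lemma integral_mul_conv {k g w : ℝ → ℝ} {C D : ℝ} (hk : Measurable k) (hC : ∀ x, ‖k x‖ ≤ C)
    (hw : Continuous w) (hD : ∀ x, ‖w x‖ ≤ D) (hg : Integrable g per) :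
    ∫ θ in (0 : ℝ)..2 * π, (∫ θ' in (0 : ℝ)..2 * π, k (θ - θ') * g θ') * w θ =
      ∫ θ' in (0 : ℝ)..2 * π, g θ' * ∫ θ in (0 : ℝ)..2 * π, k (θ - θ') * w θ := by
  simp only [integral_per]
  calc _ = ∫ θ, ∫ θ', w θ * (k (θ - θ') * g θ') ∂per ∂per := by
        simp only [integral_const_mul]
        simp only [mul_comm]
    _ = ∫ θ', ∫ θ, w θ * (k (θ - θ') * g θ') ∂per ∂per :=
        integral_integral_swap (integrable_kernel_prod hk hC hw hD hg)
    _ = _ := by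
        refine integral_congr_ae (Eventually.of_forall fun θ' => ?_)
        simp only [← integral_const_mul]
        refine integral_congr_ae (Eventually.of_forall fun θ => ?_)
        simp only
        ring

lemma isAdmissible_conv {g : ℝ → ℝ} (hg : Integrable g per)
    (heven : ∀ᵐ θ ∂(volume.restrict (Ioo 0 (2 * π))), g (2 * π - θ) = g θ) :
    IsAdmissible (conv g) (convD g) where
  weak φ hφ := by
    obtain ⟨⟨C, hC⟩, ⟨D, hD⟩, h1, h2⟩ := hφ.bounds
    obtain ⟨B, hB⟩ := exists_kernelC_bound
    unfold conv convD
    rw [integral_mul_conv continuous_kernelC.measurable hB h2 hD hg,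
      integral_mul_conv measurable_kernelD abs_kernelD_le h1 hC hg,
      ← intervalIntegral.integral_neg]
    congr 1
    funext s
    rw [hasWeakDeriv_kernelC_sub s φ hφ]
    ring
  mean := by
    obtain ⟨B, hB⟩ := exists_kernelC_bound
    have := integral_mul_conv (w := fun _ => 1) (D := 1) continuous_kernelC.measurable hB
      continuous_const (by simp) hg
    simp only [mul_one, integral_kernelC_sub, mul_zero, intervalIntegral.integral_zero] at this
    exact this
  periodic := Eventually.of_forall fun θ => by
    unfold conv
    congr 1
    funext s
    rw [← kernelC_add_pi (θ - s)]
    congr 2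
    ring
  even := Eventually.of_forall fun θ => by
    unfold conv
    have h := intervalIntegral.integral_comp_sub_left (a := 0) (b := 2 * π)
      (fun s => kernelC (2 * π - θ - s) * g s) (2 * π)
    simp only [sub_self, sub_zero] at h
    rw [← h, intervalIntegral.integral_of_le period_nonneg,
      intervalIntegral.integral_of_le period_nonneg, integral_Ioc_eq_integral_Ioo,
      integral_Ioc_eq_integral_Ioo]
    refine integral_congr_ae ?_
    filter_upwards [heven] with s hs
    rw [hs, ← kernelC_neg (θ - s)]
    congr 2
    ring

lemma aestronglyMeasurable_conv {k g : ℝ → ℝ} (hk : Measurable k) (hg : Integrable g per) :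
    AEStronglyMeasurable (fun θ => ∫ θ' in (0 : ℝ)..2 * π, k (θ - θ') * g θ') per := by
  simp only [integral_per]
  have h1 : AEStronglyMeasurable (fun p : ℝ × ℝ => k (p.1 - p.2) * g p.2) (per.prod per) :=
    (hk.comp (measurable_fst.sub measurable_snd)).aestronglyMeasurable.mul
      (hg.comp_snd per).aestronglyMeasurable
  exact h1.integral_prod_right'

lemma memLp_conv {k g : ℝ → ℝ} {C : ℝ} (hk : Measurable k) (hC : ∀ x, ‖k x‖ ≤ C)
    (hg : Integrable g per) :
    MemLp (fun θ => ∫ θ' in (0 : ℝ)..2 * π, k (θ - θ') * g θ') 2 per := by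
  refine MemLp.of_bound (aestronglyMeasurable_conv hk hg) (∫ s, C * ‖g s‖ ∂per)
    (Eventually.of_forall fun θ => ?_)
  rw [integral_per]
  refine norm_integral_le_of_norm_le (hg.norm.const_mul C) (Eventually.of_forall fun s => ?_)
  rw [norm_mul]
  exact mul_le_mul_of_nonneg_right (hC _) (norm_nonneg _)

/-- The weak derivative of `gammaFun V`. -/
def gammaDer (V : ℝ → ℝ) (θ : ℝ) : ℝ :=
  convD (fun θ' => Real.exp (-V θ')) θ / ∫ θ' in (0 : ℝ)..2 * π, Real.exp (-V θ')

lemma gamma_wellDefined (V : H) :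
    MemLp (gammaFun V.fn) 2 per ∧ MemLp (gammaDer V.fn) 2 per ∧
      IsAdmissible (gammaFun V.fn) (gammaDer V.fn) := by
  by_cases hI : Integrable (fun θ => Real.exp (-V.fn θ)) per
  · obtain ⟨B, hB⟩ := exists_kernelC_bound
    have m1 := memLp_conv continuous_kernelC.measurable hB hI
    have m2 := memLp_conv measurable_kernelD abs_kernelD_le hI
    have hadm := isAdmissible_conv hI (by
      filter_upwards [(V.2 : IsAdmissible _ _).even] with θ hθ
      unfold H.fn
      rw [hθ])
    set Z := ∫ θ' in (0 : ℝ)..2 * π, Real.exp (-V.fn θ') with hZ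
    have e1 : gammaFun V.fn = fun θ => Z⁻¹ * conv (fun θ' => Real.exp (-V.fn θ')) θ := by
      funext θ
      rw [gammaFun, ← hZ, div_eq_inv_mul]
    have e2 : gammaDer V.fn = fun θ => Z⁻¹ * convD (fun θ' => Real.exp (-V.fn θ')) θ := by
      funext θ
      rw [gammaDer, ← hZ, div_eq_inv_mul]
    rw [e1, e2]
    exact ⟨m1.const_mul _, m2.const_mul _, hadm.smul _⟩
  · have hZ : ∫ θ' in (0 : ℝ)..2 * π, Real.exp (-V.fn θ') = 0 := by
      rw [integral_per, integral_undef hI]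
    have e1 : gammaFun V.fn = fun _ => 0 := by
      funext θ
      rw [gammaFun, hZ, div_zero]
    have e2 : gammaDer V.fn = fun _ => 0 := by
      funext θ
      rw [gammaDer, hZ, div_zero]
    rw [e1, e2]
    exact ⟨MemLp.zero', MemLp.zero', IsAdmissible.zero⟩

/-- The operator `Γ : H → H`,
`Γ(V)(θ) = ∫₀^{2π} K̃(θ - θ') e^{-V(θ')} dθ' / ∫₀^{2π} e^{-V(θ')} dθ'`. -/
def Γ (V : H) : H :=
  H.mk (gammaFun V.fn) (gammaDer V.fn) (gamma_wellDefined V).1 (gamma_wellDefined V).2.1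
    (gamma_wellDefined V).2.2

/-- The fixed point formulation `V = lam Γ(V)` of the equilibrium problem. -/
def Solves (lam : ℝ) (V : H) : Prop := V = lam • Γ V

/-- `f` is, almost everywhere on the period, the density `e^{-V} / ∫ e^{-V}`. -/
def IsDensityOf (f : ℝ → ℝ) (V : H) : Prop :=
  ∀ᵐ θ ∂per, f θ = Real.exp (-V.fn θ) / ∫ θ' in (0 : ℝ)..2 * π, Real.exp (-V.fn θ')

/-! ### Bifurcation and stability -/

/-- `lam0` is a bifurcation value: nontrivial solutions exist arbitrarily close to `(lam0, 0)`. -/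
def IsBifurcationValue (lam0 : ℝ) : Prop :=
  ∀ U ∈ 𝓝 ((lam0, 0) : ℝ × H), ∃ p ∈ U, p.2 ≠ 0 ∧ Solves p.1 p.2

/-- Near `(lam0, 0)` the nontrivial solutions form a continuous curve
`t ↦ (lam0 + μ t, t (φ + z t))`, `0 < |t| < δ`, with `μ 0 = 0`, `z 0 = 0` and `z t ⊥ φ`. -/
structure IsBranch (lam0 : ℝ) (φ : H) (δ : ℝ) (μ : ℝ → ℝ) (z : ℝ → H) : Prop where
  pos : 0 < δ
  cont_μ : ContinuousOn μ (Ioo (-δ) δ)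
  cont_z : ContinuousOn z (Ioo (-δ) δ)
  μ_zero : μ 0 = 0
  z_zero : z 0 = 0
  orth : ∀ t ∈ Ioo (-δ) δ, inner ℝ φ (z t) = 0
  zeros : ∃ U ∈ 𝓝 ((lam0, 0) : ℝ × H),
    {p ∈ U | Solves p.1 p.2} =
      {p | ∃ t ∈ Ioo (-δ) δ, p = (lam0 + μ t, t • (φ + z t))} ∪ {p ∈ U | p.2 = 0}

/-- The bounded operator `A - w` on the complexification `E × E` (`(x, y)` stands for `x + i y`)
of the real space `E`. -/
def complexShift {E : Type*} [NormedAddCommGroup E] [NormedSpace ℝ E] (A : E →L[ℝ] E) (w : ℂ) :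
    (E × E) →L[ℝ] (E × E) :=
  ((A ∘L ContinuousLinearMap.fst ℝ E E) - w.re • ContinuousLinearMap.fst ℝ E E
      + w.im • ContinuousLinearMap.snd ℝ E E).prod
    ((A ∘L ContinuousLinearMap.snd ℝ E E) - w.re • ContinuousLinearMap.snd ℝ E E
      - w.im • ContinuousLinearMap.fst ℝ E E)

/-- The (complex) spectrum of a bounded operator on a real normed space. -/
def complexSpectrum {E : Type*} [NormedAddCommGroup E] [NormedSpace ℝ E] (A : E →L[ℝ] E) :
    Set ℂ := {w | ¬ IsUnit (complexShift A w)}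

/-- Linearized stability of a solution `V`: the derivative `I - lam DΓ(V)` exists and its spectrum
lies in the open right half plane. -/
def IsStable (lam : ℝ) (V : H) : Prop :=
  ∃ A : H →L[ℝ] H, HasFDerivAt (fun W : H => W - lam • Γ W) A V ∧
    ∀ w ∈ complexSpectrum A, 0 < w.re

/-- Linearized instability of a solution `V`: the derivative `I - lam DΓ(V)` exists and its
spectrum meets the open left half plane. -/
def IsUnstable (lam : ℝ) (V : H) : Prop :=
  ∃ A : H →L[ℝ] H, HasFDerivAt (fun W : H => W - lam • Γ W) A V ∧
    ∃ w ∈ complexSpectrum A, w.re < 0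

end Onsager

end

/-!
The key device is the operator `energyOp` on `H`, diagonal in the basis of the cosines
`cos (2mθ)` with entries `(4m² - 1) / (4m² + 1)`. Since the Fourier coefficients of the kernel are
`-4 / (π (4m² - 1))`, it turns `Γ(V)` into a multiple of the Riesz representative of the functional
`W ↦ ∫ e^{-V} W` (`energyOp_Γ`). As `H` embeds continuously into the bounded continuous functions,
`Γ` is smooth. In the form `⟪energyOp V, W⟫`, which is equivalent to the inner product, the
derivative of `Γ` is four times a covariance (`inner_energyOp_Γderiv`); in particular it is
symmetric, and at `V = 0` it is diagonal with entries `1 / lam_m`, where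
`lam_m = (4m² - 1) π / 2`.

Uniqueness for weak interaction compares two quantities for `g = f - 1 / (2π)`: the symmetrised
relative entropy `∫ g (log f - log (1 / (2π)))` is at least `‖g‖₁²`, and the equation identifies it
with `-lam ∬ K g g`, which is at most `lam ‖g‖₁² / 2` because `K` takes values in `[0, 1]` and `g`
has mean zero. Hence `f` is constant even for `lam < 2`.

Away from the `lam_m` the linearisation at `0` is bounded below, so no bifurcation occurs. At `lam_m`
the kernel is spanned by the cosine `φ`. The blow-up `V = t (φ + z)` turns the equation into one that
is smooth in `(t, z)` and in the parameter, and the implicit function theorem yields the branch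
(`SimpleEigen.exists_branch`); all small nontrivial solutions lie on it because they are nearly
parallel to `φ`. Expanding the exponential to third order and projecting the equation onto the modes
`m` and `2m` gives `μ(t) = κ t² + o(t²)` with
`κ = (lam_m / 8) (1 - lam_m / (lam_{2m} - lam_m)) > 0` (`tendsto_branch_parameter`). As `μ` is of
class `C²`, it is strictly monotone on either side of `0`, and exactly two small solutions exist
just above `lam_m`.

For the stability, `A = 1 - lam DΓ(V)` is symmetric in the energy form. If its form is
coercive, then by the Lax–Milgram lemma on the complexification its spectrum lies in the right half
plane; if its form takes a negative value, an extremal argument produces a negative point of the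
spectrum. For `m ≥ 2` the form is negative on `cos 2θ` already at the bifurcation point. For
`m = 1` it is coercive on the complement of `φ`, while differentiating the equation along the branch
gives `A V'(t) = (μ'(t) / lam) V(t)`, so that the form at the tangent `V'(t)` has the sign of
`t μ'(t) > 0`.
-/

noncomputable section

namespace Onsager

open scoped BoundedContinuousFunction

/-! ### Fourier cosine series of `π`-periodic even functions -/

lemma integral_cos_int_mul {n : ℤ} (hn : n ≠ 0) :
    ∫ θ in (0 : ℝ)..2 * π, Real.cos (n * θ) = 0 := by
  have hn' : (n : ℝ) ≠ 0 := by exact_mod_cast hn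
  rw [intervalIntegral.integral_comp_mul_left (fun x => Real.cos x) hn', integral_cos]
  have : Real.sin ((n : ℝ) * (2 * π)) = 0 := by
    have := Real.sin_int_mul_pi (2 * n)
    push_cast at this
    rw [← this]; ring_nf
  simp [this]

lemma integral_cos_mul_cos (j m : ℕ) (hm : m ≠ 0) :
    ∫ θ in (0 : ℝ)..2 * π, Real.cos (2 * j * θ) * Real.cos (2 * m * θ) =
      if j = m then π else 0 := by
  have e : ∀ θ : ℝ, Real.cos (2 * j * θ) * Real.cos (2 * m * θ) =
      (Real.cos ((2 * j - 2 * m : ℤ) * θ) + Real.cos ((2 * j + 2 * m : ℤ) * θ)) / 2 := by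
    intro θ
    push_cast
    rw [sub_mul, add_mul, Real.cos_sub, Real.cos_add]
    ring
  simp only [e]
  rw [intervalIntegral.integral_div, intervalIntegral.integral_add
    (Continuous.intervalIntegrable (by fun_prop) _ _)
    (Continuous.intervalIntegrable (by fun_prop) _ _),
    integral_cos_int_mul (n := 2 * j + 2 * m) (by omega)]
  split_ifs with h
  · subst h
    simp
  · rw [integral_cos_int_mul (by omega)]
    simp

lemma integral_eq_half_add_half {u : ℝ → ℝ} (hu : Integrable u per) :
    ∫ θ in (0 : ℝ)..2 * π, u θ = ∫ θ in (0 : ℝ)..π, (u θ + u (θ + π)) := by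
  have hp := Real.pi_pos
  have hI : IntervalIntegrable u volume 0 (2 * π) :=
    (intervalIntegrable_iff_integrableOn_Ioc_of_le period_nonneg).2 hu
  have h1 : IntervalIntegrable u volume 0 π := hI.mono_set (by
    rw [uIcc_of_le hp.le, uIcc_of_le period_nonneg]
    exact Icc_subset_Icc_right (by linarith))
  have h2 : IntervalIntegrable u volume π (2 * π) := hI.mono_set (by
    rw [uIcc_of_le (by linarith), uIcc_of_le period_nonneg]
    exact Icc_subset_Icc_left hp.le)
  have h3 : IntervalIntegrable (fun θ => u (θ + π)) volume 0 π := by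
    have := h2.comp_add_right π
    simpa [two_mul] using this
  rw [intervalIntegral.integral_add h1 h3, intervalIntegral.integral_comp_add_right,
    ← intervalIntegral.integral_add_adjacent_intervals h1 h2]
  simp [two_mul]

/-- A `π`-periodic function is orthogonal to the `π`-antiperiodic ones. -/
lemma integral_mul_eq_zero_of_antiperiodic {u w : ℝ → ℝ} (hu : Integrable u per)
    (hw : Continuous w) (hwb : ∀ x, ‖w x‖ ≤ 1)
    (hper : ∀ᵐ θ ∂(volume.restrict (Ioo 0 π)), u (θ + π) = u θ)
    (hanti : ∀ θ, w (θ + π) = -w θ) : ∫ θ in (0 : ℝ)..2 * π, u θ * w θ = 0 := by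
  rw [integral_eq_half_add_half
    (hu.mul_bdd hw.aestronglyMeasurable (Eventually.of_forall hwb))]
  rw [intervalIntegral.integral_of_le Real.pi_pos.le, integral_Ioc_eq_integral_Ioo]
  rw [integral_eq_zero_of_ae]
  filter_upwards [hper] with θ h
  simp [h, hanti]

/-- Functions even about `π` are orthogonal to the odd ones. -/
lemma integral_mul_eq_zero_of_odd {u w : ℝ → ℝ}
    (heven : ∀ᵐ θ ∂(volume.restrict (Ioo 0 (2 * π))), u (2 * π - θ) = u θ)
    (hodd : ∀ θ, w (2 * π - θ) = -w θ) : ∫ θ in (0 : ℝ)..2 * π, u θ * w θ = 0 := by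
  have h := intervalIntegral.integral_comp_sub_left (a := 0) (b := 2 * π)
    (fun s => u s * w s) (2 * π)
  simp only [sub_self, sub_zero] at h
  have h2 : ∫ θ in (0 : ℝ)..2 * π, u (2 * π - θ) * w (2 * π - θ) =
      - ∫ θ in (0 : ℝ)..2 * π, u θ * w θ := by
    rw [← intervalIntegral.integral_neg]
    rw [intervalIntegral.integral_of_le period_nonneg, intervalIntegral.integral_of_le
      period_nonneg, integral_Ioc_eq_integral_Ioo, integral_Ioc_eq_integral_Ioo]
    refine integral_congr_ae ?_
    filter_upwards [heven] with θ hθ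
    rw [hθ, hodd]
    ring
  linarith

/-- Completeness of the cosines `cos (2mθ)` among the `π`-periodic even functions: by the symmetries
all other Fourier coefficients vanish, so Parseval's identity applies. -/
lemma ae_eq_zero_of_cos_coeff {u : ℝ → ℝ} (hu : MemLp u 2 per)
    (hper : ∀ᵐ θ ∂(volume.restrict (Ioo 0 π)), u (θ + π) = u θ)
    (heven : ∀ᵐ θ ∂(volume.restrict (Ioo 0 (2 * π))), u (2 * π - θ) = u θ)
    (hcos : ∀ m : ℕ, ∫ θ in (0 : ℝ)..2 * π, u θ * Real.cos (2 * m * θ) = 0) :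
    u =ᵐ[per] 0 := by
  have hui : Integrable u per := hu.integrable (by norm_num)
  have hc : ∀ n : ℤ, ∫ θ in (0 : ℝ)..2 * π, u θ * Real.cos (n * θ) = 0 := by
    intro n
    rcases Int.even_or_odd' n with ⟨k, rfl | rfl⟩
    · have e : ∀ θ : ℝ, Real.cos (((2 * k : ℤ) : ℝ) * θ) = Real.cos (2 * (k.natAbs : ℕ) * θ) := by
        intro θ
        rw [← Real.cos_abs, Nat.cast_natAbs, ← Real.cos_abs (2 * _ * θ)]
        congr 1
        push_cast
        simp [abs_mul]
      simp only [e, hcos]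
    · refine integral_mul_eq_zero_of_antiperiodic hui (by fun_prop)
        (fun x => Real.abs_cos_le_one _) hper fun θ => ?_
      have e : ((2 * k + 1 : ℤ) : ℝ) * (θ + π) = (((2 * k + 1 : ℤ) : ℝ) * θ + π) + k * (2 * π) := by
        push_cast; ring
      rw [e, Real.cos_add_int_mul_two_pi, Real.cos_add_pi]
  have hs : ∀ n : ℤ, ∫ θ in (0 : ℝ)..2 * π, u θ * Real.sin (n * θ) = 0 := by
    intro n
    refine integral_mul_eq_zero_of_odd heven fun θ => ?_
    rw [mul_sub, Real.sin_int_mul_two_pi_sub]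
  have h0 : (0 : ℝ) < 2 * π := by positivity
  have hparseval := hasSum_sq_fourierCoeffOn (f := fun x => (u x : ℂ)) h0 hu.ofReal
  have hz : ∀ n, fourierCoeffOn h0 (fun x => (u x : ℂ)) n = 0 := by
    intro n
    rw [fourierCoeffOn_eq_integral]
    have e : ∀ x : ℝ, fourier (-n) (x : AddCircle (2 * π - 0)) • (u x : ℂ) =
        ((u x * Real.cos (n * x) : ℝ) : ℂ) - ((u x * Real.sin (n * x) : ℝ) : ℂ) * Complex.I := by
      intro x
      rw [fourier_coe_apply]
      have : 2 * π * Complex.I * ((-n : ℤ) : ℂ) * x / ((2 * π - 0 : ℝ) : ℂ) =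
          ((-(n * x) : ℝ) : ℂ) * Complex.I := by
        have : (π : ℂ) ≠ 0 := by exact_mod_cast Real.pi_ne_zero
        push_cast
        field_simp
        ring
      rw [this, Complex.exp_mul_I, ← Complex.ofReal_cos, ← Complex.ofReal_sin]
      simp only [Real.cos_neg, Real.sin_neg, smul_eq_mul]
      push_cast
      ring
    simp only [e]
    have i1 : Integrable (fun x : ℝ => ((u x * Real.cos (n * x) : ℝ) : ℂ)) per :=
      (hui.mul_bdd (c := 1)
        (by fun_prop : Continuous fun x : ℝ => Real.cos (n * x)).aestronglyMeasurable
        (Eventually.of_forall fun x => Real.abs_cos_le_one _)).ofReal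
    have i2 : Integrable (fun x : ℝ => ((u x * Real.sin (n * x) : ℝ) : ℂ)) per :=
      (hui.mul_bdd (c := 1)
        (by fun_prop : Continuous fun x : ℝ => Real.sin (n * x)).aestronglyMeasurable
        (Eventually.of_forall fun x => Real.abs_sin_le_one _)).ofReal
    rw [intervalIntegral.integral_sub, intervalIntegral.integral_mul_const,
      intervalIntegral.integral_ofReal, intervalIntegral.integral_ofReal, hc, hs]
    · simp
    · exact (intervalIntegrable_iff_integrableOn_Ioc_of_le period_nonneg).2 i1
    · exact (intervalIntegrable_iff_integrableOn_Ioc_of_le period_nonneg).2 (i2.mul_const _)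
  simp only [hz, norm_zero, ne_eq, OfNat.ofNat_ne_zero, not_false_eq_true, zero_pow] at hparseval
  have h1 := hparseval.unique hasSum_zero
  have h2 : ∫ x, u x ^ 2 ∂per = 0 := by
    have h3 : (2 * π - 0 : ℝ)⁻¹ ≠ 0 := by simp [Real.pi_ne_zero]
    have := (smul_eq_zero.1 h1).resolve_left h3
    rw [intervalIntegral.integral_of_le period_nonneg] at this
    simpa using this
  have h4 := (integral_eq_zero_iff_of_nonneg (fun x => sq_nonneg (u x)) hu.integrable_sq).1 h2
  filter_upwards [h4] with x hx
  simpa using hx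

lemma integral_abs_sin_mul_cos (m : ℕ) :
    ∫ θ in (0 : ℝ)..2 * π, kernel θ * Real.cos (2 * m * θ) = -(4 / (4 * (m : ℝ) ^ 2 - 1)) := by
  have hcont : Continuous fun θ : ℝ => kernel θ * Real.cos (2 * m * θ) := by
    unfold kernel; fun_prop
  rw [integral_eq_half_add_half hcont.integrableOn_Ioc]
  have hne1 : (2 * (m : ℝ) + 1) ≠ 0 := by positivity
  have hne2 : (2 * (m : ℝ) - 1) ≠ 0 := by
    intro h
    have h' : (2 * (m : ℝ)) = 1 := by linarith
    norm_cast at h'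
    omega
  have hne3 : (4 * (m : ℝ) ^ 2 - 1) ≠ 0 := by
    have : (4 * (m : ℝ) ^ 2 - 1) = (2 * m + 1) * (2 * m - 1) := by ring
    rw [this]
    exact mul_ne_zero hne1 hne2
  have hd : ∀ x : ℝ, HasDerivAt (fun x => -Real.cos ((2 * m + 1) * x) / (2 * m + 1)
      + Real.cos ((2 * m - 1) * x) / (2 * m - 1)) (2 * (Real.sin x * Real.cos (2 * m * x))) x := by
    intro x
    have h1 : HasDerivAt (fun y : ℝ => (2 * (m : ℝ) + 1) * y) (2 * m + 1) x := by
      simpa using (hasDerivAt_id x).const_mul (2 * (m : ℝ) + 1)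
    have h2 : HasDerivAt (fun y : ℝ => (2 * (m : ℝ) - 1) * y) (2 * m - 1) x := by
      simpa using (hasDerivAt_id x).const_mul (2 * (m : ℝ) - 1)
    have h3 := (h1.cos.neg.div_const (2 * (m : ℝ) + 1)).add (h2.cos.div_const (2 * (m : ℝ) - 1))
    refine h3.congr_deriv ?_
    rw [add_mul, sub_mul, Real.sin_add, Real.sin_sub]
    field_simp
    simp
    ring
  rw [intervalIntegral.integral_congr (g := fun x => 2 * (Real.sin x * Real.cos (2 * m * x))),
    intervalIntegral.integral_eq_sub_of_hasDerivAt (fun x _ => hd x)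
    (Continuous.intervalIntegrable (by fun_prop) _ _)]
  · have hfac : (4 * (m : ℝ) ^ 2 - 1) = (2 * m + 1) * (2 * m - 1) := by ring
    have e1 : Real.cos ((2 * m + 1) * π) = -1 := by
      have : (2 * (m : ℝ) + 1) * π = π + m * (2 * π) := by ring
      rw [this, Real.cos_add_nat_mul_two_pi, Real.cos_pi]
    have e2 : Real.cos ((2 * m - 1) * π) = -1 := by
      have : (2 * (m : ℝ) - 1) * π = m * (2 * π) - π := by ring
      rw [this, Real.cos_nat_mul_two_pi_sub, Real.cos_pi]
    rw [e1, e2, hfac]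
    simp only [mul_zero, Real.cos_zero]
    field_simp
    ring
  · intro x hx
    rw [uIcc_of_le Real.pi_pos.le] at hx
    have hs := Real.sin_nonneg_of_mem_Icc hx
    have e : 2 * (m : ℝ) * (x + π) = 2 * m * x + m * (2 * π) := by ring
    simp only [kernel, Real.sin_add_pi, abs_neg, e, Real.cos_add_nat_mul_two_pi, abs_of_nonneg hs]
    ring

lemma fourierCos_kernel_zero : fourierCos kernel 0 = 2 / π := by
  have := integral_abs_sin_mul_cos 0
  simp only [Nat.cast_zero, mul_zero, zero_mul, Real.cos_zero, mul_one] at this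
  rw [fourierCos, if_pos rfl, this]
  field_simp
  norm_num

lemma fourierCos_kernel {m : ℕ} (hm : 1 ≤ m) :
    fourierCos kernel m = -(4 / (π * (4 * (m : ℝ) ^ 2 - 1))) := by
  rw [fourierCos, if_neg (by omega), integral_abs_sin_mul_cos]
  rw [mul_neg, ← div_eq_inv_mul, div_div, mul_comm π]

lemma one_le_cast_sq {m : ℕ} (hm : 1 ≤ m) : (1 : ℝ) ≤ (m : ℝ) ^ 2 := by
  have : (1 : ℝ) ≤ m := by exact_mod_cast hm
  nlinarith

lemma summable_inv_four_sq : Summable fun m : ℕ => 4 / (π * (4 * ((m + 1 : ℕ) : ℝ) ^ 2 - 1)) := by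
  have h1 : Summable fun m : ℕ => (4 / (3 * π)) * (1 / ((m + 1 : ℕ) : ℝ) ^ 2) :=
    (((summable_nat_add_iff 1).2 (Real.summable_one_div_nat_pow.2 one_lt_two))).mul_left _
  refine h1.of_nonneg_of_le (fun m => ?_) fun m => ?_
  · have := one_le_cast_sq (m := m + 1) (by omega)
    have := Real.pi_pos
    exact div_nonneg (by norm_num) (mul_nonneg this.le (by linarith))
  · have h := one_le_cast_sq (m := m + 1) (by omega)
    have hp := Real.pi_pos
    rw [div_mul_div_comm, mul_one]
    refine div_le_div_of_nonneg_left (by norm_num) (by positivity) ?_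
    nlinarith

lemma summable_fourierCos : Summable fun m => ‖fourierCos kernel m‖ := by
  rw [← summable_nat_add_iff 1]
  refine summable_inv_four_sq.congr fun m => ?_
  have h := one_le_cast_sq (m := m + 1) (by omega)
  rw [fourierCos_kernel (by omega), norm_neg, Real.norm_of_nonneg]
  exact div_nonneg (by norm_num) (mul_nonneg Real.pi_pos.le (by linarith))

lemma abs_cos_nat (m : ℕ) (θ : ℝ) : ‖Real.cos (2 * m * θ)‖ ≤ 1 := Real.abs_cos_le_one _

lemma cos_nat_add_pi (m : ℕ) (θ : ℝ) : Real.cos (2 * m * (θ + π)) = Real.cos (2 * m * θ) := by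
  have e : 2 * (m : ℝ) * (θ + π) = 2 * m * θ + m * (2 * π) := by ring
  rw [e, Real.cos_add_nat_mul_two_pi]

lemma cos_nat_two_pi_sub (m : ℕ) (θ : ℝ) :
    Real.cos (2 * m * (2 * π - θ)) = Real.cos (2 * m * θ) := by
  have e : 2 * (m : ℝ) * (2 * π - θ) = ((2 * m : ℕ) : ℝ) * (2 * π) - 2 * m * θ := by
    push_cast; ring
  rw [e, Real.cos_nat_mul_two_pi_sub]

/-- An absolutely convergent cosine series may be integrated term by term. -/
lemma integral_tsum_cos_mul {c : ℕ → ℝ} (hc : Summable fun m => ‖c m‖) (m : ℕ) :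
    HasSum (fun j => c j * ∫ θ in (0 : ℝ)..2 * π, Real.cos (2 * j * θ) * Real.cos (2 * m * θ))
      (∫ θ in (0 : ℝ)..2 * π, (∑' j, c j * Real.cos (2 * j * θ)) * Real.cos (2 * m * θ)) := by
  have h := intervalIntegral.hasSum_integral_of_dominated_convergence (μ := volume)
    (a := 0) (b := 2 * π)
    (F := fun (j : ℕ) θ => c j * (Real.cos (2 * j * θ) * Real.cos (2 * m * θ)))
    (f := fun θ => (∑' j, c j * Real.cos (2 * j * θ)) * Real.cos (2 * m * θ))
    (fun j _ => ‖c j‖) (fun j => (by fun_prop : Continuous _).aestronglyMeasurable)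
    (fun j => Eventually.of_forall fun θ _ => by
      rw [norm_mul, norm_mul]
      exact mul_le_of_le_one_right (norm_nonneg _)
        (mul_le_one₀ (abs_cos_nat _ _) (norm_nonneg _) (abs_cos_nat _ _)))
    (Eventually.of_forall fun θ _ => hc)
    (by simp)
    (Eventually.of_forall fun θ _ => by
      have h1 : Summable fun j => c j * Real.cos (2 * j * θ) := by
        refine Summable.of_norm_bounded hc fun j => ?_
        rw [norm_mul]
        exact mul_le_of_le_one_right (norm_nonneg _) (abs_cos_nat _ _)
      have := h1.hasSum.mul_right (Real.cos (2 * m * θ))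
      simpa only [mul_assoc] using this)
  simpa only [intervalIntegral.integral_const_mul] using h

lemma continuous_tsum_cos {c : ℕ → ℝ} (hc : Summable fun m => ‖c m‖) :
    Continuous fun θ : ℝ => ∑' j, c j * Real.cos (2 * j * θ) :=
  continuous_tsum (fun j => by fun_prop) hc fun j θ => by
    rw [norm_mul]
    exact mul_le_of_le_one_right (norm_nonneg _) (abs_cos_nat _ _)

lemma fourierCos_kernel_eq (m : ℕ) (hm : m ≠ 0) :
    ∫ θ in (0 : ℝ)..2 * π, kernel θ * Real.cos (2 * m * θ) = π * fourierCos kernel m := by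
  rw [fourierCos, if_neg hm, mul_inv_cancel_left₀ Real.pi_ne_zero]

/-- The kernel is the sum of its cosine series: both sides are continuous with the same
coefficients. -/
lemma hasSum_abs_sin (θ : ℝ) :
    HasSum (fun m : ℕ => fourierCos kernel m * Real.cos (2 * m * θ)) |Real.sin θ| := by
  have hs := summable_fourierCos
  set g : ℝ → ℝ := fun θ => ∑' j, fourierCos kernel j * Real.cos (2 * j * θ) with hg
  have hgc : Continuous g := continuous_tsum_cos hs
  have hkc : Continuous kernel := by unfold kernel; fun_prop
  have hgp : ∀ x, g (x + π) = g x := fun x => by simp only [hg, cos_nat_add_pi]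
  have hkp : ∀ x, kernel (x + π) = kernel x := fun x => by simp [kernel, Real.sin_add_pi]
  have hsub : Continuous fun θ => kernel θ - g θ := hkc.sub hgc
  have hae : (fun θ => kernel θ - g θ) =ᵐ[per] 0 := by
    refine ae_eq_zero_of_cos_coeff ?_ (Eventually.of_forall fun x => by simp [hgp, hkp])
      (Eventually.of_forall fun x => ?_) fun m => ?_
    · have hb : ∀ x, ‖g x‖ ≤ ∑' m, ‖fourierCos kernel m‖ := fun x => by
        refine tsum_of_norm_bounded hs.hasSum fun j => ?_
        rw [norm_mul]
        exact mul_le_of_le_one_right (norm_nonneg _) (abs_cos_nat _ _)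
      refine memLp_of_continuous hsub (1 + ∑' m, ‖fourierCos kernel m‖) fun x => ?_
      refine (norm_sub_le _ _).trans (add_le_add ?_ (hb x))
      simpa [kernel] using Real.abs_sin_le_one x
    · simp only [hg, cos_nat_two_pi_sub]
      simp [kernel]
    · have h1 := integral_tsum_cos_mul hs m
      simp only [sub_mul]
      rw [intervalIntegral.integral_sub ((by fun_prop : Continuous _).intervalIntegrable _ _)
        ((by fun_prop : Continuous _).intervalIntegrable _ _), sub_eq_zero]
      refine HasSum.unique ?_ h1
      rcases eq_or_ne m 0 with rfl | hm
      · have h2 : ∀ j : ℕ, j ≠ 0 → fourierCos kernel j * ∫ θ in (0 : ℝ)..2 * π,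
            Real.cos (2 * j * θ) * Real.cos (2 * (0 : ℕ) * θ) = 0 := by
          intro j hj
          have := integral_cos_mul_cos 0 j hj
          simp only [mul_comm (Real.cos (2 * (j : ℝ) * _))]
          rw [this, if_neg (Ne.symm hj), mul_zero]
        convert hasSum_single 0 h2 using 1
        simp [fourierCos]
        field_simp
      · have h2 : ∀ j : ℕ, j ≠ m → fourierCos kernel j * ∫ θ in (0 : ℝ)..2 * π,
            Real.cos (2 * j * θ) * Real.cos (2 * m * θ) = 0 := by
          intro j hj
          rw [integral_cos_mul_cos j m hm, if_neg hj, mul_zero]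
        convert hasSum_single m h2 using 1
        rw [integral_cos_mul_cos m m hm, if_pos rfl, fourierCos_kernel_eq m hm, mul_comm]
  have heq : EqOn (fun θ => kernel θ - g θ) 0 (Ioc 0 (2 * π)) :=
    Measure.eqOn_Ioc_of_ae_eq (μ := volume) hae hsub.continuousOn continuousOn_const
  have hp : Function.Periodic (fun θ => kernel θ - g θ) π := fun x => by simp [hgp, hkp]
  obtain ⟨y, hy, hxy⟩ := hp.exists_mem_Ioc Real.pi_pos θ 0
  have hzero : kernel θ - g θ = 0 := by
    have := heq (x := y) ⟨hy.1, by linarith [hy.2, Real.pi_pos]⟩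
    exact hxy.trans this
  have h1 : Summable fun j => fourierCos kernel j * Real.cos (2 * j * θ) := by
    refine Summable.of_norm_bounded hs fun j => ?_
    rw [norm_mul]
    exact mul_le_of_le_one_right (norm_nonneg _) (abs_cos_nat _ _)
  have h2 := h1.hasSum
  have h3 : |Real.sin θ| = ∑' j, fourierCos kernel j * Real.cos (2 * j * θ) := by
    have : kernel θ = g θ := by linarith
    exact this
  rwa [h3]

/-- The cosine series at `θ = 0`, where the kernel vanishes: only `k_0` is positive. -/
lemma hasSum_abs_fourierCos : HasSum (fun m : ℕ => |fourierCos kernel (m + 1)|) (π / 2)⁻¹ := by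
  have h := hasSum_abs_sin 0
  simp only [mul_zero, Real.cos_zero, mul_one, Real.sin_zero, abs_zero] at h
  have h1 := ((hasSum_nat_add_iff' 1).2 h).neg
  simp only [Finset.range_one, Finset.sum_singleton, zero_sub, neg_neg, fourierCos_kernel_zero] at h1
  rw [inv_div]
  refine h1.congr_fun fun m => ?_
  have h := one_le_cast_sq (m := m + 1) (by omega)
  rw [abs_of_nonpos]
  rw [fourierCos_kernel (by omega), neg_nonpos]
  exact div_nonneg (by norm_num) (mul_nonneg Real.pi_pos.le (by linarith))

lemma neg_two_div_fourierCos {m : ℕ} (hm : 1 ≤ m) :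
    -2 / fourierCos kernel m = (4 * (m : ℝ) ^ 2 - 1) * π / 2 := by
  have h := one_le_cast_sq hm
  have : (4 * (m : ℝ) ^ 2 - 1) ≠ 0 := by linarith
  rw [fourierCos_kernel hm]
  field_simp
  norm_num

/-! ### Uniqueness for weak interaction -/

/-- The logarithmic mean is at most the arithmetic mean. -/
lemma two_mul_sq_div_add_le {x c : ℝ} (hx : 0 < x) (hc : 0 < c) :
    2 * (x - c) ^ 2 / (x + c) ≤ (x - c) * (Real.log x - Real.log c) := by
  wlog h : c ≤ x generalizing x c
  · have := this hc hx (le_of_not_ge h)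
    rw [add_comm] at this
    rw [← neg_sub x c, neg_sq] at this
    linarith
  have h1 := Real.le_log_one_add_of_nonneg (x := (x - c) / c) (div_nonneg (by linarith) hc.le)
  have e1 : 1 + (x - c) / c = x / c := by field_simp; ring
  rw [e1, Real.log_div hx.ne' hc.ne'] at h1
  have e2 : 2 * ((x - c) / c) / ((x - c) / c + 2) = 2 * (x - c) / (x + c) := by
    have : x + c ≠ 0 := by positivity
    have h2 : (x - c) / c + 2 = (x + c) / c := by field_simp; ring
    rw [h2]
    field_simp
  rw [e2] at h1
  calc 2 * (x - c) ^ 2 / (x + c) = (x - c) * (2 * (x - c) / (x + c)) := by ring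
    _ ≤ _ := mul_le_mul_of_nonneg_left h1 (by linarith)

/-- A lower bound that is linear in `|x - c|` and `x`, so that it can be integrated; the parameter
`a` will be the `L¹` distance to the constant density. -/
lemma two_mul_abs_sub_le {x c : ℝ} (hx : 0 < x) (hc : 0 < c) (a : ℝ) :
    2 * a * |x - c| - a ^ 2 * ((x + c) / 2) ≤ (x - c) * (Real.log x - Real.log c) := by
  refine le_trans ?_ (two_mul_sq_div_add_le hx hc)
  have h : 0 < x + c := by positivity
  rw [le_div_iff₀ h, ← sq_abs (x - c)]
  nlinarith [sq_nonneg (2 * |x - c| - a * (x + c))]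

lemma continuous_kernel : Continuous kernel := by unfold kernel; fun_prop

lemma abs_kernel_le (θ : ℝ) : ‖kernel θ‖ ≤ 1 := by simpa [kernel] using Real.abs_sin_le_one θ

lemma integral_kernelC_sub_left (θ : ℝ) : ∫ s in (0 : ℝ)..2 * π, kernelC (θ - s) = 0 := by
  refine Eq.trans ?_ (integral_kernelC_sub θ)
  congr 1
  funext s
  rw [← kernelC_neg, neg_sub]

lemma intervalIntegrable_kernel_mul {k f : ℝ → ℝ} {C : ℝ} (hk : Measurable k)
    (hC : ∀ x, ‖k x‖ ≤ C) (hf : Integrable f per) (θ : ℝ) :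
    IntervalIntegrable (fun s => k (θ - s) * f s) volume 0 (2 * π) :=
  (intervalIntegrable_iff_integrableOn_Ioc_of_le period_nonneg).2
    (hf.bdd_mul (c := C) (hk.comp (measurable_const.sub measurable_id)).aestronglyMeasurable
      (Eventually.of_forall fun _ => hC _))

/-- The potential of a density is, up to the constant mean part, `lam` times its convolution with
the centred kernel. -/
lemma potential_eq {f : ℝ → ℝ} (hf : Integrable f per) (lam θ : ℝ) :
    potential kernel lam f θ = lam * conv f θ +
      lam * (((2 * π)⁻¹ * ∫ s in (0 : ℝ)..2 * π, kernel s) * ∫ s in (0 : ℝ)..2 * π, f s) := by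
  obtain ⟨B, hB⟩ := exists_kernelC_bound
  rw [potential, conv, ← mul_add]
  congr 1
  rw [← intervalIntegral.integral_const_mul,
    ← intervalIntegral.integral_add
      (intervalIntegrable_kernel_mul continuous_kernelC.measurable hB hf θ)
      ((intervalIntegrable_iff_integrableOn_Ioc_of_le period_nonneg).2 (hf.const_mul _))]
  congr 1
  funext s
  simp only [kernelC]
  ring

lemma conv_const (c θ : ℝ) : conv (fun _ => c) θ = 0 := by
  rw [conv, intervalIntegral.integral_mul_const, integral_kernelC_sub_left, zero_mul]

lemma isEquilibrium_const {lam : ℝ} : IsEquilibrium kernel lam (fun _ => 1 / (2 * π)) where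
  nonneg _ := by positivity
  periodic _ := rfl
  integrable := by simp
  mass := by
    rw [intervalIntegral.integral_const, smul_eq_mul, sub_zero]
    field_simp
  eq θ := by
    simp only [potential_eq (integrable_const _), conv_const, intervalIntegral.integral_const]
    have := Real.exp_pos (-(lam * 0 + lam * (((2 * π)⁻¹ * ∫ s in (0 : ℝ)..2 * π, kernel s) *
      (2 * π - 0) • (1 / (2 * π)))))
    simp only [smul_eq_mul, sub_zero] at this ⊢
    field_simp

lemma IsEquilibrium.integrable_per {lam : ℝ} {f : ℝ → ℝ} (h : IsEquilibrium kernel lam f) :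
    Integrable f per :=
  (intervalIntegrable_iff_integrableOn_Ioc_of_le period_nonneg).1 h.integrable

lemma conv_congr {f g : ℝ → ℝ} (h : f =ᵐ[per] g) (θ : ℝ) : conv f θ = conv g θ := by
  rw [conv, conv, integral_per, integral_per]
  refine integral_congr_ae ?_
  filter_upwards [h] with s hs
  rw [hs]

lemma integral_congr_per {f g : ℝ → ℝ} (h : f =ᵐ[per] g) :
    ∫ s in (0 : ℝ)..2 * π, f s = ∫ s in (0 : ℝ)..2 * π, g s := by
  rw [integral_per, integral_per, integral_congr_ae h]

/-- An equilibrium density is determined by its values almost everywhere. -/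
lemma IsEquilibrium.eq_of_ae {lam : ℝ} {f g : ℝ → ℝ} (hf : IsEquilibrium kernel lam f)
    (hg : IsEquilibrium kernel lam g) (h : f =ᵐ[per] g) : f = g := by
  have hp : potential kernel lam f = potential kernel lam g := by
    funext θ
    rw [potential_eq hf.integrable_per, potential_eq hg.integrable_per, conv_congr h,
      integral_congr_per h]
  funext θ
  rw [hf.eq, hg.eq, hp]

/-- With a kernel of values in `[0, 1]`, the interaction energy of `g` of mean zero is controlled
by `‖g‖₁² / 2`, since the kernel may be replaced by `K - 1/2`. -/
lemma abs_conv_le {g : ℝ → ℝ} (hg : Integrable g per) (h0 : ∫ s in (0 : ℝ)..2 * π, g s = 0)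
    (θ : ℝ) : |conv g θ| ≤ 1 / 2 * ∫ s, |g s| ∂per := by
  obtain ⟨B, hB⟩ := exists_kernelC_bound
  set c := (2 * π)⁻¹ * ∫ s in (0 : ℝ)..2 * π, kernel s with hc
  have e : conv g θ = ∫ s in (0 : ℝ)..2 * π, (kernel (θ - s) - 1 / 2) * g s := by
    have h1 : conv g θ + (c - 1 / 2) * ∫ s in (0 : ℝ)..2 * π, g s =
        ∫ s in (0 : ℝ)..2 * π, (kernel (θ - s) - 1 / 2) * g s := by
      rw [conv, ← intervalIntegral.integral_const_mul, ← intervalIntegral.integral_add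
        (intervalIntegrable_kernel_mul continuous_kernelC.measurable hB hg θ)
        ((intervalIntegrable_iff_integrableOn_Ioc_of_le period_nonneg).2 (hg.const_mul _))]
      congr 1
      funext s
      simp only [kernelC, ← hc]
      ring
    rw [← h1, h0, mul_zero, add_zero]
  rw [e, integral_per, ← integral_const_mul, ← Real.norm_eq_abs]
  refine norm_integral_le_of_norm_le (hg.abs.const_mul _) (Eventually.of_forall fun s => ?_)
  rw [norm_mul]
  refine mul_le_mul_of_nonneg_right ?_ (norm_nonneg _)
  have h1 := abs_kernel_le (θ - s)
  have h2 : 0 ≤ kernel (θ - s) := abs_nonneg _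
  rw [Real.norm_eq_abs, abs_le] at h1 ⊢
  constructor <;> linarith [h1.1, h1.2]

lemma IsEquilibrium.pos {lam : ℝ} {f : ℝ → ℝ} (h : IsEquilibrium kernel lam f) (θ : ℝ) :
    0 < f θ := by
  refine lt_of_le_of_ne (h.nonneg θ) fun h0 => ?_
  rw [h.eq] at h0
  have hZ : ∫ θ' in (0 : ℝ)..2 * π, Real.exp (-potential kernel lam f θ') = 0 := by
    by_contra hne
    exact div_ne_zero (Real.exp_pos _).ne' hne h0.symm
  have : f = fun _ => 0 := by
    funext s
    rw [h.eq, hZ, div_zero]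
  have hm := h.mass
  rw [this] at hm
  simp at hm

/-- Below the threshold, a comparison of the symmetrised relative entropy with the constant
density (at least `‖f - f₀‖₁²`) and the interaction energy (at most `lam ‖f - f₀‖₁² / 2`) leaves
only the constant. -/
theorem IsEquilibrium.eq_const {lam : ℝ} (hlam : 0 < lam) (h2 : lam < 2) {f : ℝ → ℝ}
    (h : IsEquilibrium kernel lam f) : f = fun _ => 1 / (2 * π) := by
  have hfi := h.integrable_per
  have hfp := h.pos
  set c : ℝ := 1 / (2 * π) with hc
  have hcp : 0 < c := by positivity
  have hci : Integrable (fun _ : ℝ => c) per := integrable_const _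
  set g : ℝ → ℝ := fun θ => f θ - c with hg
  have hgi : Integrable g per := hfi.sub hci
  have hcm : ∫ s in (0 : ℝ)..2 * π, c = 1 := (isEquilibrium_const (lam := lam)).mass
  have hg0 : ∫ s in (0 : ℝ)..2 * π, g s = 0 := by
    rw [hg, intervalIntegral.integral_sub h.integrable (by simp), h.mass, hcm, sub_self]
  have hgper : ∫ s, g s ∂per = 0 := by rw [← integral_per, hg0]
  have hconv : ∀ θ, conv f θ = conv g θ := by
    intro θ
    obtain ⟨B, hB⟩ := exists_kernelC_bound
    have e : conv g θ = conv f θ - conv (fun _ => c) θ := by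
      rw [conv, conv, conv, ← intervalIntegral.integral_sub
        (intervalIntegrable_kernel_mul continuous_kernelC.measurable hB hfi θ)
        (intervalIntegrable_kernel_mul continuous_kernelC.measurable hB hci θ)]
      congr 1
      funext s
      simp only [hg]
      ring
    rw [e, conv_const, sub_zero]
  set N := ∫ s, |g s| ∂per with hN
  have hlog : ∃ b, ∀ θ, Real.log (f θ) - Real.log c = -(lam * conv g θ) + b := by
    refine ⟨-(lam * (((2 * π)⁻¹ * ∫ s in (0 : ℝ)..2 * π, kernel s) * ∫ s in (0 : ℝ)..2 * π, f s)) -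
      Real.log (∫ θ' in (0 : ℝ)..2 * π, Real.exp (-potential kernel lam f θ')) - Real.log c,
      fun θ => ?_⟩
    · have hf := h.eq θ
      have hZ : ∫ θ' in (0 : ℝ)..2 * π, Real.exp (-potential kernel lam f θ') ≠ 0 := by
        intro hZ
        rw [hZ, div_zero] at hf
        exact (hfp θ).ne' hf
      rw [hf, Real.log_div (Real.exp_pos _).ne' hZ, Real.log_exp, potential_eq hfi lam θ, hconv]
      ring
  obtain ⟨b, hb⟩ := hlog
  have hbd : ∀ θ, ‖conv g θ‖ ≤ 1 / 2 * N := abs_conv_le hgi hg0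
  obtain ⟨B, hB⟩ := exists_kernelC_bound
  have hcm : AEStronglyMeasurable (conv g) per :=
    aestronglyMeasurable_conv continuous_kernelC.measurable hgi
  have i1 : Integrable (fun θ => g θ * conv g θ) per :=
    hgi.mul_bdd hcm (Eventually.of_forall hbd)
  have i2 : Integrable (fun θ => g θ * (Real.log (f θ) - Real.log c)) per := by
    have : (fun θ => g θ * (Real.log (f θ) - Real.log c)) =
        fun θ => -lam * (g θ * conv g θ) + b * g θ := by
      funext θ
      rw [hb]
      ring
    rw [this]
    exact (i1.const_mul _).add (hgi.const_mul _)
  have upper : ∫ θ, g θ * (Real.log (f θ) - Real.log c) ∂per ≤ lam / 2 * N ^ 2 := by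
    have e : ∀ θ, g θ * (Real.log (f θ) - Real.log c) = -lam * (g θ * conv g θ) + b * g θ := by
      intro θ
      rw [hb]
      ring
    simp only [e]
    rw [integral_add (i1.const_mul _) (hgi.const_mul _), integral_const_mul, integral_const_mul,
      hgper, mul_zero, add_zero]
    have h3 : ‖∫ θ, g θ * conv g θ ∂per‖ ≤ ∫ θ, |g θ| * (1 / 2 * N) ∂per :=
      norm_integral_le_of_norm_le (hgi.abs.mul_const _) (Eventually.of_forall fun θ => by
        rw [norm_mul]
        exact mul_le_mul_of_nonneg_left (hbd θ) (norm_nonneg _))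
    rw [integral_mul_const, ← hN, Real.norm_eq_abs] at h3
    nlinarith [(abs_le.1 h3).1]
  have lower : N ^ 2 ≤ ∫ θ, g θ * (Real.log (f θ) - Real.log c) ∂per := by
    have i3 : Integrable (fun θ => 2 * N * |g θ|) per := hgi.abs.const_mul _
    have i4 : Integrable (fun θ => N ^ 2 * ((f θ + c) / 2)) per :=
      ((hfi.add hci).div_const 2).const_mul _
    have h3 : ∫ θ, (2 * N * |g θ| - N ^ 2 * ((f θ + c) / 2)) ∂per ≤
        ∫ θ, g θ * (Real.log (f θ) - Real.log c) ∂per :=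
      integral_mono (i3.sub i4) i2 fun θ => two_mul_abs_sub_le (hfp θ) hcp N
    rw [integral_sub i3 i4, integral_const_mul, integral_const_mul, integral_div,
      integral_add hfi hci, ← hN, ← integral_per f, ← integral_per (fun _ => c), h.mass,
      (isEquilibrium_const (lam := lam)).mass] at h3
    linarith
  have hN0 : N = 0 := by
    by_contra hne
    have : 0 < N ^ 2 := by positivity
    nlinarith
  have hae : g =ᵐ[per] 0 := by
    have := (integral_eq_zero_iff_of_nonneg (fun x => abs_nonneg (g x)) hgi.abs).1 hN0
    filter_upwards [this] with x hx
    simpa using hx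
  refine h.eq_of_ae isEquilibrium_const ?_
  filter_upwards [hae] with x hx
  have : f x - c = 0 := hx
  linarith

/-! ### The Hilbert space structure of `H` -/

lemma deriv_smoothTransition_eq_zero {x : ℝ} (h : x < 0 ∨ 1 < x) :
    deriv Real.smoothTransition x = 0 := by
  rcases h with h | h
  · have : Real.smoothTransition =ᶠ[𝓝 x] fun _ => 0 := by
      filter_upwards [Iio_mem_nhds h] with y hy using
        Real.smoothTransition.zero_of_nonpos (le_of_lt hy)
    rw [this.deriv_eq, deriv_const]
  · have : Real.smoothTransition =ᶠ[𝓝 x] fun _ => 1 := by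
      filter_upwards [Ioi_mem_nhds h] with y hy using
        Real.smoothTransition.one_of_one_le (le_of_lt hy)
    rw [this.deriv_eq, deriv_const]

lemma exists_bound_deriv_smoothTransition :
    ∃ M, 0 ≤ M ∧ ∀ x, |x + 1| * |deriv Real.smoothTransition x| ≤ M := by
  have hc : Continuous fun x : ℝ => |x + 1| * |deriv Real.smoothTransition x| := by
    have : Continuous (deriv Real.smoothTransition) :=
      (Real.smoothTransition.contDiff (n := 1)).continuous_deriv le_rfl
    fun_prop
  obtain ⟨M, hM⟩ := (isCompact_Icc (a := (0 : ℝ)) (b := 1)).exists_bound_of_continuousOn hc.continuousOn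
  refine ⟨M, (norm_nonneg _).trans (hM 0 (by simp)), fun x => ?_⟩
  by_cases hx : x ∈ Icc (0 : ℝ) 1
  · exact (le_abs_self _).trans (hM x hx)
  · rw [mem_Icc, not_and_or, not_le, not_le] at hx
    rw [deriv_smoothTransition_eq_zero hx, abs_zero, mul_zero]
    exact (norm_nonneg _).trans (hM 0 (by simp))

/-- A smooth cutoff, for large `n` equal to `1` on `[2 / n, 2 * π - 2 / n]` and to `0`
outside `[1 / n, 2 * π - 1 / n]`. -/
def cutoff (n : ℕ) (θ : ℝ) : ℝ :=
  Real.smoothTransition (n * θ - 1) * Real.smoothTransition (n * (2 * π - θ) - 1)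

lemma contDiff_cutoff (n : ℕ) : ContDiff ℝ ∞ (cutoff n) := by
  unfold cutoff
  exact (Real.smoothTransition.contDiff.comp (by fun_prop)).mul
    (Real.smoothTransition.contDiff.comp (by fun_prop))

lemma hasDerivAt_cutoff (n : ℕ) (θ : ℝ) : HasDerivAt (cutoff n)
    (n * deriv Real.smoothTransition (n * θ - 1) * Real.smoothTransition (n * (2 * π - θ) - 1) -
      Real.smoothTransition (n * θ - 1) * (n * deriv Real.smoothTransition (n * (2 * π - θ) - 1)))
    θ := by
  have hd : ∀ x, HasDerivAt Real.smoothTransition (deriv Real.smoothTransition x) x := fun x =>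
    (((Real.smoothTransition.contDiff (n := 1)).differentiable (by simp)) x).hasDerivAt
  have h1 : HasDerivAt (fun y : ℝ => (n : ℝ) * y - 1) n θ := by
    simpa using ((hasDerivAt_id θ).const_mul (n : ℝ)).sub_const 1
  have h2 : HasDerivAt (fun y : ℝ => (n : ℝ) * (2 * π - y) - 1) (-n) θ := by
    simpa using (((hasDerivAt_id θ).const_sub (2 * π)).const_mul (n : ℝ)).sub_const 1
  exact (((hd _).comp θ h1).mul ((hd _).comp θ h2)).congr_deriv (by
    simp only [Function.comp_apply]
    ring)

lemma abs_cutoff_le (n : ℕ) (θ : ℝ) : |cutoff n θ| ≤ 1 := by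
  rw [cutoff, abs_mul, abs_of_nonneg (Real.smoothTransition.nonneg _),
    abs_of_nonneg (Real.smoothTransition.nonneg _)]
  exact mul_le_one₀ (Real.smoothTransition.le_one _) (Real.smoothTransition.nonneg _)
    (Real.smoothTransition.le_one _)

lemma eventually_cutoff_eq_one {θ : ℝ} (hθ : θ ∈ Ioo 0 (2 * π)) :
    ∀ᶠ n : ℕ in atTop, cutoff n =ᶠ[𝓝 θ] fun _ => 1 := by
  have h1 : ∀ {a : ℝ}, 0 < a → ∀ᶠ n : ℕ in atTop, 2 < n * a := fun ha => by
    have : Tendsto (fun n : ℕ => (n : ℝ) * _) atTop atTop :=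
      tendsto_natCast_atTop_atTop.atTop_mul_const ha
    exact this.eventually_gt_atTop 2
  filter_upwards [h1 hθ.1, h1 (sub_pos.2 hθ.2)] with n hn1 hn2
  have c1 : ∀ᶠ y in 𝓝 θ, 2 < (n : ℝ) * y :=
    (by fun_prop : Continuous fun y : ℝ => (n : ℝ) * y).continuousAt.eventually_const_lt hn1
  have c2 : ∀ᶠ y in 𝓝 θ, 2 < (n : ℝ) * (2 * π - y) :=
    (by fun_prop : Continuous fun y : ℝ => (n : ℝ) * (2 * π - y)).continuousAt.eventually_const_lt hn2
  filter_upwards [c1, c2] with y h1 h2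
  rw [cutoff, Real.smoothTransition.one_of_one_le (by linarith),
    Real.smoothTransition.one_of_one_le (by linarith), one_mul]

lemma isTest_mul_cutoff {g : ℝ → ℝ} (hg : ContDiff ℝ ∞ g) {n : ℕ} (hn : 1 ≤ n) :
    IsTest fun θ => g θ * cutoff n θ := by
  have hn' : (0 : ℝ) < n := by exact_mod_cast hn
  have hsub : tsupport (fun θ => g θ * cutoff n θ) ⊆ Icc (1 / n : ℝ) (2 * π - 1 / n) := by
    refine closure_minimal (fun θ hθ => ?_) isClosed_Icc
    by_contra hne
    apply hθ
    rw [mem_Icc, not_and_or, not_le, not_le] at hne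
    rcases hne with h | h
    · have : (n : ℝ) * θ - 1 ≤ 0 := by
        rw [lt_div_iff₀ hn'] at h
        linarith
      simp [cutoff, Real.smoothTransition.zero_of_nonpos this]
    · have : (n : ℝ) * (2 * π - θ) - 1 ≤ 0 := by
        have : 2 * π - θ < 1 / n := by linarith
        rw [lt_div_iff₀ hn'] at this
        linarith
      simp [cutoff, Real.smoothTransition.zero_of_nonpos this]
  refine ⟨hg.mul (contDiff_cutoff n), ?_, hsub.trans fun x hx => ?_⟩
  · exact isCompact_Icc.of_isClosed_subset (isClosed_tsupport _) hsub
  · have : 0 < 1 / (n : ℝ) := by positivity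
    exact ⟨by linarith [hx.1], by linarith [hx.2]⟩

lemma ae_per_of_Ioo {P : ℝ → Prop} (h : ∀ᵐ θ, θ ∈ Ioo 0 (2 * π) → P θ) : ∀ᵐ θ ∂per, P θ := by
  rw [per, ← Measure.restrict_congr_set (Ioo_ae_eq_Ioc (μ := volume) (a := 0) (b := 2 * π)),
    ae_restrict_iff' measurableSet_Ioo]
  exact h

/-- The weak derivative may be tested against smooth functions that merely vanish at the end
points of the period: the derivative of the cutoff, of size `n`, lives at distance `O(1 / n)` from
them. -/
lemma HasWeakDeriv.integral_mul_deriv {u v g : ℝ → ℝ} (h : HasWeakDeriv u v)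
    (hu : Integrable u per) (hv : Integrable v per) (hg : ContDiff ℝ ∞ g) {K L : ℝ}
    (hgK : ∀ x, |g x| ≤ K) (hgL : ∀ x, |deriv g x| ≤ L)
    (h0 : ∀ x, |g x| ≤ L * |x|) (h2π : ∀ x, |g x| ≤ L * |2 * π - x|) :
    ∫ θ in (0 : ℝ)..2 * π, u θ * deriv g θ = -∫ θ in (0 : ℝ)..2 * π, v θ * g θ := by
  obtain ⟨M, hM0, hM⟩ := exists_bound_deriv_smoothTransition
  have hL : 0 ≤ L := (abs_nonneg _).trans (hgL 0)
  have hgd : ∀ x, HasDerivAt g (deriv g x) x := fun x =>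
    ((hg.differentiable (by simp)) x).hasDerivAt
  have hd : ∀ n θ, deriv (fun θ => g θ * cutoff n θ) θ =
      deriv g θ * cutoff n θ + g θ * deriv (cutoff n) θ := fun n θ =>
    ((hgd θ).mul (hasDerivAt_cutoff n θ).differentiableAt.hasDerivAt).deriv
  have hbnd : ∀ n θ, |deriv (fun θ => g θ * cutoff n θ) θ| ≤ L + 2 * (L * M) := by
    intro n θ
    rw [hd, (hasDerivAt_cutoff n θ).deriv]
    have e1 : |deriv g θ * cutoff n θ| ≤ L := by
      rw [abs_mul]
      exact (mul_le_of_le_one_right (abs_nonneg _) (abs_cutoff_le n θ)).trans (hgL θ)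
    have key : ∀ x s : ℝ, |g θ| ≤ L * |x| → |s| ≤ 1 →
        |g θ * (n * deriv Real.smoothTransition (n * x - 1) * s)| ≤ L * M := by
      intro x s hx hs
      rw [abs_mul, abs_mul, abs_mul]
      have h1 := hM (n * x - 1)
      rw [sub_add_cancel, abs_mul] at h1
      calc |g θ| * (|(n : ℝ)| * |deriv Real.smoothTransition (n * x - 1)| * |s|)
          ≤ (L * |x|) * (|(n : ℝ)| * |deriv Real.smoothTransition (n * x - 1)| * 1) := by gcongr
        _ = L * (|(n : ℝ)| * |x| * |deriv Real.smoothTransition (n * x - 1)|) := by ring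
        _ ≤ _ := by gcongr
    have hs : ∀ x, |Real.smoothTransition x| ≤ 1 := fun x => by
      rw [abs_of_nonneg (Real.smoothTransition.nonneg _)]
      exact Real.smoothTransition.le_one x
    have e2 := key θ _ (h0 θ) (hs (n * (2 * π - θ) - 1))
    have e3 := key (2 * π - θ) _ (h2π θ) (hs (n * θ - 1))
    have e4 : g θ * (n * deriv Real.smoothTransition (n * θ - 1) *
        Real.smoothTransition (n * (2 * π - θ) - 1) - Real.smoothTransition (n * θ - 1) *
        (n * deriv Real.smoothTransition (n * (2 * π - θ) - 1))) =
        g θ * (n * deriv Real.smoothTransition (n * θ - 1) *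
        Real.smoothTransition (n * (2 * π - θ) - 1)) - g θ *
        (n * deriv Real.smoothTransition (n * (2 * π - θ) - 1) *
          Real.smoothTransition (n * θ - 1)) := by ring
    rw [e4]
    refine (abs_add_le _ _).trans ?_
    refine (add_le_add e1 (abs_sub _ _)).trans ?_
    linarith
  have hioo : ∀ᵐ θ ∂per, θ ∈ Ioo 0 (2 * π) :=
    ae_per_of_Ioo (Eventually.of_forall fun _ h => h)
  have lim1 : Tendsto (fun n : ℕ => ∫ θ, u θ * deriv (fun θ => g θ * cutoff n θ) θ ∂per) atTop
      (𝓝 (∫ θ, u θ * deriv g θ ∂per)) := by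
    refine tendsto_integral_filter_of_dominated_convergence
      (fun θ => |u θ| * (L + 2 * (L * M))) ?_ ?_ (hu.abs.mul_const _) ?_
    · refine Eventually.of_forall fun n => hu.aestronglyMeasurable.mul ?_
      exact ((hg.mul (contDiff_cutoff n)).continuous_deriv (by simp)).aestronglyMeasurable
    · refine Eventually.of_forall fun n => Eventually.of_forall fun θ => ?_
      rw [norm_mul]
      exact mul_le_mul_of_nonneg_left (hbnd n θ) (norm_nonneg _)
    · filter_upwards [hioo] with θ hθ
      refine tendsto_const_nhds.congr' ?_
      filter_upwards [eventually_cutoff_eq_one hθ] with n hn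
      rw [hd, hn.deriv_eq, hn.eq_of_nhds]
      simp
  have lim2 : Tendsto (fun n : ℕ => ∫ θ, v θ * (g θ * cutoff n θ) ∂per) atTop
      (𝓝 (∫ θ, v θ * g θ ∂per)) := by
    refine tendsto_integral_filter_of_dominated_convergence
      (fun θ => |v θ| * K) ?_ ?_ (hv.abs.mul_const _) ?_
    · refine Eventually.of_forall fun n => hv.aestronglyMeasurable.mul ?_
      exact (hg.mul (contDiff_cutoff n)).continuous.aestronglyMeasurable
    · refine Eventually.of_forall fun n => Eventually.of_forall fun θ => ?_
      rw [norm_mul, norm_mul]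
      refine mul_le_mul_of_nonneg_left ?_ (norm_nonneg _)
      exact (mul_le_of_le_one_right (norm_nonneg _) (abs_cutoff_le n θ)).trans (hgK θ)
    · filter_upwards [hioo] with θ hθ
      refine tendsto_const_nhds.congr' ?_
      filter_upwards [eventually_cutoff_eq_one hθ] with n hn
      rw [hn.eq_of_nhds]
      simp
  rw [integral_per, integral_per]
  refine tendsto_nhds_unique lim1 (lim2.neg.congr' ?_)
  filter_upwards [eventually_ge_atTop 1] with n hn
  have := h _ (isTest_mul_cutoff hg hn)
  rw [integral_per, integral_per] at this
  exact this.symm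

lemma HasWeakDeriv.integral_mul_sin {u v : ℝ → ℝ} (h : HasWeakDeriv u v)
    (hu : Integrable u per) (hv : Integrable v per) (m : ℕ) :
    ∫ θ in (0 : ℝ)..2 * π, v θ * Real.sin (2 * m * θ) =
      -(2 * m * ∫ θ in (0 : ℝ)..2 * π, u θ * Real.cos (2 * m * θ)) := by
  have hd : ∀ x, HasDerivAt (fun θ : ℝ => Real.sin (2 * m * θ)) (2 * m * Real.cos (2 * m * x)) x := by
    intro x
    have h1 : HasDerivAt (fun y : ℝ => 2 * (m : ℝ) * y) (2 * m) x := by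
      simpa using (hasDerivAt_id x).const_mul (2 * (m : ℝ))
    exact h1.sin.congr_deriv (by ring)
  have hsin : ∀ x : ℝ, |Real.sin (2 * m * x)| ≤ 2 * m * |x| := fun x => by
    refine Real.abs_sin_le_abs.trans ?_
    rw [abs_mul, abs_of_nonneg (by positivity : (0 : ℝ) ≤ 2 * m)]
  have key := h.integral_mul_deriv (g := fun θ => Real.sin (2 * m * θ)) (K := 1) (L := 2 * m) hu hv
    (by fun_prop) (fun x => Real.abs_sin_le_one _) (fun x => ?_) hsin (fun x => ?_)
  · simp only [fun x => (hd x).deriv] at key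
    have e : ∀ θ, u θ * (2 * m * Real.cos (2 * m * θ)) = 2 * m * (u θ * Real.cos (2 * m * θ)) :=
      fun θ => by ring
    simp only [e, intervalIntegral.integral_const_mul] at key
    linarith
  · rw [(hd x).deriv, abs_mul, abs_of_nonneg (by positivity : (0 : ℝ) ≤ 2 * m)]
    exact mul_le_of_le_one_right (by positivity) (Real.abs_cos_le_one _)
  · have e : Real.sin (2 * m * x) = -Real.sin (2 * m * (2 * π - x)) := by
      have : 2 * (m : ℝ) * (2 * π - x) = ((2 * m : ℕ) : ℝ) * (2 * π) - 2 * m * x := by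
        push_cast; ring
      rw [this, Real.sin_nat_mul_two_pi_sub, neg_neg]
    rw [e, abs_neg]
    exact hsin _

/-- Integration against a square integrable function. -/
def pairing (w : ℝ → ℝ) (hw : MemLp w 2 per) : L2per →L[ℝ] ℝ := innerSL ℝ (hw.toLp w)

lemma L2per.inner_eq (u w : L2per) : inner ℝ u w = ∫ θ in (0 : ℝ)..2 * π, u θ * w θ := by
  rw [L2.inner_def, integral_per]
  simp [mul_comm]

lemma pairing_apply (w : ℝ → ℝ) (hw : MemLp w 2 per) (u : L2per) :
    pairing w hw u = ∫ θ in (0 : ℝ)..2 * π, u θ * w θ := by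
  rw [pairing, innerSL_apply_apply, L2per.inner_eq]
  refine integral_congr_per ?_
  filter_upwards [hw.coeFn_toLp] with θ hθ
  rw [hθ, mul_comm]

lemma exists_seq_tendsto_ae_of_tendsto {u : ℕ → L2per} {v : L2per} (h : Tendsto u atTop (𝓝 v)) :
    ∃ ns : ℕ → ℕ, ∀ᵐ θ ∂per, Tendsto (fun i => u (ns i) θ) atTop (𝓝 (v θ)) := by
  obtain ⟨ns, -, hns⟩ := (tendstoInMeasure_of_tendsto_Lp h).exists_seq_tendsto_ae
  exact ⟨ns, hns⟩

lemma isClosed_symmetricH1 : IsClosed (symmetricH1 : Set (WithLp 2 (L2per × L2per))) := by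
  refine isClosed_of_closure_subset fun p hp => ?_
  obtain ⟨q, hq, hlim⟩ := mem_closure_iff_seq_limit.1 hp
  have l1 : Tendsto (fun n => (q n).fst) atTop (𝓝 p.fst) :=
    ((WithLp.prod_continuous_ofLp 2 _ _).fst.tendsto p).comp hlim
  have l2 : Tendsto (fun n => (q n).snd) atTop (𝓝 p.snd) :=
    ((WithLp.prod_continuous_ofLp 2 _ _).snd.tendsto p).comp hlim
  have hadm : ∀ n, IsAdmissible (q n).fst (q n).snd := hq
  obtain ⟨ns, hns⟩ := exists_seq_tendsto_ae_of_tendsto l1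
  refine ⟨fun φ hφ => ?_, ?_, ?_, ?_⟩
  · obtain ⟨⟨C, hC⟩, ⟨D, hD⟩, h1, h2⟩ := hφ.bounds
    have m1 := memLp_of_continuous h1 C hC
    have m2 := memLp_of_continuous h2 D hD
    rw [← pairing_apply φ m1, ← pairing_apply _ m2]
    refine tendsto_nhds_unique (((pairing _ m2).continuous.tendsto _).comp l1)
      ((((pairing _ m1).continuous.tendsto _).comp l2).neg.congr fun n => ?_)
    have := (hadm n).weak φ hφ
    rw [← pairing_apply φ m1, ← pairing_apply _ m2] at this
    exact this.symm
  · have m1 : MemLp (fun _ : ℝ => (1 : ℝ)) 2 per := memLp_const 1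
    have e : ∀ u : L2per, ∫ θ in (0 : ℝ)..2 * π, u θ = pairing _ m1 u := fun u => by
      simp [pairing_apply]
    rw [e]
    refine tendsto_nhds_unique (((pairing _ m1).continuous.tendsto _).comp l1)
      (tendsto_const_nhds.congr fun n => ?_)
    have := (hadm n).mean
    rw [e] at this
    exact this.symm
  · have hall : ∀ᵐ θ ∂(volume.restrict (Ioo 0 π)), ∀ n, (q n).fst (θ + π) = (q n).fst θ :=
      ae_all_iff.2 fun n => (hadm n).periodic
    filter_upwards [ae_shift hns, ae_half hns, hall] with θ h1 h2 h3
    refine tendsto_nhds_unique h1 (h2.congr fun i => (h3 _).symm)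
  · have hall : ∀ᵐ θ ∂(volume.restrict (Ioo 0 (2 * π))),
        ∀ n, (q n).fst (2 * π - θ) = (q n).fst θ :=
      ae_all_iff.2 fun n => (hadm n).even
    filter_upwards [ae_refl hns, ae_open hns, hall] with θ h1 h2 h3
    refine tendsto_nhds_unique h1 (h2.congr fun i => (h3 _).symm)

instance : CompleteSpace H := isClosed_symmetricH1.completeSpace_coe

/-- The inclusion of `H` in `L²`. -/
def fstL : H →L[ℝ] L2per :=
  (ContinuousLinearMap.fst ℝ L2per L2per) ∘L
    (WithLp.prodContinuousLinearEquiv 2 ℝ L2per L2per).toContinuousLinearMap ∘L symmetricH1.subtypeL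

lemma coeFn_fstL (V : H) : ⇑(fstL V) = V.fn := rfl

/-- The `m`-th cosine coefficient of an element of `H`, as a functional on `H`. -/
def coeff (m : ℕ) : H →L[ℝ] ℝ :=
  π⁻¹ • ((pairing (fun θ => Real.cos (2 * m * θ))
    (memLp_of_continuous (by fun_prop) 1 (abs_cos_nat m))) ∘L fstL)

lemma coeff_apply (m : ℕ) (V : H) :
    coeff m V = π⁻¹ * ∫ θ in (0 : ℝ)..2 * π, V.fn θ * Real.cos (2 * m * θ) := by
  simp [coeff, pairing_apply, coeFn_fstL]

lemma H.inner_eq (V W : H) : inner ℝ V W =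
    inner ℝ (fstL V) (fstL W) +
      inner ℝ (V : WithLp 2 (L2per × L2per)).snd (W : WithLp 2 (L2per × L2per)).snd := by
  rw [Submodule.coe_inner, WithLp.prod_inner_apply]
  rfl

lemma cosMode_fn {m : ℕ} (hm : m ≠ 0) :
    (cosMode m).fn =ᵐ[per] fun θ => Real.cos (2 * m * θ) := by
  rw [cosMode, dif_neg hm]
  exact H.fn_mk ..

lemma cosMode_snd {m : ℕ} (hm : m ≠ 0) :
    (cosMode m : WithLp 2 (L2per × L2per)).snd =ᵐ[per]
      fun θ => -(2 * m * Real.sin (2 * m * θ)) := by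
  rw [cosMode, dif_neg hm]
  exact (memLp_of_continuous (by fun_prop) (2 * m) fun x => by
    rw [norm_neg, norm_mul, Real.norm_of_nonneg (by positivity)]
    exact mul_le_of_le_one_right (by positivity) (Real.abs_sin_le_one _) :
      MemLp (fun θ : ℝ => -(2 * m * Real.sin (2 * m * θ))) 2 per).coeFn_toLp

lemma inner_cosMode {m : ℕ} (hm : m ≠ 0) (V : H) :
    inner ℝ (cosMode m) V = π * (1 + 4 * (m : ℝ) ^ 2) * coeff m V := by
  have e1 : ∫ θ in (0 : ℝ)..2 * π, (cosMode m).fn θ * V.fn θ =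
      ∫ θ in (0 : ℝ)..2 * π, V.fn θ * Real.cos (2 * m * θ) := by
    refine integral_congr_per ?_
    filter_upwards [cosMode_fn hm] with θ hθ
    rw [hθ, mul_comm]
  have e2 : ∫ θ in (0 : ℝ)..2 * π, (cosMode m : WithLp 2 (L2per × L2per)).snd θ *
      (V : WithLp 2 (L2per × L2per)).snd θ = ∫ θ in (0 : ℝ)..2 * π,
      -(2 * m) * ((V : WithLp 2 (L2per × L2per)).snd θ * Real.sin (2 * m * θ)) := by
    refine integral_congr_per ?_
    filter_upwards [cosMode_snd hm] with θ hθ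
    rw [hθ]
    ring
  have e3 := (V.2 : IsAdmissible _ _).weak.integral_mul_sin (L2per.integrable _)
    (L2per.integrable _) m
  rw [H.inner_eq, L2per.inner_eq, L2per.inner_eq, coeFn_fstL, coeFn_fstL, e1, e2,
    intervalIntegral.integral_const_mul, e3, coeff_apply]
  have := Real.pi_ne_zero
  field_simp
  simp only [H.fn]
  ring

lemma coeff_cosMode {m : ℕ} (hm : m ≠ 0) (j : ℕ) :
    coeff j (cosMode m) = if j = m then 1 else 0 := by
  have e1 : ∫ θ in (0 : ℝ)..2 * π, (cosMode m).fn θ * Real.cos (2 * j * θ) =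
      ∫ θ in (0 : ℝ)..2 * π, Real.cos (2 * j * θ) * Real.cos (2 * m * θ) := by
    refine integral_congr_per ?_
    filter_upwards [cosMode_fn hm] with θ hθ
    rw [hθ, mul_comm]
  rw [coeff_apply, e1, integral_cos_mul_cos j m hm]
  split_ifs <;> simp

lemma coeff_zero_index (V : H) : coeff 0 V = 0 := by
  have := (V.2 : IsAdmissible _ _).mean
  rw [coeff_apply]
  simp only [Nat.cast_zero, mul_zero, zero_mul, Real.cos_zero, mul_one]
  simp only [H.fn]
  rw [this, mul_zero]

lemma L2per.ext_zero {u : L2per} (h : u =ᵐ[per] fun _ => 0) : u = 0 :=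
  Lp.ext (h.trans (Lp.coeFn_zero _ _ _).symm)

/-- An element of `H` is determined by its function. -/
lemma H.eq_zero_of_fn {V : H} (h : V.fn =ᵐ[per] 0) : V = 0 := by
  have hadm : IsAdmissible _ _ := V.2
  have h1 : (V : WithLp 2 (L2per × L2per)).fst = 0 := L2per.ext_zero h
  have h2 : (V : WithLp 2 (L2per × L2per)).snd = 0 := by
    apply L2per.ext_zero
    set v := (V : WithLp 2 (L2per × L2per)).snd with hv
    have hvi : IntegrableOn v (Ioo 0 (2 * π)) volume :=
      IntegrableOn.mono_set (L2per.integrable v) Ioo_subset_Ioc_self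
    have := isOpen_Ioo.ae_eq_zero_of_integral_contDiff_smul_eq_zero (μ := volume) (f := v)
      hvi.locallyIntegrableOn fun φ h1 h2 h3 => ?_
    · exact ae_per_of_Ioo this
    · have hw := hadm.weak φ ⟨h1, h2, h3⟩
      rw [integral_congr_per (g := fun _ => 0), intervalIntegral.integral_zero, eq_comm,
        neg_eq_zero, integral_per, integral_Ioc_eq_integral_Ioo] at hw
      · rw [← hw, ← setIntegral_eq_integral_of_forall_compl_eq_zero (s := Ioo 0 (2 * π))]
        · congr 1
          funext θ
          rw [smul_eq_mul, mul_comm]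
        · intro x hx
          rw [image_eq_zero_of_notMem_tsupport (fun h => hx (h3 h)), zero_smul]
      · filter_upwards [h] with θ hθ
        have : (V : WithLp 2 (L2per × L2per)).fst θ = 0 := hθ
        rw [this, zero_mul]
  exact Subtype.ext (by
    apply (WithLp.ofLp_injective 2)
    exact Prod.ext h1 h2)

lemma H.eq_of_fn {V W : H} (h : V.fn =ᵐ[per] W.fn) : V = W := by
  rw [← sub_eq_zero]
  refine H.eq_zero_of_fn ?_
  have : (V - W).fn =ᵐ[per] fun θ => V.fn θ - W.fn θ := Lp.coeFn_sub (fstL V) (fstL W)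
  filter_upwards [this, h] with θ h1 h2
  rw [h1, h2, sub_self]
  rfl

lemma H.eq_zero_of_coeff {V : H} (h : ∀ m, m ≠ 0 → coeff m V = 0) : V = 0 := by
  have hadm : IsAdmissible _ _ := V.2
  refine H.eq_zero_of_fn (ae_eq_zero_of_cos_coeff (Lp.memLp (fstL V)) hadm.periodic hadm.even
    fun m => ?_)
  have : coeff m V = 0 := by
    rcases eq_or_ne m 0 with rfl | hm
    · exact coeff_zero_index V
    · exact h m hm
  rw [coeff_apply] at this
  exact (mul_eq_zero.1 this).resolve_left (inv_ne_zero Real.pi_ne_zero)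

lemma H.ext_coeff {V W : H} (h : ∀ m, m ≠ 0 → coeff m V = coeff m W) : V = W := by
  rw [← sub_eq_zero]
  exact H.eq_zero_of_coeff fun m hm => by rw [map_sub, h m hm, sub_self]

/-! ### Expansion in cosines -/

lemma norm_cosMode_sq {m : ℕ} (hm : m ≠ 0) : ‖cosMode m‖ ^ 2 = π * (1 + 4 * (m : ℝ) ^ 2) := by
  rw [← real_inner_self_eq_norm_sq, inner_cosMode hm, coeff_cosMode hm, if_pos rfl, mul_one]

lemma norm_cosMode_pos {m : ℕ} (hm : m ≠ 0) : 0 < ‖cosMode m‖ := by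
  have h : 0 < ‖cosMode m‖ ^ 2 := by
    rw [norm_cosMode_sq hm]
    have := Real.pi_pos
    positivity
  exact (norm_nonneg _).lt_of_ne' fun h0 => by simp [h0] at h

/-- The normalised cosines. -/
def unitMode (j : ℕ) : H := ‖cosMode (j + 1)‖⁻¹ • cosMode (j + 1)

lemma inner_unitMode (j : ℕ) (V : H) :
    inner ℝ (unitMode j) V = ‖cosMode (j + 1)‖ * coeff (j + 1) V := by
  have h := norm_cosMode_pos (m := j + 1) (by omega)
  have e := real_inner_smul_left (cosMode (j + 1)) V ‖cosMode (j + 1)‖⁻¹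
  rw [unitMode, e, inner_cosMode (by omega), ← norm_cosMode_sq (by omega)]
  field_simp

lemma orthonormal_unitMode : Orthonormal ℝ unitMode := by
  rw [orthonormal_iff_ite]
  intro i j
  have h := norm_cosMode_pos (m := j + 1) (by omega)
  rw [inner_unitMode, unitMode, map_smul, coeff_cosMode (by omega), smul_eq_mul]
  by_cases hij : i = j
  · subst hij
    rw [if_pos rfl, if_pos rfl, mul_one, mul_inv_cancel₀ h.ne']
  · simp [hij]

/-- The normalised cosines form a Hilbert basis of `H`. -/
def modeBasis : HilbertBasis ℕ ℝ H :=
  HilbertBasis.mkOfOrthogonalEqBot orthonormal_unitMode (by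
    rw [Submodule.eq_bot_iff]
    intro V hV
    refine H.eq_zero_of_coeff fun m hm => ?_
    obtain ⟨j, rfl⟩ := Nat.exists_eq_succ_of_ne_zero hm
    have h1 := (Submodule.mem_orthogonal _ V).1 hV (unitMode j)
      (Submodule.subset_span (mem_range_self j))
    rw [inner_unitMode] at h1
    exact (mul_eq_zero.1 h1).resolve_left (norm_cosMode_pos (by omega)).ne')

lemma modeBasis_apply (j : ℕ) : modeBasis j = unitMode j := by
  rw [modeBasis, HilbertBasis.coe_mkOfOrthogonalEqBot]

lemma H.hasSum_inner (V W : H) : HasSum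
    (fun j : ℕ => π * (1 + 4 * ((j + 1 : ℕ) : ℝ) ^ 2) * (coeff (j + 1) V * coeff (j + 1) W))
    (inner ℝ V W) := by
  refine (modeBasis.hasSum_inner_mul_inner V W).congr_fun fun j => ?_
  rw [modeBasis_apply, real_inner_comm, inner_unitMode, inner_unitMode,
    ← norm_cosMode_sq (by omega)]
  ring

lemma H.hasSum_cosMode (V : H) :
    HasSum (fun j : ℕ => coeff (j + 1) V • cosMode (j + 1)) V := by
  refine (modeBasis.hasSum_repr V).congr_fun fun j => ?_
  rw [modeBasis.repr_apply_apply, modeBasis_apply, inner_unitMode, unitMode, smul_smul]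
  congr 1
  have h := norm_cosMode_pos (m := j + 1) (by omega)
  field_simp

/-- An operator with `coeff m (P V) = b m * coeff m V`: diagonal in the basis of cosines. -/
def IsDiagonal (P : H →L[ℝ] H) (b : ℕ → ℝ) : Prop :=
  ∀ m, m ≠ 0 → ∀ V, coeff m (P V) = b m * coeff m V

lemma IsDiagonal.hasSum_inner {P : H →L[ℝ] H} {b : ℕ → ℝ} (h : IsDiagonal P b) (V W : H) : HasSum
    (fun j : ℕ => b (j + 1) * (π * (1 + 4 * ((j + 1 : ℕ) : ℝ) ^ 2) *
      (coeff (j + 1) V * coeff (j + 1) W))) (inner ℝ (P V) W) := by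
  refine (H.hasSum_inner (P V) W).congr_fun fun j => ?_
  rw [h _ (by omega)]
  ring

lemma IsDiagonal.apply_cosMode {P : H →L[ℝ] H} {b : ℕ → ℝ} (h : IsDiagonal P b) {m : ℕ}
    (hm : m ≠ 0) : P (cosMode m) = b m • cosMode m := by
  refine H.ext_coeff fun j hj => ?_
  rw [h j hj, map_smul, coeff_cosMode hm, smul_eq_mul]
  split_ifs with hjm
  · rw [hjm]
  · simp

/-- A lower bound for the quadratic form of a diagonal operator from one for the entries on the
support of the vector. -/
lemma IsDiagonal.le_inner {P : H →L[ℝ] H} {b : ℕ → ℝ} (h : IsDiagonal P b) {c : ℝ} {V : H}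
    (hb : ∀ m, m ≠ 0 → coeff m V ≠ 0 → c ≤ b m) : c * ‖V‖ ^ 2 ≤ inner ℝ (P V) V := by
  rw [← real_inner_self_eq_norm_sq]
  refine hasSum_le (fun j => ?_) ((H.hasSum_inner V V).mul_left c) (h.hasSum_inner V V)
  by_cases hz : coeff (j + 1) V = 0
  · simp [hz]
  · refine mul_le_mul_of_nonneg_right (hb _ (by omega) hz) ?_
    exact mul_nonneg (mul_nonneg Real.pi_pos.le (by positivity)) (mul_self_nonneg _)

lemma IsDiagonal.comp {P Q : H →L[ℝ] H} {b c : ℕ → ℝ} (h : IsDiagonal P b) (h' : IsDiagonal Q c) :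
    IsDiagonal (P * Q) (fun m => b m * c m) := fun m hm V => by
  rw [mul_apply_eq_comp, h m hm, h' m hm, mul_assoc]

/-- The Lax–Milgram lemma for a single operator. -/
lemma isUnit_of_coercive {X : Type*} [NormedAddCommGroup X] [InnerProductSpace ℝ X]
    [CompleteSpace X] {P : X →L[ℝ] X} {c : ℝ} (hc : 0 < c)
    (h : ∀ x, c * ‖x‖ ^ 2 ≤ inner ℝ (P x) x) : IsUnit P := by
  have hco : IsCoercive ((innerSL ℝ) ∘L P : X →L[ℝ] X →L[ℝ] ℝ) :=
    ⟨c, hc, fun u => by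
      have := h u
      rw [ContinuousLinearMap.comp_apply, innerSL_apply_apply]
      nlinarith⟩
  have e : (hco.continuousLinearEquivOfBilin : X →L[ℝ] X) = P := by
    ext v
    refine ext_inner_right ℝ fun w => ?_
    exact hco.continuousLinearEquivOfBilin_apply v w
  rw [← e]
  exact ContinuousLinearMap.isUnit_iff_bijective.2 hco.continuousLinearEquivOfBilin.bijective

lemma IsDiagonal.norm_ge {P : H →L[ℝ] H} {b : ℕ → ℝ} (h : IsDiagonal P b) {c : ℝ} (hc : 0 ≤ c)
    {V : H} (hb : ∀ m, m ≠ 0 → coeff m V ≠ 0 → c ≤ |b m|) : c * ‖V‖ ≤ ‖P V‖ := by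
  have h1 : c ^ 2 * ‖V‖ ^ 2 ≤ ‖P V‖ ^ 2 := by
    rw [← real_inner_self_eq_norm_sq, ← real_inner_self_eq_norm_sq]
    refine hasSum_le (fun j => ?_) ((H.hasSum_inner V V).mul_left (c ^ 2))
      (H.hasSum_inner (P V) (P V))
    rw [h _ (by omega)]
    by_cases hz : coeff (j + 1) V = 0
    · simp [hz]
    have h2 : c ^ 2 ≤ b (j + 1) ^ 2 := by
      rw [← sq_abs (b _)]
      exact pow_le_pow_left₀ hc (hb _ (by omega) hz) 2
    have h3 : 0 ≤ π * (1 + 4 * ((j + 1 : ℕ) : ℝ) ^ 2) * (coeff (j + 1) V * coeff (j + 1) V) :=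
      mul_nonneg (mul_nonneg Real.pi_pos.le (by positivity)) (mul_self_nonneg _)
    nlinarith
  rw [← mul_pow] at h1
  exact (pow_le_pow_iff_left₀ (by positivity) (norm_nonneg _) two_ne_zero).1 h1

/-- A diagonal operator whose entries are bounded away from zero is invertible: its square is
coercive. -/
lemma IsDiagonal.isUnit {P : H →L[ℝ] H} {b : ℕ → ℝ} (h : IsDiagonal P b) {c : ℝ} (hc : 0 < c)
    (hb : ∀ m, m ≠ 0 → c ≤ |b m|) : IsUnit P := by
  have h2 : IsUnit (P * P) := by
    refine isUnit_of_coercive (c := c ^ 2) (by positivity) fun V => ?_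
    refine (h.comp h).le_inner fun m hm _ => ?_
    rw [← pow_two, ← sq_abs (b m)]
    exact pow_le_pow_left₀ hc.le (hb m hm) 2
  exact ((Commute.isUnit_mul_iff (Commute.refl P)).1 h2).1

/-! ### The embedding of `H` in the bounded continuous functions -/

/-- `cos (2mθ)` as a bounded continuous function. -/
def cosB (m : ℕ) : ℝ →ᵇ ℝ :=
  BoundedContinuousFunction.ofNormedAddCommGroup (fun θ => Real.cos (2 * m * θ)) (by fun_prop) 1
    (abs_cos_nat m)

lemma cosB_apply (m : ℕ) (θ : ℝ) : cosB m θ = Real.cos (2 * m * θ) := rfl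

lemma norm_cosB_le (m : ℕ) : ‖cosB m‖ ≤ 1 :=
  BoundedContinuousFunction.norm_ofNormedAddCommGroup_le _ zero_le_one _

lemma summable_inv_norm_cosMode_sq :
    Summable fun j : ℕ => 1 / (π * (1 + 4 * ((j + 1 : ℕ) : ℝ) ^ 2)) := by
  have h1 : Summable fun m : ℕ => 1 / ((m + 1 : ℕ) : ℝ) ^ 2 :=
    (summable_nat_add_iff 1).2 (Real.summable_one_div_nat_pow.2 one_lt_two)
  refine h1.of_nonneg_of_le (fun m => ?_) fun m => ?_
  · have := Real.pi_pos
    positivity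
  · have hp := Real.pi_gt_three
    refine one_div_le_one_div_of_le (by positivity) ?_
    nlinarith [sq_nonneg ((m + 1 : ℕ) : ℝ)]

lemma abs_coeff_le (j : ℕ) (V : H) : |coeff (j + 1) V| ≤
    1 / 2 * (π * (1 + 4 * ((j + 1 : ℕ) : ℝ) ^ 2) * (coeff (j + 1) V * coeff (j + 1) V) +
      1 / (π * (1 + 4 * ((j + 1 : ℕ) : ℝ) ^ 2))) := by
  set n := π * (1 + 4 * ((j + 1 : ℕ) : ℝ) ^ 2) with hn
  have hp : 0 < n := by
    have := Real.pi_pos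
    positivity
  have h1 : 0 ≤ (n * |coeff (j + 1) V| - 1) ^ 2 / n := by positivity
  have h2 : (n * |coeff (j + 1) V| - 1) ^ 2 / n =
      n * (coeff (j + 1) V * coeff (j + 1) V) + 1 / n - 2 * |coeff (j + 1) V| := by
    rw [← abs_mul_abs_self (coeff (j + 1) V)]
    field_simp
    ring
  linarith

lemma norm_smul_cosB_le (c : ℝ) (m : ℕ) : ‖c • cosB m‖ ≤ |c| := by
  rw [norm_smul, Real.norm_eq_abs]
  exact mul_le_of_le_one_right (abs_nonneg _) (norm_cosB_le m)

lemma summable_abs_coeff (V : H) : Summable fun j : ℕ => |coeff (j + 1) V| :=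
  (((H.hasSum_inner V V).summable.add summable_inv_norm_cosMode_sq).mul_left (1 / 2)).of_nonneg_of_le
    (fun _ => abs_nonneg _) fun j => abs_coeff_le j V

lemma summable_coeff_cosB (V : H) : Summable fun j : ℕ => coeff (j + 1) V • cosB (j + 1) :=
  Summable.of_norm_bounded (summable_abs_coeff V) fun _ => norm_smul_cosB_le _ _

/-- The sum of the cosine series, as a linear map. -/
def embedLin : H →ₗ[ℝ] (ℝ →ᵇ ℝ) where
  toFun V := ∑' j : ℕ, coeff (j + 1) V • cosB (j + 1)
  map_add' V W := by
    rw [← (summable_coeff_cosB V).tsum_add (summable_coeff_cosB W)]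
    simp only [map_add, add_smul]
  map_smul' c V := by
    simp only [map_smul, smul_eq_mul, mul_smul, RingHom.id_apply]
    rw [(summable_coeff_cosB V).tsum_const_smul]

lemma exists_embedLin_bound : ∃ C, ∀ V, ‖embedLin V‖ ≤ C * ‖V‖ := by
  set S := ∑' j : ℕ, 1 / (π * (1 + 4 * ((j + 1 : ℕ) : ℝ) ^ 2)) with hS
  refine LinearMap.bound_of_ball_bound zero_lt_one (1 / 2 * (1 + S)) embedLin fun V hV => ?_
  have hV1 : ‖V‖ ≤ 1 := by
    rw [mem_ball_zero_iff] at hV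
    exact hV.le
  have h1 := ((H.hasSum_inner V V).add summable_inv_norm_cosMode_sq.hasSum).mul_left (1 / 2)
  refine (tsum_of_norm_bounded h1 fun j => (norm_smul_cosB_le _ _).trans (abs_coeff_le j V)).trans ?_
  rw [real_inner_self_eq_norm_sq, ← hS]
  nlinarith [norm_nonneg V]

/-- The Sobolev embedding of `H` in the bounded continuous functions, given by the sum of the
cosine series. -/
def embed : H →L[ℝ] (ℝ →ᵇ ℝ) := embedLin.mkContinuousOfExistsBound exists_embedLin_bound

lemma hasSum_embed (V : H) : HasSum (fun j : ℕ => coeff (j + 1) V • cosB (j + 1)) (embed V) :=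
  (summable_coeff_cosB V).hasSum

/-- The class in `L²` of a bounded continuous function. -/
def toL2 : (ℝ →ᵇ ℝ) →L[ℝ] L2per := BoundedContinuousFunction.toLp 2 per ℝ

lemma coeFn_toL2 (g : ℝ →ᵇ ℝ) : toL2 g =ᵐ[per] g :=
  BoundedContinuousFunction.coeFn_toLp 2 per ℝ g

lemma toL2_embed (V : H) : toL2 (embed V) = fstL V := by
  refine ((hasSum_embed V).mapL toL2).unique (((H.hasSum_cosMode V).mapL fstL).congr_fun fun j => ?_)
  rw [map_smul, map_smul]
  exact congrArg (fun w => coeff (j + 1) V • w)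
    (Lp.ext ((coeFn_toL2 _).trans (cosMode_fn (m := j + 1) (by omega)).symm))

lemma embed_ae (V : H) : V.fn =ᵐ[per] embed V := by
  have := coeFn_toL2 (embed V)
  rw [toL2_embed] at this
  exact this

lemma embed_cosMode {m : ℕ} (hm : m ≠ 0) : embed (cosMode m) = cosB m := by
  refine (hasSum_embed (cosMode m)).unique ?_
  obtain ⟨j, rfl⟩ := Nat.exists_eq_succ_of_ne_zero hm
  convert hasSum_single j fun i hi => ?_ using 1
  · rw [coeff_cosMode (by omega), if_pos rfl, one_smul]
  · rw [coeff_cosMode (by omega), if_neg (by omega), zero_smul]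

/-! ### Duality between `H` and the bounded continuous functions -/

/-- The integral over one period. -/
def integ : (ℝ →ᵇ ℝ) →L[ℝ] ℝ :=
  (pairing (fun _ => 1) (memLp_const 1)) ∘L toL2

lemma integ_apply (g : ℝ →ᵇ ℝ) : integ g = ∫ θ in (0 : ℝ)..2 * π, g θ := by
  rw [integ, ContinuousLinearMap.comp_apply, pairing_apply]
  refine integral_congr_per ?_
  filter_upwards [coeFn_toL2 g] with θ hθ
  rw [hθ, mul_one]

/-- `rieszMap g` represents the functional `W ↦ ∫ g W` on `H`. -/
def rieszMap : (ℝ →ᵇ ℝ) →L[ℝ] H := (ContinuousLinearMap.adjoint fstL) ∘L toL2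

lemma inner_rieszMap (g : ℝ →ᵇ ℝ) (W : H) : inner ℝ (rieszMap g) W = integ (g * embed W) := by
  rw [rieszMap, ContinuousLinearMap.comp_apply, ContinuousLinearMap.adjoint_inner_left,
    L2per.inner_eq, integ_apply]
  refine integral_congr_per ?_
  filter_upwards [coeFn_toL2 g, embed_ae W] with θ h1 h2
  rw [h1, coeFn_fstL, h2]
  rfl

lemma coeff_eq_integ (m : ℕ) (V : H) : coeff m V = π⁻¹ * integ (embed V * cosB m) := by
  rw [coeff_apply, integ_apply]
  congr 1
  refine integral_congr_per ?_
  filter_upwards [embed_ae V] with θ hθ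
  rw [hθ]
  rfl

lemma integ_cosB_mul_embed (m : ℕ) (V : H) : integ (cosB m * embed V) = π * coeff m V := by
  rw [coeff_eq_integ, mul_inv_cancel_left₀ Real.pi_ne_zero, mul_comm]

lemma coeff_rieszMap {m : ℕ} (hm : m ≠ 0) (g : ℝ →ᵇ ℝ) :
    coeff m (rieszMap g) = (π * (1 + 4 * (m : ℝ) ^ 2))⁻¹ * integ (g * cosB m) := by
  have h1 := inner_rieszMap g (cosMode m)
  rw [real_inner_comm, inner_cosMode hm, embed_cosMode hm] at h1
  rw [← h1]
  have := Real.pi_pos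
  field_simp

lemma integ_embed (V : H) : integ (embed V) = 0 := by
  have h := coeff_zero_index V
  have e : embed V * cosB 0 = embed V := by
    ext θ
    simp [cosB_apply]
  rw [coeff_eq_integ, e] at h
  exact (mul_eq_zero.1 h).resolve_left (inv_ne_zero Real.pi_ne_zero)

lemma rieszMap_one : rieszMap 1 = 0 := by
  refine ext_inner_right ℝ fun W => ?_
  rw [inner_rieszMap, one_mul, integ_embed, inner_zero_left]

/-- The self-adjoint operator `S` with `⟪S V, W⟫ = ∫ V' W' - ∫ V W`. Since `K'' + K` is a sum of
point masses, `S` undoes the convolution with `K`. -/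
def energyOp : H →L[ℝ] H := 1 - (2 : ℝ) • (rieszMap ∘L embed)

lemma isDiagonal_energyOp :
    IsDiagonal energyOp (fun m => (4 * (m : ℝ) ^ 2 - 1) / (4 * (m : ℝ) ^ 2 + 1)) := by
  intro m hm V
  have h : coeff m (energyOp V) = coeff m V - 2 * coeff m (rieszMap (embed V)) := by
    simp [energyOp]
  rw [h, coeff_rieszMap hm, mul_comm (embed V), integ_cosB_mul_embed]
  have := Real.pi_pos
  field_simp
  ring

lemma le_energyOp_entry {m : ℕ} (hm : m ≠ 0) :
    (3 / 5 : ℝ) ≤ (4 * (m : ℝ) ^ 2 - 1) / (4 * (m : ℝ) ^ 2 + 1) := by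
  have := one_le_cast_sq (m := m) (by omega)
  rw [div_le_div_iff₀ (by norm_num) (by positivity)]
  linarith

lemma energyOp_coercive (V : H) : 3 / 5 * ‖V‖ ^ 2 ≤ inner ℝ (energyOp V) V :=
  isDiagonal_energyOp.le_inner fun _ hm _ => le_energyOp_entry hm

lemma isUnit_energyOp : IsUnit energyOp :=
  isUnit_of_coercive (by norm_num) energyOp_coercive

lemma inner_energyOp_comm (V W : H) : inner ℝ (energyOp V) W = inner ℝ V (energyOp W) := by
  rw [real_inner_comm (energyOp W) V]
  refine (isDiagonal_energyOp.hasSum_inner V W).unique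
    ((isDiagonal_energyOp.hasSum_inner W V).congr_fun fun j => ?_)
  rw [mul_comm (coeff (j + 1) W)]

/-- The inverse of the operator `S`. -/
def energyInv : H →L[ℝ] H := Ring.inverse energyOp

lemma energyOp_energyInv (V : H) : energyOp (energyInv V) = V := by
  rw [← mul_apply_eq_comp, energyInv, Ring.mul_inverse_cancel _ isUnit_energyOp]
  rfl

lemma energyInv_energyOp (V : H) : energyInv (energyOp V) = V := by
  rw [← mul_apply_eq_comp, energyInv, Ring.inverse_mul_cancel _ isUnit_energyOp]
  rfl

lemma energyOp_injective : Function.Injective energyOp :=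
  Function.LeftInverse.injective energyInv_energyOp

/-! ### The exponential and its difference quotient on bounded continuous functions -/

lemma exp_apply (g : ℝ →ᵇ ℝ) (θ : ℝ) : NormedSpace.exp g θ = Real.exp (g θ) := by
  have h := (NormedSpace.exp_series_hasSum_exp' (𝕂 := ℝ) g).mapL
    (BoundedContinuousFunction.evalCLM ℝ θ : (ℝ →ᵇ ℝ) →L[ℝ] ℝ)
  rw [Real.exp_eq_exp_ℝ]
  refine h.unique ((NormedSpace.exp_series_hasSum_exp' (𝕂 := ℝ) (g θ)).congr_fun fun n => ?_)
  simp

lemma contDiff_exp_bcf {n : WithTop ℕ∞} : ContDiff ℝ n (NormedSpace.exp : (ℝ →ᵇ ℝ) → (ℝ →ᵇ ℝ)) :=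
  AnalyticOnNhd.contDiff fun x _ => NormedSpace.exp_analytic x

/-- The Taylor coefficients of `(1 - e^{-x}) / x`. -/
def quotCoeff (n : ℕ) : ℝ := (-1) ^ n * ((n + 1).factorial : ℝ)⁻¹

lemma quotCoeff_ne_zero (n : ℕ) : quotCoeff n ≠ 0 := by
  unfold quotCoeff
  positivity

/-- The entire function `(1 - e^{-x}) / x` on the Banach algebra of bounded continuous functions,
given by its power series. -/
def expQuot (g : ℝ →ᵇ ℝ) : ℝ →ᵇ ℝ :=
  (FormalMultilinearSeries.ofScalars (ℝ →ᵇ ℝ) quotCoeff).sum g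

lemma hasFPowerSeriesOnBall_expQuot : HasFPowerSeriesOnBall expQuot
    (FormalMultilinearSeries.ofScalars (ℝ →ᵇ ℝ) quotCoeff) 0 ⊤ := by
  have hr : (FormalMultilinearSeries.ofScalars (ℝ →ᵇ ℝ) quotCoeff).radius = ⊤ := by
    refine FormalMultilinearSeries.ofScalars_radius_eq_top_of_tendsto _ _
      (Eventually.of_forall quotCoeff_ne_zero) ?_
    have e : ∀ n : ℕ, ‖quotCoeff n.succ‖ / ‖quotCoeff n‖ = 1 / (((n + 1 : ℕ) : ℝ) + 1) := by
      intro n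
      have h1 : ((n + 1).factorial : ℝ) ≠ 0 := by positivity
      simp only [quotCoeff, norm_mul, norm_pow, norm_neg, norm_one, one_pow, one_mul, norm_inv,
        Nat.succ_eq_add_one, Nat.factorial_succ (n + 1), RCLike.norm_natCast]
      push_cast
      field_simp
    simp only [e]
    exact (tendsto_add_atTop_iff_nat (f := fun n : ℕ => 1 / ((n : ℝ) + 1)) 1).2
      tendsto_one_div_add_atTop_nhds_zero_nat
  have := (FormalMultilinearSeries.ofScalars (ℝ →ᵇ ℝ) quotCoeff).hasFPowerSeriesOnBall
    (by rw [hr]; exact ENNReal.zero_lt_top)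
  rwa [hr] at this

lemma contDiff_expQuot {n : WithTop ℕ∞} : ContDiff ℝ n expQuot :=
  AnalyticOnNhd.contDiff fun x _ =>
    hasFPowerSeriesOnBall_expQuot.analyticAt_of_mem (by simp)

lemma hasSum_expQuot (g : ℝ →ᵇ ℝ) : HasSum (fun n => quotCoeff n • g ^ n) (expQuot g) := by
  have := hasFPowerSeriesOnBall_expQuot.hasSum (y := g) (by simp)
  rw [zero_add] at this
  refine this.congr_fun fun n => ?_
  rw [FormalMultilinearSeries.ofScalars_apply_eq]

lemma mul_expQuot (g : ℝ →ᵇ ℝ) : g * expQuot g = 1 - NormedSpace.exp (-g) := by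
  have h1 := (hasSum_expQuot g).mul_left (-g)
  have h2 := (hasSum_nat_add_iff' 1).2 (NormedSpace.exp_series_hasSum_exp' (𝕂 := ℝ) (-g))
  have h3 := h1.unique (h2.congr_fun fun n => ?_)
  · simp only [Finset.range_one, Finset.sum_singleton, Nat.factorial_zero, Nat.cast_one, inv_one,
      pow_zero, one_smul] at h3
    rw [← neg_inj, ← neg_mul, h3, neg_sub]
  · rw [quotCoeff, pow_succ' (-g), neg_pow g n, mul_smul, mul_smul_comm, mul_smul_comm, smul_comm]
    congr 1
    rcases Nat.even_or_odd n with h | h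
    · simp [h.neg_one_pow]
    · simp only [h.neg_one_pow, neg_mul, one_mul, mul_neg]
      exact neg_one_smul ℝ (-g * g ^ n)

lemma hasFDerivAt_exp_neg (g : ℝ →ᵇ ℝ) : HasFDerivAt (fun x : ℝ →ᵇ ℝ => NormedSpace.exp (-x))
    (-(ContinuousLinearMap.mul ℝ (ℝ →ᵇ ℝ) (NormedSpace.exp (-g)))) g := by
  have h := (hasFDerivAt_exp (𝕂 := ℝ) (x := -g)).comp g (hasFDerivAt_id g).neg
  refine h.congr_fderiv ?_
  ext w : 1
  simp

/-! ### Smoothness and linearisation of `Γ` -/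

/-- The normalisation `∫ e^{-V}`. -/
def partition (V : H) : ℝ := integ (NormedSpace.exp (-embed V))

lemma integ_pos {g : ℝ →ᵇ ℝ} (hg : ∀ θ, 0 < g θ) : 0 < integ g := by
  rw [integ_apply]
  exact intervalIntegral.intervalIntegral_pos_of_pos (g.continuous.intervalIntegrable _ _) hg
    (by positivity)

lemma partition_pos (V : H) : 0 < partition V :=
  integ_pos fun θ => by
    rw [exp_apply]
    exact Real.exp_pos _

lemma exp_neg_fn_ae (V : H) :
    (fun θ => Real.exp (-V.fn θ)) =ᵐ[per] ⇑(NormedSpace.exp (-embed V)) := by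
  filter_upwards [embed_ae V] with θ hθ
  rw [exp_apply, hθ]
  rfl

lemma partition_eq (V : H) : ∫ θ in (0 : ℝ)..2 * π, Real.exp (-V.fn θ) = partition V := by
  rw [integral_congr_per (exp_neg_fn_ae V), partition, integ_apply]

lemma bcf_integrable (g : ℝ →ᵇ ℝ) : Integrable g per := g.continuous.integrableOn_Ioc

lemma H.integrable_exp (V : H) : Integrable (fun θ => Real.exp (-V.fn θ)) per :=
  (bcf_integrable _).congr (exp_neg_fn_ae V).symm

lemma integral_kernelC_mul_cos {m : ℕ} (hm : m ≠ 0) :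
    ∫ θ in (0 : ℝ)..2 * π, kernelC θ * Real.cos (2 * m * θ) = π * fourierCos kernel m := by
  unfold kernelC
  simp only [sub_mul]
  rw [intervalIntegral.integral_sub
    ((by have := continuous_kernel; fun_prop : Continuous _).intervalIntegrable _ _)
    ((by fun_prop : Continuous _).intervalIntegrable _ _), fourierCos_kernel_eq m hm,
    intervalIntegral.integral_const_mul]
  have := integral_cos_int_mul (n := 2 * m) (by omega)
  push_cast at this
  rw [this, mul_zero, sub_zero]

lemma integral_kernelC_mul_sin (m : ℕ) :
    ∫ θ in (0 : ℝ)..2 * π, kernelC θ * Real.sin (2 * m * θ) = 0 := by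
  refine integral_mul_eq_zero_of_odd (Eventually.of_forall fun θ => ?_) fun θ => ?_
  · rw [show 2 * π - θ = -θ + 2 * π by ring, kernelC_add_two_pi, kernelC_neg]
  · have : 2 * (m : ℝ) * (2 * π - θ) = ((2 * m : ℕ) : ℝ) * (2 * π) - 2 * m * θ := by
      push_cast; ring
    rw [this, Real.sin_nat_mul_two_pi_sub]

/-- The cosines are eigenfunctions of the convolution with the kernel. -/
lemma integral_kernelC_sub_mul_cos {m : ℕ} (hm : m ≠ 0) (s : ℝ) :
    ∫ θ in (0 : ℝ)..2 * π, kernelC (θ - s) * Real.cos (2 * m * θ) =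
      π * fourierCos kernel m * Real.cos (2 * m * s) := by
  have h1 := intervalIntegral.integral_comp_sub_right (a := 0) (b := 2 * π)
    (fun x => kernelC x * Real.cos (2 * m * (x + s))) s
  simp only [sub_add_cancel] at h1
  have hp : Function.Periodic (fun x => kernelC x * Real.cos (2 * m * (x + s))) (2 * π) := by
    intro x
    simp only [kernelC_add_two_pi]
    rw [show 2 * (m : ℝ) * (x + 2 * π + s) = 2 * m * (x + s) + (2 * m : ℕ) * (2 * π) by
      push_cast; ring, Real.cos_add_nat_mul_two_pi]
  have h2 := hp.intervalIntegral_add_eq (0 - s) 0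
  rw [zero_add, show 0 - s + 2 * π = 2 * π - s by ring] at h2
  rw [h1, h2]
  have e : ∀ x, kernelC x * Real.cos (2 * m * (x + s)) =
      kernelC x * Real.cos (2 * m * x) * Real.cos (2 * m * s) -
      kernelC x * Real.sin (2 * m * x) * Real.sin (2 * m * s) := by
    intro x
    rw [mul_add, Real.cos_add]
    ring
  simp only [e]
  have hc := continuous_kernelC
  rw [intervalIntegral.integral_sub ((by fun_prop : Continuous _).intervalIntegrable _ _)
    ((by fun_prop : Continuous _).intervalIntegrable _ _), intervalIntegral.integral_mul_const,
    intervalIntegral.integral_mul_const, integral_kernelC_mul_cos hm, integral_kernelC_mul_sin]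
  ring

lemma Γ_fn (V : H) : (Γ V).fn =ᵐ[per] gammaFun V.fn := H.fn_mk ..

lemma coeff_Γ {m : ℕ} (hm : m ≠ 0) (V : H) : coeff m (Γ V) =
    (partition V)⁻¹ * fourierCos kernel m * integ (NormedSpace.exp (-embed V) * cosB m) := by
  obtain ⟨B, hB⟩ := exists_kernelC_bound
  have h1 : ∫ θ in (0 : ℝ)..2 * π, (Γ V).fn θ * Real.cos (2 * m * θ) = ∫ θ in (0 : ℝ)..2 * π,
      (partition V)⁻¹ * (conv (fun s => Real.exp (-V.fn s)) θ * Real.cos (2 * m * θ)) := by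
    refine integral_congr_per ?_
    filter_upwards [Γ_fn V] with θ hθ
    rw [hθ, gammaFun, partition_eq]
    ring
  have h2 := integral_mul_conv (w := fun θ => Real.cos (2 * m * θ)) (D := 1)
    continuous_kernelC.measurable hB (by fun_prop) (abs_cos_nat m) V.integrable_exp
  simp only [integral_kernelC_sub_mul_cos hm] at h2
  have h3 : ∫ θ in (0 : ℝ)..2 * π, Real.exp (-V.fn θ) *
      (π * fourierCos kernel m * Real.cos (2 * m * θ)) = ∫ θ in (0 : ℝ)..2 * π,
      π * fourierCos kernel m * (NormedSpace.exp (-embed V) * cosB m) θ := by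
    refine integral_congr_per ?_
    filter_upwards [exp_neg_fn_ae V] with θ hθ
    rw [hθ, BoundedContinuousFunction.mul_apply, cosB_apply]
    ring
  rw [h3, intervalIntegral.integral_const_mul, ← integ_apply] at h2
  rw [coeff_apply, h1, intervalIntegral.integral_const_mul]
  have h4 : ∫ θ in (0 : ℝ)..2 * π, conv (fun s => Real.exp (-V.fn s)) θ * Real.cos (2 * m * θ) =
      π * fourierCos kernel m * integ (NormedSpace.exp (-embed V) * cosB m) := h2
  rw [h4]
  have := Real.pi_ne_zero
  field_simp

/-- The operator `S` turns `Γ` into the normalised exponential. -/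
lemma energyOp_Γ (V : H) :
    energyOp (Γ V) = -((4 * (partition V)⁻¹) • rieszMap (NormedSpace.exp (-embed V))) := by
  refine H.ext_coeff fun m hm => ?_
  have h1 := one_le_cast_sq (m := m) (by omega)
  have h2 : 4 * (m : ℝ) ^ 2 - 1 ≠ 0 := by linarith
  rw [isDiagonal_energyOp m hm, coeff_Γ hm, map_neg, map_smul, coeff_rieszMap hm,
    fourierCos_kernel (by omega), smul_eq_mul]
  have h3 := (partition_pos V).ne'
  have := Real.pi_ne_zero
  field_simp
  ring

/-- The smooth map `(t, u) ↦ Γ(t u) / t`. -/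
def rescaled (p : ℝ × H) : H :=
  energyInv ((4 * (integ (NormedSpace.exp (-(p.1 • embed p.2))))⁻¹) •
    rieszMap (embed p.2 * expQuot (p.1 • embed p.2)))

lemma Γ_smul (t : ℝ) (u : H) : Γ (t • u) = t • rescaled (t, u) := by
  apply energyOp_injective
  have h := mul_expQuot (t • embed u)
  have h1 : rieszMap (NormedSpace.exp (-(t • embed u))) =
      -(t • rieszMap (embed u * expQuot (t • embed u))) := by
    rw [← map_smul rieszMap, ← smul_mul_assoc, h, map_sub, rieszMap_one, zero_sub, neg_neg]
  rw [energyOp_Γ, map_smul energyOp, rescaled, energyOp_energyInv, partition, map_smul embed, h1,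
    smul_neg, neg_neg, smul_comm]

lemma contDiff_rescaled {n : WithTop ℕ∞} : ContDiff ℝ n rescaled := by
  have h1 : ContDiff ℝ n fun p : ℝ × H => p.1 • embed p.2 :=
    contDiff_fst.smul (embed.contDiff.comp contDiff_snd)
  have h2 : ContDiff ℝ n fun p : ℝ × H => integ (NormedSpace.exp (-(p.1 • embed p.2))) :=
    integ.contDiff.comp (contDiff_exp_bcf.comp h1.neg)
  have h3 : ContDiff ℝ n fun p : ℝ × H => rieszMap (embed p.2 * expQuot (p.1 • embed p.2)) :=
    rieszMap.contDiff.comp ((embed.contDiff.comp contDiff_snd).mul (contDiff_expQuot.comp h1))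
  have h4 : ∀ p : ℝ × H, integ (NormedSpace.exp (-(p.1 • embed p.2))) ≠ 0 := fun p => by
    rw [← map_smul]
    exact (partition_pos (p.1 • p.2)).ne'
  exact energyInv.contDiff.comp ((contDiff_const.mul (h2.inv h4)).smul h3)

lemma contDiff_Γ {n : WithTop ℕ∞} : ContDiff ℝ n Γ := by
  have : Γ = fun V => rescaled (1, V) := by
    funext V
    have := Γ_smul 1 V
    rwa [one_smul, one_smul] at this
  rw [this]
  exact contDiff_rescaled.comp (contDiff_const.prodMk contDiff_id)

/-- The derivative of `Γ` at `V`. -/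
def Γderiv (V : H) : H →L[ℝ] H := fderiv ℝ Γ V

lemma hasFDerivAt_Γ (V : H) : HasFDerivAt Γ (Γderiv V) V :=
  ((contDiff_Γ (n := 1)).differentiable (by simp) V).hasFDerivAt

lemma continuous_Γderiv : Continuous Γderiv := (contDiff_Γ (n := 1)).continuous_fderiv (by simp)

lemma integ_one : integ 1 = 2 * π := by
  rw [integ_apply]
  simp

/-- In the energy form the derivative of `Γ` is four times the covariance under the density
`e^{-V} / ∫ e^{-V}`. -/
lemma inner_energyOp_Γderiv (V W W' : H) : inner ℝ (energyOp (Γderiv V W)) W' =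
    4 * (partition V)⁻¹ * integ (NormedSpace.exp (-embed V) * embed W * embed W') -
      4 * (partition V)⁻¹ ^ 2 * (integ (NormedSpace.exp (-embed V) * embed W) *
        integ (NormedSpace.exp (-embed V) * embed W')) := by
  have h1 : HasFDerivAt (fun V : H => inner ℝ (energyOp (Γ V)) W')
      ((innerSL ℝ W') ∘L energyOp ∘L Γderiv V) V := by
    have := ((innerSL ℝ W').hasFDerivAt (x := energyOp (Γ V))).comp V
      ((energyOp.hasFDerivAt (x := Γ V)).comp V (hasFDerivAt_Γ V))
    refine this.congr_of_eventuallyEq (Eventually.of_forall fun U => ?_)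
    simp only [Function.comp_apply, innerSL_apply_apply]
    exact real_inner_comm _ _
  have hexp := (hasFDerivAt_exp_neg (embed V)).comp V embed.hasFDerivAt
  have hZ : HasFDerivAt partition _ V := (integ.hasFDerivAt).comp V hexp
  have hI : HasFDerivAt (fun V : H => integ (NormedSpace.exp (-embed V) * embed W')) _ V :=
    (integ.hasFDerivAt).comp V (hexp.mul_const' (embed W'))
  have hZi := (hasDerivAt_inv (partition_pos V).ne').hasFDerivAt.comp V hZ
  have h2 := (hZi.mul hI).const_mul (-4)
  have e : ∀ U : H, inner ℝ (energyOp (Γ U)) W' =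
      -4 * ((partition U)⁻¹ * integ (NormedSpace.exp (-embed U) * embed W')) := by
    intro U
    have e1 := real_inner_smul_left (rieszMap (NormedSpace.exp (-embed U))) W'
      (4 * (partition U)⁻¹)
    rw [energyOp_Γ, inner_neg_left, e1, inner_rieszMap]
    ring
  have h3 := h1.unique (h2.congr_of_eventuallyEq (Eventually.of_forall e))
  have h4 := congrArg (fun A : H →L[ℝ] ℝ => A W) h3
  simp only [ContinuousLinearMap.comp_apply, innerSL_apply_apply] at h4
  rw [real_inner_comm, h4]
  simp
  ring

/-- The threshold `lam_m` at which `cosMode m` enters the kernel of the linearisation. -/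
def threshold (m : ℕ) : ℝ := (4 * (m : ℝ) ^ 2 - 1) * π / 2

lemma threshold_pos {m : ℕ} (hm : m ≠ 0) : 0 < threshold m := by
  have := one_le_cast_sq (m := m) (by omega)
  have := Real.pi_pos
  unfold threshold
  have : 0 < 4 * (m : ℝ) ^ 2 - 1 := by linarith
  positivity

/-- At the trivial solution the derivative is diagonal, with the entries `1 / lam_m`. -/
lemma isDiagonal_Γderiv_zero : IsDiagonal (Γderiv 0) (fun m => (threshold m)⁻¹) := by
  have h1 : ∀ W, energyOp (Γderiv 0 W) = (2 / π) • rieszMap (embed W) := by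
    intro W
    refine ext_inner_right ℝ fun W' => ?_
    have e := real_inner_smul_left (rieszMap (embed W)) W' (2 / π)
    rw [inner_energyOp_Γderiv, e, inner_rieszMap]
    have hp : partition 0 = 2 * π := by
      rw [partition, map_zero, neg_zero, NormedSpace.exp_zero, integ_one]
    rw [hp, map_zero, neg_zero, NormedSpace.exp_zero, one_mul, one_mul, integ_embed]
    field_simp
    ring
  intro m hm W
  have h2 := congrArg (coeff m) (h1 W)
  rw [isDiagonal_energyOp m hm, map_smul, coeff_rieszMap hm, mul_comm (embed W),
    integ_cosB_mul_embed, smul_eq_mul] at h2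
  have h3 := one_le_cast_sq (m := m) (by omega)
  have h4 : 4 * (m : ℝ) ^ 2 - 1 ≠ 0 := by linarith
  have := Real.pi_ne_zero
  simp only [threshold]
  field_simp at h2 ⊢
  have h5 : 1 + 4 * (m : ℝ) ^ 2 ≠ 0 := by positivity
  exact mul_right_cancel₀ h5 (by linear_combination h2)

lemma rescaled_zero (u : H) : rescaled (0, u) = Γderiv 0 u := by
  have h1 : HasDerivAt (fun t : ℝ => Γ (t • u)) (Γderiv 0 u) 0 := by
    have h2 : HasDerivAt (fun t : ℝ => t • u) u 0 := by
      simpa using (hasDerivAt_id (0 : ℝ)).smul_const u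
    have h3 : HasFDerivAt Γ (Γderiv 0) ((0 : ℝ) • u) := by
      rw [zero_smul]
      exact hasFDerivAt_Γ 0
    exact h3.comp_hasDerivAt 0 h2
  have h4 : HasDerivAt (fun t : ℝ => t • rescaled (t, u)) (rescaled (0, u)) 0 := by
    have h5 : DifferentiableAt ℝ (fun t : ℝ => rescaled (t, u)) 0 :=
      ((contDiff_rescaled (n := 1)).comp (contDiff_id.prodMk contDiff_const)).differentiable
        (by simp) 0
    exact ((hasDerivAt_id (0 : ℝ)).smul h5.hasDerivAt).congr_deriv (by simp)
  have h6 : (fun t : ℝ => Γ (t • u)) = fun t : ℝ => t • rescaled (t, u) := by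
    funext t
    exact Γ_smul t u
  rw [h6] at h1
  exact h4.unique h1

lemma Γ_zero : Γ 0 = 0 := by
  have := Γ_smul 0 0
  rwa [zero_smul, zero_smul] at this

/-! ### Bifurcation from a simple eigenvalue -/

section abstract_bifurcation

variable {X : Type*} [NormedAddCommGroup X] [InnerProductSpace ℝ X]

/-- The coordinate along `φ`: `φ`-coefficient of the orthogonal projection onto `ℝ φ`. -/
def coord (φ : X) : X →L[ℝ] ℝ := (‖φ‖ ^ 2)⁻¹ • innerSL ℝ φ

lemma coord_apply (φ y : X) : coord φ y = (‖φ‖ ^ 2)⁻¹ * inner ℝ φ y := rfl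

lemma coord_self {φ : X} (hφ : φ ≠ 0) : coord φ φ = 1 := by
  rw [coord_apply, real_inner_self_eq_norm_sq, inv_mul_cancel₀]
  exact pow_ne_zero 2 (norm_ne_zero_iff.2 hφ)

/-- The component orthogonal to `φ`. -/
def orthPart (φ : X) : X →L[ℝ] X := 1 - (coord φ).smulRight φ

lemma orthPart_apply (φ y : X) : orthPart φ y = y - coord φ y • φ := rfl

lemma coord_orthPart {φ : X} (hφ : φ ≠ 0) (y : X) : coord φ (orthPart φ y) = 0 := by
  rw [orthPart_apply, map_sub, map_smul, coord_self hφ, smul_eq_mul, mul_one, sub_self]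

lemma inner_orthPart {φ : X} (hφ : φ ≠ 0) (y : X) : inner ℝ φ (orthPart φ y) = 0 := by
  have h := coord_orthPart hφ y
  rw [coord_apply] at h
  exact (mul_eq_zero.1 h).resolve_left (inv_ne_zero (pow_ne_zero 2 (norm_ne_zero_iff.2 hφ)))

lemma coord_eq_zero {φ y : X} (h : inner ℝ φ y = 0) : coord φ y = 0 := by
  rw [coord_apply, h, mul_zero]

/-- The hypotheses of bifurcation from a simple eigenvalue for the equation `v = lam G(v)`: the
blow-up `N(t, u) = G(t u) / t` is of class `C²`, the linearisation `L` of `G` at `0` has the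
eigenvector `φ` for `1 / lam0`, and `1 - lam0 L` becomes invertible after a rank one perturbation
along `φ`. -/
structure SimpleEigen (G : X → X) (N : ℝ × X → X) (L : X →L[ℝ] X) (φ : X) (lam0 : ℝ) : Prop where
  smooth : ContDiff ℝ 2 N
  blowup : ∀ t u, G (t • u) = t • N (t, u)
  lin : ∀ u, N (0, u) = L u
  deriv : HasFDerivAt G L 0
  ne_zero : φ ≠ 0
  pos : 0 < lam0
  eigen : L φ = lam0⁻¹ • φ
  unit : IsUnit (1 - lam0 • L - lam0⁻¹ • (coord φ).smulRight φ)

variable {G : X → X} {N : ℝ × X → X} {L : X →L[ℝ] X} {φ : X} {lam0 : ℝ}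

/-- The equation after the blow-up; the unknown `y` encodes the increment `coord φ y` of the
parameter and the component `orthPart φ y` of the solution. -/
def blowupEq (N : ℝ × X → X) (φ : X) (lam0 : ℝ) (p : ℝ × X) : X :=
  φ + orthPart φ p.2 - (lam0 + coord φ p.2) • N (p.1, φ + orthPart φ p.2)

namespace SimpleEigen

lemma map_zero (h : SimpleEigen G N L φ lam0) : G 0 = 0 := by
  have := h.blowup 0 0
  rwa [zero_smul, zero_smul] at this

lemma contDiff_blowupEq (h : SimpleEigen G N L φ lam0) : ContDiff ℝ 2 (blowupEq N φ lam0) := by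
  have h1 : ContDiff ℝ 2 fun p : ℝ × X => φ + orthPart φ p.2 :=
    contDiff_const.add ((orthPart φ).contDiff.comp contDiff_snd)
  exact h1.sub ((contDiff_const.add ((coord φ).contDiff.comp contDiff_snd)).smul
    (h.smooth.comp (contDiff_fst.prodMk h1)))

lemma blowupEq_zero (h : SimpleEigen G N L φ lam0) : blowupEq N φ lam0 (0, 0) = 0 := by
  have := h.pos.ne'
  simp [blowupEq, h.lin, h.eigen, this]

lemma fderiv_blowupEq (h : SimpleEigen G N L φ lam0) :
    fderiv ℝ (blowupEq N φ lam0) (0, 0) ∘L .inr ℝ ℝ X =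
      1 - lam0 • L - lam0⁻¹ • (coord φ).smulRight φ := by
  have h1 : HasFDerivAt (fun y : X => blowupEq N φ lam0 (0, y))
      (fderiv ℝ (blowupEq N φ lam0) (0, 0) ∘L .inr ℝ ℝ X) 0 :=
    HasFDerivAt.comp (0 : X) (f := fun y : X => ((0 : ℝ), y))
      ((h.contDiff_blowupEq.differentiable (by simp) (0, 0)).hasFDerivAt)
      (hasFDerivAt_prodMk_right (0 : ℝ) (0 : X))
  have h2 : HasFDerivAt (fun y : X => φ + orthPart φ y) (orthPart φ) 0 :=
    ((orthPart φ).hasFDerivAt).const_add φ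
  have h3 : HasFDerivAt (fun y : X => lam0 + coord φ y) (coord φ) 0 :=
    ((coord φ).hasFDerivAt).const_add lam0
  have h4 := h2.sub (h3.smul ((L.hasFDerivAt (x := φ + orthPart φ 0)).comp (0 : X) h2))
  have h5 := h1.unique (h4.congr_of_eventuallyEq (Eventually.of_forall fun y => by
    simp [blowupEq, h.lin]))
  rw [h5]
  ext w
  have := h.pos.ne'
  simp only [_root_.map_zero, add_zero, zero_smul, sub_zero, Function.comp_apply, sub_apply,
    add_apply, smul_apply, ContinuousLinearMap.comp_apply, ContinuousLinearMap.smulRight_apply,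
    orthPart_apply, map_sub, map_smul, h.eigen, one_apply_eq_self]
  match_scalars <;> field_simp
  ring

/-- On the orthogonal complement of `φ` the operator `1 - lam0 L` is bounded below. -/
lemma exists_lower_bound (h : SimpleEigen G N L φ lam0) :
    ∃ c > 0, ∀ w, coord φ w = 0 → c * ‖w‖ ≤ ‖w - lam0 • L w‖ := by
  obtain ⟨u, hu⟩ := h.unit
  refine ⟨(‖(↑u⁻¹ : X →L[ℝ] X)‖ + 1)⁻¹, by positivity, fun w hw => ?_⟩
  have e1 : (u : X →L[ℝ] X) w = w - lam0 • L w := by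
    rw [hu]
    simp [hw]
  have e2 : (↑u⁻¹ : X →L[ℝ] X) ((u : X →L[ℝ] X) w) = w := by
    rw [← mul_apply_eq_comp, Units.inv_mul]
    rfl
  have h1 : ‖w‖ ≤ ‖(↑u⁻¹ : X →L[ℝ] X)‖ * ‖w - lam0 • L w‖ := by
    rw [← e1]
    nth_rw 1 [← e2]
    exact ContinuousLinearMap.le_opNorm _ _
  rw [inv_mul_le_iff₀ (by positivity)]
  nlinarith [norm_nonneg (w - lam0 • L w)]

/-- Small nontrivial solutions near `lam0` are almost parallel to `φ`. -/
lemma eventually_parallel (h : SimpleEigen G N L φ lam0) {ε : ℝ} (hε : 0 < ε) :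
    ∀ᶠ p in 𝓝 ((lam0, 0) : ℝ × X), p.2 = p.1 • G p.2 → p.2 ≠ 0 →
      coord φ p.2 ≠ 0 ∧ ‖orthPart φ p.2‖ ≤ ε * |coord φ p.2| := by
  obtain ⟨c, hc, hlow⟩ := h.exists_lower_bound
  have hφ : 0 < ‖φ‖ := norm_pos_iff.2 h.ne_zero
  -- the error allowed in the linearised equation
  obtain ⟨η, hη, hη1, hη2⟩ : ∃ η > 0, η ≤ c / 2 ∧ η * ‖φ‖ ≤ c / 2 * ε := by
    refine ⟨min (c / 2) (c / 2 * ε / ‖φ‖), by positivity, min_le_left _ _, ?_⟩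
    rw [← le_div_iff₀ hφ]
    exact min_le_right _ _
  have hlam := h.pos
  have e1 : ∀ᶠ V in 𝓝 (0 : X), ‖G V - L V‖ ≤ η / (2 * lam0) * ‖V‖ := by
    have := h.deriv.isLittleO.def (c := η / (2 * lam0)) (by positivity)
    simpa [h.map_zero] using this
  have e2 : ∀ᶠ lam in 𝓝 lam0, |lam - lam0| * (‖L‖ + η / (2 * lam0)) < η / 2 := by
    have : Tendsto (fun lam => |lam - lam0| * (‖L‖ + η / (2 * lam0))) (𝓝 lam0)
        (𝓝 (|lam0 - lam0| * (‖L‖ + η / (2 * lam0)))) := Continuous.tendsto (by fun_prop) _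
    refine this.eventually_lt_const ?_
    simp only [sub_self, abs_zero, zero_mul]
    positivity
  rw [nhds_prod_eq]
  filter_upwards [e2.prod_mk e1] with p hp hsol hne
  obtain ⟨hp2, hp1⟩ := hp
  set V := p.2 with hV
  set t := coord φ V with ht
  set w := orthPart φ V with hw
  have hVw : V = w + t • φ := by rw [hw, orthPart_apply, ht]; abel
  have hkey : w - lam0 • L w = (p.1 - lam0) • G V + lam0 • (G V - L V) := by
    have e3 : V - lam0 • L V = w - lam0 • L w := by
      rw [hVw, map_add, map_smul, h.eigen, smul_add, smul_comm t, smul_inv_smul₀ hlam.ne']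
      abel
    rw [← e3]
    nth_rw 1 [hsol]
    rw [sub_smul, smul_sub]
    abel
  have hG : ‖G V‖ ≤ (‖L‖ + η / (2 * lam0)) * ‖V‖ := by
    calc ‖G V‖ = ‖L V + (G V - L V)‖ := by rw [add_sub_cancel]
      _ ≤ ‖L V‖ + ‖G V - L V‖ := norm_add_le _ _
      _ ≤ ‖L‖ * ‖V‖ + η / (2 * lam0) * ‖V‖ := add_le_add (L.le_opNorm _) hp1
      _ = _ := by ring
  have hVle : ‖V‖ ≤ ‖w‖ + |t| * ‖φ‖ := by
    rw [hVw]
    refine (norm_add_le _ _).trans ?_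
    rw [norm_smul, Real.norm_eq_abs]
  have hmain : c * ‖w‖ ≤ η * ‖V‖ := by
    refine (hlow w (coord_orthPart h.ne_zero V)).trans ?_
    rw [hkey]
    refine (norm_add_le _ _).trans ?_
    rw [norm_smul, norm_smul, Real.norm_eq_abs, Real.norm_of_nonneg hlam.le]
    have i1 : |p.1 - lam0| * ‖G V‖ ≤ η / 2 * ‖V‖ := by
      calc |p.1 - lam0| * ‖G V‖ ≤ |p.1 - lam0| * ((‖L‖ + η / (2 * lam0)) * ‖V‖) := by gcongr
        _ = |p.1 - lam0| * (‖L‖ + η / (2 * lam0)) * ‖V‖ := by ring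
        _ ≤ _ := by gcongr
    have i2 : lam0 * ‖G V - L V‖ ≤ η / 2 * ‖V‖ := by
      calc lam0 * ‖G V - L V‖ ≤ lam0 * (η / (2 * lam0) * ‖V‖) := by gcongr
        _ = _ := by field_simp
    linarith
  have hfin : ‖w‖ ≤ ε * |t| := by
    have i3 : η * ‖V‖ ≤ c / 2 * ‖w‖ + c / 2 * ε * |t| := by
      calc η * ‖V‖ ≤ η * (‖w‖ + |t| * ‖φ‖) := by gcongr
        _ = η * ‖w‖ + η * ‖φ‖ * |t| := by ring
        _ ≤ _ := by gcongr
    have : c / 2 * ‖w‖ ≤ c / 2 * (ε * |t|) := by linarith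
    exact le_of_mul_le_mul_left this (by positivity)
  refine ⟨fun ht0 => hne ?_, hfin⟩
  rw [ht0, abs_zero, mul_zero] at hfin
  rw [hVw, ht0, norm_le_zero_iff.1 hfin, zero_smul, add_zero]

variable [CompleteSpace X]

/-- The implicit function theorem applied to the blown-up equation. -/
lemma exists_curve (h : SimpleEigen G N L φ lam0) : ∃ y : ℝ → X, ContDiffAt ℝ 2 y 0 ∧ y 0 = 0 ∧
    ∀ᶠ v in 𝓝 ((0, 0) : ℝ × X), blowupEq N φ lam0 v = 0 ↔ y v.1 = v.2 := by
  have hc : ContDiffAt ℝ 2 (blowupEq N φ lam0) (0, 0) := h.contDiff_blowupEq.contDiffAt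
  have hi : (fderiv ℝ (blowupEq N φ lam0) (0, 0) ∘L .inr ℝ ℝ X).IsInvertible := by
    rw [h.fderiv_blowupEq]
    obtain ⟨u, hu⟩ := h.unit
    exact ⟨ContinuousLinearEquiv.ofUnit u, hu⟩
  refine ⟨hc.implicitFunction two_ne_zero hi, hc.contDiffAt_implicitFunction two_ne_zero hi,
    hc.implicitFunction_apply_self two_ne_zero hi, ?_⟩
  have := hc.eventually_apply_eq_iff_implicitFunction two_ne_zero hi
  rwa [h.blowupEq_zero] at this

/-- The local branch of nontrivial solutions, and the fact that it contains all of them. -/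
theorem exists_branch (h : SimpleEigen G N L φ lam0) : ∃ δ > 0, ∃ (μ : ℝ → ℝ) (z : ℝ → X),
    (∀ t ∈ Ioo (-δ) δ, ContDiffAt ℝ 2 μ t ∧ ContDiffAt ℝ 2 z t) ∧ μ 0 = 0 ∧ z 0 = 0 ∧
    (∀ t, inner ℝ φ (z t) = 0) ∧
    (∀ t ∈ Ioo (-δ) δ, φ + z t = (lam0 + μ t) • N (t, φ + z t)) ∧
    ∀ δ' > 0, ∃ U ∈ 𝓝 ((lam0, 0) : ℝ × X), ∀ p ∈ U, p.2 = p.1 • G p.2 → p.2 ≠ 0 →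
      ∃ t ∈ Ioo (-δ') δ', t ≠ 0 ∧ p = (lam0 + μ t, t • (φ + z t)) := by
  obtain ⟨y, hy, hy0, hiff⟩ := h.exists_curve
  have hyc : Tendsto (fun t => (t, y t)) (𝓝 0) (𝓝 ((0, 0) : ℝ × X)) := by
    have := hy.continuousAt
    rw [ContinuousAt, hy0] at this
    exact tendsto_id.prodMk_nhds this
  have hev1 : ∀ᶠ t in 𝓝 (0 : ℝ), blowupEq N φ lam0 (t, y t) = 0 := by
    filter_upwards [hyc.eventually hiff] with t ht
    exact ht.2 rfl
  have hev2 : ∀ᶠ t in 𝓝 (0 : ℝ), ContDiffAt ℝ 2 y t := hy.eventually (by simp)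
  obtain ⟨δ, hδ, hball⟩ := Metric.eventually_nhds_iff.1 (hev1.and hev2)
  have hmem : ∀ t ∈ Ioo (-δ) δ, dist t 0 < δ := fun t ht => by
    rw [Real.dist_eq, sub_zero, abs_lt]
    exact ht
  refine ⟨δ, hδ, fun t => coord φ (y t), fun t => orthPart φ (y t), fun t ht => ⟨?_, ?_⟩, ?_, ?_,
    fun t => inner_orthPart h.ne_zero _, fun t ht => ?_, fun δ' hδ' => ?_⟩
  · exact (coord φ).contDiff.contDiffAt.comp t (hball (hmem t ht)).2
  · exact (orthPart φ).contDiff.contDiffAt.comp t (hball (hmem t ht)).2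
  · simp [hy0]
  · simp [hy0]
  · exact sub_eq_zero.1 (hball (hmem t ht)).1
  · -- a solution `(lam, V)` corresponds to the point `((lam - lam0) φ + w / t)` of the blow-up
    obtain ⟨ρ, hρ, hρb⟩ := Metric.eventually_nhds_iff.1 hiff
    have hφ : 0 < ‖φ‖ := norm_pos_iff.2 h.ne_zero
    have e1 := h.eventually_parallel (ε := ρ / 2) (by positivity)
    have e2 : ∀ᶠ p in 𝓝 ((lam0, 0) : ℝ × X), |p.1 - lam0| * ‖φ‖ < ρ / 2 := by
      have : Tendsto (fun p : ℝ × X => |p.1 - lam0| * ‖φ‖) (𝓝 (lam0, 0))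
          (𝓝 (|lam0 - lam0| * ‖φ‖)) :=
        Continuous.tendsto (f := fun p : ℝ × X => |p.1 - lam0| * ‖φ‖) (by fun_prop) _
      refine this.eventually_lt_const ?_
      simp only [sub_self, abs_zero, zero_mul]
      positivity
    have e3 : ∀ᶠ p in 𝓝 ((lam0, 0) : ℝ × X), |coord φ p.2| < min δ' ρ := by
      have : Tendsto (fun p : ℝ × X => |coord φ p.2|) (𝓝 (lam0, 0))
          (𝓝 (|coord φ (0 : X)|)) :=
        Continuous.tendsto (f := fun p : ℝ × X => |coord φ p.2|) (by fun_prop) _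
      refine this.eventually_lt_const ?_
      simp only [_root_.map_zero, abs_zero]
      positivity
    refine ⟨_, (e1.and (e2.and e3)), ?_⟩
    rintro p ⟨h1, h2, h3⟩ hsol hne
    obtain ⟨ht, hw⟩ := h1 hsol hne
    set t := coord φ p.2 with htdef
    set y' : X := (p.1 - lam0) • φ + t⁻¹ • orthPart φ p.2 with hy'
    have c1 : coord φ y' = p.1 - lam0 := by
      rw [hy', map_add, map_smul, map_smul, coord_self h.ne_zero, coord_orthPart h.ne_zero]
      simp
    have c2 : orthPart φ y' = t⁻¹ • orthPart φ p.2 := by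
      rw [orthPart_apply, c1, hy', add_sub_cancel_left]
    have c3 : t • (φ + orthPart φ y') = p.2 := by
      rw [c2, smul_add, smul_inv_smul₀ ht, orthPart_apply, add_sub_cancel]
    have hnorm : ‖y'‖ < ρ := by
      calc ‖y'‖ ≤ ‖(p.1 - lam0) • φ‖ + ‖t⁻¹ • orthPart φ p.2‖ := norm_add_le _ _
        _ = |p.1 - lam0| * ‖φ‖ + |t|⁻¹ * ‖orthPart φ p.2‖ := by
            rw [norm_smul, norm_smul, norm_inv, Real.norm_eq_abs, Real.norm_eq_abs]
        _ < ρ / 2 + |t|⁻¹ * (ρ / 2 * |t|) := add_lt_add_of_lt_of_le h2 (by gcongr)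
        _ = ρ := by
            have : |t| ≠ 0 := abs_ne_zero.2 ht
            field_simp
            ring
    have hzero : blowupEq N φ lam0 (t, y') = 0 := by
      have h5 : t • blowupEq N φ lam0 (t, y') = 0 := by
        simp only [blowupEq]
        rw [smul_sub, smul_comm t, ← h.blowup, c3, c1, add_sub_cancel, sub_eq_zero]
        exact hsol
      exact (smul_eq_zero.1 h5).resolve_left ht
    have hyt : y t = y' := by
      refine (hρb (y := (t, y')) ?_).1 hzero
      rw [Prod.dist_eq, max_lt_iff]
      simp only [dist_zero_right, Real.norm_eq_abs]
      exact ⟨h3.trans_le (min_le_right _ _), hnorm⟩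
    refine ⟨t, abs_lt.1 (h3.trans_le (min_le_left _ _)), ht, ?_⟩
    change p = (lam0 + coord φ (y t), t • (φ + orthPart φ (y t)))
    rw [hyt, c1, c3, add_sub_cancel]

end SimpleEigen

/-- If the parameter increases strictly along both halves of a branch that contains all small
nontrivial solutions, there are exactly two small nontrivial solutions just above `lam0` and none
below. -/
lemma exactly_two_of_branch {G : X → X} {φ : X} {lam0 δ : ℝ} {μ : ℝ → ℝ} {z : ℝ → X} (hφ : φ ≠ 0)
    (hδ : 0 < δ) (hμ : ContinuousOn μ (Ioo (-δ) δ)) (hz : ContinuousOn z (Ioo (-δ) δ))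
    (hμ0 : μ 0 = 0) (hinc : StrictMonoOn μ (Ico 0 δ)) (hdec : StrictAntiOn μ (Ioc (-δ) 0))
    (horth : ∀ t, inner ℝ φ (z t) = 0)
    (hsol : ∀ t ∈ Ioo (-δ) δ, t • (φ + z t) = (lam0 + μ t) • G (t • (φ + z t)))
    (hall : ∃ U ∈ 𝓝 ((lam0, 0) : ℝ × X), ∀ p ∈ U, p.2 = p.1 • G p.2 → p.2 ≠ 0 →
      ∃ t ∈ Ioo (-δ) δ, t ≠ 0 ∧ p = (lam0 + μ t, t • (φ + z t))) :
    ∃ r₀ > 0, ∀ r : ℝ, 0 < r → r < r₀ → ∃ ε > 0,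
      (∀ lam ∈ Ioc (lam0 - ε) lam0, {V : X | ‖V‖ < r ∧ V ≠ 0 ∧ V = lam • G V} = ∅) ∧
      (∀ lam ∈ Ioo lam0 (lam0 + ε), {V : X | ‖V‖ < r ∧ V ≠ 0 ∧ V = lam • G V}.ncard = 2) := by
  obtain ⟨U, hU, hUb⟩ := hall
  obtain ⟨ρ, hρ, hball⟩ := Metric.mem_nhds_iff.1 hU
  have hpos : ∀ t ∈ Ioo (-δ) δ, t ≠ 0 → 0 < μ t := by
    intro t ht hne
    rw [← hμ0]
    rcases hne.lt_or_gt with h | h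
    · exact hdec ⟨ht.1, h.le⟩ ⟨by linarith, le_rfl⟩ h
    · exact hinc ⟨le_rfl, hδ⟩ ⟨h.le, ht.2⟩ h
  have hcoord : ∀ t, coord φ (t • (φ + z t)) = t := fun t => by
    rw [map_smul, map_add, coord_self hφ, coord_eq_zero (horth t), add_zero, smul_eq_mul, mul_one]
  refine ⟨ρ, hρ, fun r hr hrρ => ?_⟩
  have h0 : Ioo (-δ) δ ∈ 𝓝 (0 : ℝ) := Ioo_mem_nhds (by linarith) hδ
  have hVlim : ∀ᶠ t in 𝓝 (0 : ℝ), ‖t • (φ + z t)‖ < r := by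
    have hcz : ContinuousAt z 0 := hz.continuousAt h0
    have : ContinuousAt (fun t : ℝ => ‖t • (φ + z t)‖) 0 :=
      (continuousAt_id.smul (continuousAt_const.add hcz)).norm
    refine this.eventually_lt_const ?_
    simpa using hr
  obtain ⟨κ, hκ, hκb⟩ := Metric.eventually_nhds_iff.1 hVlim
  obtain ⟨δ1, hδ1, hδ1δ, hδ1κ⟩ : ∃ δ1 > 0, δ1 < δ ∧ δ1 < κ :=
    ⟨min δ κ / 2, by positivity, by linarith [min_le_left δ κ, lt_min hδ hκ],
      by linarith [min_le_right δ κ, lt_min hδ hκ]⟩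
  have hsmall : ∀ t, |t| ≤ δ1 → ‖t • (φ + z t)‖ < r := fun t ht =>
    hκb (by rw [Real.dist_eq, sub_zero]; linarith)
  have p1 := hpos δ1 ⟨by linarith, hδ1δ⟩ hδ1.ne'
  have p2 := hpos (-δ1) ⟨by linarith, by linarith⟩ (by linarith)
  have hmemU : ∀ lam V, |lam - lam0| < ρ → ‖V‖ < r → (lam, V) ∈ U := by
    intro lam V h1 h2
    refine hball ?_
    rw [Metric.mem_ball, Prod.dist_eq, max_lt_iff, dist_zero_right, Real.dist_eq]
    exact ⟨h1, h2.trans hrρ⟩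
  refine ⟨min ρ (min (μ δ1) (μ (-δ1))), by positivity, fun lam hlam => ?_, fun lam hlam => ?_⟩
  · rw [eq_empty_iff_forall_notMem]
    rintro V ⟨hV, hne, hs⟩
    have hb : |lam - lam0| < ρ := by
      rw [abs_lt]
      constructor <;> linarith [hlam.1, hlam.2, min_le_left ρ (min (μ δ1) (μ (-δ1)))]
    obtain ⟨t, ht, htne, hp⟩ := hUb (lam, V) (hmemU lam V hb hV) hs hne
    have := hpos t ht htne
    have h3 : lam = lam0 + μ t := congrArg Prod.fst hp
    linarith [hlam.2]
  · have m1 := min_le_left ρ (min (μ δ1) (μ (-δ1)))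
    have m2 := (min_le_right ρ (min (μ δ1) (μ (-δ1)))).trans (min_le_left _ _)
    have m3 := (min_le_right ρ (min (μ δ1) (μ (-δ1)))).trans (min_le_right _ _)
    have hb : |lam - lam0| < ρ := by
      rw [abs_lt]
      constructor <;> linarith [hlam.1, hlam.2]
    obtain ⟨a, ha, hμa⟩ : ∃ a ∈ Icc 0 δ1, μ a = lam - lam0 :=
      intermediate_value_Icc hδ1.le
        (hμ.mono fun t ht => ⟨by linarith [ht.1], by linarith [ht.2]⟩)
        (by rw [hμ0]; exact ⟨by linarith [hlam.1], by linarith [hlam.2]⟩)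
    obtain ⟨b, hb', hμb⟩ : ∃ b ∈ Icc (-δ1) 0, μ b = lam - lam0 :=
      intermediate_value_Icc' (by linarith)
        (hμ.mono fun t ht => ⟨by linarith [ht.1], by linarith [ht.2]⟩)
        (by rw [hμ0]; exact ⟨by linarith [hlam.1], by linarith [hlam.2]⟩)
    have ha0 : a ≠ 0 := by
      rintro rfl
      linarith [hlam.1]
    have hb0 : b ≠ 0 := by
      rintro rfl
      linarith [hlam.1]
    have hset : {V : X | ‖V‖ < r ∧ V ≠ 0 ∧ V = lam • G V} =
        {a • (φ + z a), b • (φ + z b)} := by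
      ext V
      constructor
      · rintro ⟨hV, hne, hs⟩
        obtain ⟨t, ht, htne, hp⟩ := hUb (lam, V) (hmemU lam V hb hV) hs hne
        have h3 : lam = lam0 + μ t := congrArg Prod.fst hp
        have h4 : V = t • (φ + z t) := congrArg Prod.snd hp
        rcases htne.lt_or_gt with h | h
        · have : t = b := hdec.injOn ⟨ht.1, h.le⟩ ⟨by linarith [hb'.1], hb'.2⟩ (by linarith)
          right
          rw [h4, this]
          rfl
        · have : t = a := hinc.injOn ⟨h.le, ht.2⟩ ⟨ha.1, by linarith [ha.2]⟩ (by linarith)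
          left
          rw [h4, this]
      · have hof : ∀ t, |t| ≤ δ1 → t ≠ 0 → μ t = lam - lam0 →
            ‖t • (φ + z t)‖ < r ∧ t • (φ + z t) ≠ 0 ∧
              t • (φ + z t) = lam • G (t • (φ + z t)) := by
          intro t ht htne hμt
          refine ⟨hsmall t ht, fun h0 => htne ?_, ?_⟩
          · rw [← hcoord t, h0, map_zero]
          · have h5 := abs_le.1 ht
            have := hsol t ⟨by linarith, by linarith⟩
            rwa [hμt, add_sub_cancel] at this
        rintro (rfl | rfl)
        · exact hof a (abs_le.2 ⟨by linarith [ha.1], ha.2⟩) ha0 hμa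
        · exact hof b (abs_le.2 ⟨hb'.1, by linarith [hb'.2]⟩) hb0 hμb
    rw [hset, ncard_pair]
    intro heq
    have := congrArg (coord φ) heq
    rw [hcoord, hcoord] at this
    have h1 : a = 0 := le_antisymm (this ▸ hb'.2) ha.1
    exact ha0 h1

end abstract_bifurcation

/-! ### The linearisation at the trivial solution -/

lemma tendsto_threshold : Tendsto threshold atTop atTop := by
  have h : Tendsto (fun m : ℕ => (m : ℝ)) atTop atTop := tendsto_natCast_atTop_atTop
  refine tendsto_atTop_mono' _ ?_ h
  filter_upwards [eventually_ge_atTop 1] with m hm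
  have h1 : (1 : ℝ) ≤ m := by exact_mod_cast hm
  have h2 : (m : ℝ) ≤ 4 * (m : ℝ) ^ 2 - 1 := by nlinarith
  have h3 : (4 * (m : ℝ) ^ 2 - 1) * 2 ≤ (4 * (m : ℝ) ^ 2 - 1) * π :=
    mul_le_mul_of_nonneg_left Real.two_le_pi (by linarith)
  unfold threshold
  linarith

lemma threshold_inj {j m : ℕ} (h : threshold j = threshold m) : j = m := by
  have hp := Real.pi_ne_zero
  have h1 : (j : ℝ) ^ 2 = (m : ℝ) ^ 2 := by
    unfold threshold at h
    field_simp at h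
    linarith
  exact_mod_cast (pow_left_inj₀ (Nat.cast_nonneg j) (Nat.cast_nonneg m) two_ne_zero).1 h1

lemma exists_pos_le_of_lt (f : ℕ → ℝ) (n : ℕ) : ∃ c > 0, ∀ j < n, 0 < f j → c ≤ f j := by
  induction n with
  | zero => exact ⟨1, one_pos, fun j hj => absurd hj (by omega)⟩
  | succ n ih =>
    obtain ⟨c, hc, h⟩ := ih
    by_cases hn : 0 < f n
    · refine ⟨min c (f n), lt_min hc hn, fun j hj hfj => ?_⟩
      rcases Nat.lt_succ_iff_lt_or_eq.1 hj with h1 | rfl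
      · exact (min_le_left _ _).trans (h j h1 hfj)
      · exact min_le_right _ _
    · refine ⟨c, hc, fun j hj hfj => ?_⟩
      rcases Nat.lt_succ_iff_lt_or_eq.1 hj with h1 | rfl
      · exact h j h1 hfj
      · exact absurd hfj hn

/-- The nonzero entries of `1 - lam DΓ(0)` stay away from zero. -/
lemma exists_entry_bound (lam : ℝ) : ∃ c > 0, ∀ j, j ≠ 0 → threshold j ≠ lam →
    c ≤ |1 - lam * (threshold j)⁻¹| := by
  have h1 : Tendsto (fun j => |1 - lam * (threshold j)⁻¹|) atTop (𝓝 1) := by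
    have h2 := ((tendsto_inv_atTop_zero.comp tendsto_threshold).const_mul lam).const_sub 1
    have := h2.abs
    simpa using this
  obtain ⟨n, hn⟩ := eventually_atTop.1 (h1.eventually_const_le (by norm_num : (1 / 2 : ℝ) < 1))
  obtain ⟨c, hc, h⟩ := exists_pos_le_of_lt (fun j => |1 - lam * (threshold j)⁻¹|) n
  refine ⟨min c (1 / 2), by positivity, fun j hj hne => ?_⟩
  rcases lt_or_ge j n with hjn | hjn
  · refine (min_le_left _ _).trans (h j hjn (abs_pos.2 fun h0 => hne ?_))
    have := (threshold_pos hj).ne'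
    field_simp at h0
    linarith
  · exact (min_le_right _ _).trans (hn j hjn)

lemma isDiagonal_one_sub (lam : ℝ) :
    IsDiagonal (1 - lam • Γderiv 0) (fun j => 1 - lam * (threshold j)⁻¹) := by
  intro j hj V
  have h : coeff j ((1 - lam • Γderiv 0) V) = coeff j V - lam * coeff j (Γderiv 0 V) := by
    simp
  rw [h, isDiagonal_Γderiv_zero j hj]
  ring

lemma cosMode_ne_zero {m : ℕ} (hm : m ≠ 0) : cosMode m ≠ 0 := fun h => by
  have := norm_cosMode_pos hm
  rw [h, norm_zero] at this
  exact lt_irrefl _ this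

lemma coord_cosMode {m : ℕ} (hm : m ≠ 0) (V : H) : coord (cosMode m) V = coeff m V := by
  rw [coord_apply, inner_cosMode hm, norm_cosMode_sq hm]
  have := Real.pi_pos
  field_simp

lemma isUnit_bifurcation {m : ℕ} (hm : m ≠ 0) : IsUnit (1 - threshold m • Γderiv 0 -
    (threshold m)⁻¹ • (coord (cosMode m)).smulRight (cosMode m)) := by
  obtain ⟨c, hc, hb⟩ := exists_entry_bound (threshold m)
  have hp := threshold_pos hm
  have hd : IsDiagonal (1 - threshold m • Γderiv 0 -
      (threshold m)⁻¹ • (coord (cosMode m)).smulRight (cosMode m))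
      (fun j => 1 - threshold m * (threshold j)⁻¹ - if j = m then (threshold m)⁻¹ else 0) := by
    intro j hj V
    have h : coeff j ((1 - threshold m • Γderiv 0 -
        (threshold m)⁻¹ • (coord (cosMode m)).smulRight (cosMode m)) V) =
        coeff j ((1 - threshold m • Γderiv 0) V) -
        (threshold m)⁻¹ * (coord (cosMode m) V * coeff j (cosMode m)) := by
      rw [sub_apply, map_sub, smul_apply, ContinuousLinearMap.smulRight_apply]
      simp only [map_smul, smul_eq_mul]
    rw [h, isDiagonal_one_sub _ j hj, coord_cosMode hm, coeff_cosMode hm]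
    by_cases hjm : j = m
    · rw [hjm]
      simp only [if_pos]
      ring
    · simp only [if_neg hjm]
      ring
  refine hd.isUnit (c := min c (threshold m)⁻¹) (by positivity) fun j hj => ?_
  by_cases hjm : j = m
  · rw [if_pos hjm, hjm, mul_inv_cancel₀ hp.ne', sub_self, zero_sub, abs_neg,
      abs_of_pos (by positivity)]
    exact min_le_right _ _
  · rw [if_neg hjm, sub_zero]
    exact (min_le_left _ _).trans (hb j hj fun h => hjm (threshold_inj h))

lemma simpleEigen {m : ℕ} (hm : m ≠ 0) :
    SimpleEigen Γ rescaled (Γderiv 0) (cosMode m) (threshold m) where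
  smooth := contDiff_rescaled
  blowup := Γ_smul
  lin := rescaled_zero
  deriv := hasFDerivAt_Γ 0
  ne_zero := cosMode_ne_zero hm
  pos := threshold_pos hm
  eigen := isDiagonal_Γderiv_zero.apply_cosMode hm
  unit := isUnit_bifurcation hm

/-! ### Direction of the branch -/

/-- A `C²` function with `μ(t) / t² → κ > 0` increases away from `0` on both sides. -/
lemma eventually_mul_deriv_pos {μ : ℝ → ℝ} (hμ : ContDiffAt ℝ 2 μ 0) (h0 : μ 0 = 0) {κ : ℝ}
    (hκ : 0 < κ) (hlim : Tendsto (fun t => μ t / t ^ 2) (𝓝[≠] 0) (𝓝 κ)) :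
    ∀ᶠ t in 𝓝[≠] (0 : ℝ), 0 < t * deriv μ t := by
  have hd1 : ContDiffAt ℝ 1 (deriv μ) 0 :=
    (hμ.fderiv_right (m := 1) (by norm_num)).clm_apply contDiffAt_const
  have hdiff : ∀ᶠ t in 𝓝 (0 : ℝ), HasDerivAt μ (deriv μ t) t := by
    filter_upwards [hμ.eventually (by simp)] with t ht
    exact (ht.differentiableAt (by simp)).hasDerivAt
  have hz : deriv μ 0 = 0 := by
    have h1 := (hasDerivAt_iff_tendsto_slope.1 hdiff.self_of_nhds)
    have h2 : Tendsto (fun t : ℝ => t * (μ t / t ^ 2)) (𝓝[≠] 0) (𝓝 (0 * κ)) :=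
      (tendsto_id.mono_left nhdsWithin_le_nhds).mul hlim
    rw [zero_mul] at h2
    refine tendsto_nhds_unique h1 (h2.congr' ?_)
    filter_upwards [self_mem_nhdsWithin] with t ht
    have ht' : t ≠ 0 := ht
    rw [slope_def_field, h0]
    field_simp
    ring
  have h2 : Tendsto (fun t => deriv μ t / t) (𝓝[≠] 0) (𝓝 (deriv (deriv μ) 0)) := by
    have := hasDerivAt_iff_tendsto_slope.1 (hd1.differentiableAt (by simp)).hasDerivAt
    refine this.congr fun t => ?_
    rw [slope_def_field, hz, sub_zero, sub_zero]
  have h3 : Tendsto (fun t => μ t / t ^ 2) (𝓝[≠] 0) (𝓝 (deriv (deriv μ) 0 / 2)) := by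
    refine HasDerivAt.lhopital_zero_nhdsNE (f' := deriv μ) (g' := fun t => 2 * t)
      (hdiff.filter_mono nhdsWithin_le_nhds) (Eventually.of_forall fun t => ?_) ?_ ?_ ?_ ?_
    · simpa using hasDerivAt_pow 2 t
    · filter_upwards [self_mem_nhdsWithin] with t ht
      exact mul_ne_zero two_ne_zero ht
    · have := hμ.continuousAt.tendsto
      rw [h0] at this
      exact this.mono_left nhdsWithin_le_nhds
    · have : Tendsto (fun t : ℝ => t ^ 2) (𝓝 0) (𝓝 (0 ^ 2)) :=
        (continuous_pow 2).tendsto 0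
      rw [zero_pow two_ne_zero] at this
      exact this.mono_left nhdsWithin_le_nhds
    · refine (h2.div_const 2).congr fun t => ?_
      rw [div_div, mul_comm]
  have h4 : 0 < deriv (deriv μ) 0 := by
    have := tendsto_nhds_unique hlim h3
    linarith
  filter_upwards [h2.eventually_const_lt h4, self_mem_nhdsWithin] with t ht hne
  have hne' : t ≠ 0 := hne
  have : t * deriv μ t = t ^ 2 * (deriv μ t / t) := by
    field_simp
  rw [this]
  positivity

/-- The third order Taylor expansion of the exponential along a curve. -/
lemma exists_exp_expansion {U : ℝ → ℝ →ᵇ ℝ} {U0 : ℝ →ᵇ ℝ} (hU : Tendsto U (𝓝[≠] 0) (𝓝 U0)) :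
    ∃ R : ℝ → ℝ →ᵇ ℝ, Tendsto R (𝓝[≠] 0) (𝓝 0) ∧ ∀ t, t ≠ 0 →
      NormedSpace.exp (-(t • U t)) = 1 - t • U t + (t ^ 2 / 2) • (U t * U t) -
        (t ^ 3 / 6) • (U t * U t * U t) + t ^ 3 • R t := by
  set P : ℝ → ℝ →ᵇ ℝ := fun t => 1 - t • U t + (t ^ 2 / 2) • (U t * U t) -
        (t ^ 3 / 6) • (U t * U t * U t) with hP
  refine ⟨fun t => (t ^ 3)⁻¹ • (NormedSpace.exp (-(t • U t)) - P t), ?_, fun t ht => ?_⟩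
  · have h1 := (NormedSpace.exp_hasFPowerSeriesAt_zero (𝕂 := ℝ)
      (𝔸 := ℝ →ᵇ ℝ)).isBigO_sub_partialSum_pow 4
    have ht0 : Tendsto (fun t : ℝ => t) (𝓝[≠] 0) (𝓝 0) := tendsto_id.mono_left nhdsWithin_le_nhds
    have h2 : Tendsto (fun t => -(t • U t)) (𝓝[≠] 0) (𝓝 0) := by
      have := (ht0.smul hU).neg
      rwa [zero_smul, neg_zero] at this
    have h3 := h1.comp_tendsto h2
    have e : ∀ t, (NormedSpace.expSeries ℝ (ℝ →ᵇ ℝ)).partialSum 4 (-(t • U t)) = P t := by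
      intro t
      simp only [FormalMultilinearSeries.partialSum, NormedSpace.expSeries_apply_eq,
        Finset.sum_range_succ, Finset.sum_range_zero, hP]
      ext θ
      simp [Nat.factorial]
      ring
    have h4 : (fun t => NormedSpace.exp (-(t • U t)) - P t) =O[𝓝[≠] 0] fun t : ℝ => t ^ 4 := by
      refine Asymptotics.IsBigO.trans (g := fun t : ℝ => ‖-(t • U t)‖ ^ 4) ?_ ?_
      · refine h3.congr_left fun t => ?_
        simp only [Function.comp_apply, zero_add]
        rw [e]
      · have h5 : (fun t => ‖-(t • U t)‖) =O[𝓝[≠] 0] fun t : ℝ => t := by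
          have h6 := (Asymptotics.isBigO_refl (fun t : ℝ => t) (𝓝[≠] 0)).smul
            (hU.isBigO_one ℝ)
          simp only [smul_eq_mul, mul_one] at h6
          exact h6.neg_left.norm_left
        exact h5.pow 4
    have h7 : (fun t => (t ^ 3)⁻¹ • (NormedSpace.exp (-(t • U t)) - P t)) =O[𝓝[≠] 0]
        fun t : ℝ => (t ^ 3)⁻¹ • t ^ 4 :=
      (Asymptotics.isBigO_refl (fun t : ℝ => (t ^ 3)⁻¹) _).smul h4
    refine h7.trans_tendsto (ht0.congr' ?_)
    filter_upwards [self_mem_nhdsWithin] with t ht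
    have ht' : t ≠ 0 := ht
    rw [smul_eq_mul]
    field_simp
  · rw [smul_inv_smul₀ (pow_ne_zero 3 ht), hP]
    simp only
    abel

lemma integ_cosB {m : ℕ} (hm : m ≠ 0) : integ (cosB m) = 0 := by
  rw [← embed_cosMode hm, integ_embed]

lemma integ_cosB_mul_cosB {m : ℕ} (hm : m ≠ 0) (j : ℕ) :
    integ (cosB j * cosB m) = if j = m then π else 0 := by
  rw [integ_apply, ← integral_cos_mul_cos j m hm]
  rfl

lemma cosB_mul_self (m : ℕ) : cosB m * cosB m = (1 / 2 : ℝ) • (1 + cosB (2 * m)) := by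
  ext θ
  have : 2 * ((2 * m : ℕ) : ℝ) * θ = 2 * (2 * m * θ) := by push_cast; ring
  simp only [BoundedContinuousFunction.mul_apply, cosB_apply, BoundedContinuousFunction.smul_apply,
    BoundedContinuousFunction.add_apply, BoundedContinuousFunction.coe_one, Pi.one_apply, this,
    Real.cos_two_mul,
    smul_eq_mul]
  ring

lemma integ_cosB_sq_mul (m : ℕ) (g : ℝ →ᵇ ℝ) :
    integ (cosB m * cosB m * g) = (integ g + integ (cosB (2 * m) * g)) / 2 := by
  rw [cosB_mul_self, smul_mul_assoc, map_smul, add_mul, one_mul, map_add, smul_eq_mul]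
  ring

lemma integ_cosB_pow_three {m : ℕ} (hm : m ≠ 0) : integ (cosB m * cosB m * cosB m) = 0 := by
  rw [integ_cosB_sq_mul, integ_cosB hm, integ_cosB_mul_cosB hm, if_neg (by omega)]
  simp

lemma integ_cosB_pow_four {m : ℕ} (hm : m ≠ 0) :
    integ (cosB m * cosB m * cosB m * cosB m) = 3 * π / 4 := by
  rw [mul_assoc, integ_cosB_sq_mul, mul_comm (cosB (2 * m)), integ_cosB_sq_mul,
    integ_cosB_mul_cosB hm, integ_cosB (by omega), integ_cosB_mul_cosB (by omega), if_pos rfl,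
    if_pos rfl]
  ring

lemma integ_cosB_sq_mul_double {m : ℕ} (hm : m ≠ 0) :
    integ (cosB m * cosB m * cosB (2 * m)) = π / 2 := by
  rw [integ_cosB_sq_mul, integ_cosB (by omega), integ_cosB_mul_cosB (by omega), if_pos rfl]
  ring

lemma fourierCos_eq_threshold {m : ℕ} (hm : m ≠ 0) :
    fourierCos kernel m = -2 * (threshold m)⁻¹ := by
  have h1 := one_le_cast_sq (m := m) (by omega)
  have h2 : 4 * (m : ℝ) ^ 2 - 1 ≠ 0 := by linarith
  have := Real.pi_ne_zero
  rw [fourierCos_kernel (by omega), threshold]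
  field_simp
  norm_num

/-- The Fourier coefficients of a solution, in a form free of the normalisation. -/
lemma coeff_of_solution {j : ℕ} (hj : j ≠ 0) {lam t : ℝ} {u : H}
    (h : t • u = lam • Γ (t • u)) :
    t * coeff j u * integ (NormedSpace.exp (-(t • embed u))) =
      -2 * (threshold j)⁻¹ * lam * integ (NormedSpace.exp (-(t • embed u)) * cosB j) := by
  have h1 := congrArg (coeff j) h
  have h2 := (partition_pos (t • u)).ne'
  rw [map_smul, map_smul, coeff_Γ hj, smul_eq_mul, smul_eq_mul, fourierCos_eq_threshold hj] at h1
  rw [h1]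
  rw [partition, map_smul] at h2 ⊢
  field_simp

/-- The limit `κ` of `μ(t) / t²` along the branch that bifurcates at `threshold m`. -/
def curvature (m : ℕ) : ℝ :=
  threshold m / 8 * (1 - threshold m / (threshold (2 * m) - threshold m))

lemma four_mul_threshold_lt (m : ℕ) : 4 * threshold m < threshold (2 * m) := by
  have := Real.pi_pos
  unfold threshold
  push_cast
  linarith

lemma curvature_pos {m : ℕ} (hm : m ≠ 0) : 0 < curvature m := by
  have h1 := four_mul_threshold_lt m
  have h2 := threshold_pos hm
  have h3 : threshold m / (threshold (2 * m) - threshold m) < 1 := by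
    rw [div_lt_one (by linarith)]
    linarith
  unfold curvature
  have : 0 < 1 - threshold m / (threshold (2 * m) - threshold m) := by linarith
  positivity

/-- The branch leaves the trivial solution with `μ(t) ~ κ t²`: the equation is projected onto the
modes `m` and `2m`, the second of which determines the first order part of `z`. -/
lemma tendsto_branch_parameter {m : ℕ} {μ : ℝ → ℝ} {z : ℝ → H} (hm : m ≠ 0)
    (hz : DifferentiableAt ℝ z 0) (hz0 : z 0 = 0)
    (hμ : ContinuousAt μ 0) (hμ0 : μ 0 = 0) (horth : ∀ t, inner ℝ (cosMode m) (z t) = 0)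
    (hsol : ∀ᶠ t in 𝓝[≠] (0 : ℝ), t • (cosMode m + z t) =
      (threshold m + μ t) • Γ (t • (cosMode m + z t))) :
    Tendsto (fun t => μ t / t ^ 2) (𝓝[≠] 0) (𝓝 (curvature m)) := by
  have h2m : 2 * m ≠ 0 := by omega
  set ζ : ℝ → ℝ →ᵇ ℝ := fun t => embed (z t) with hζdef
  set U : ℝ → ℝ →ᵇ ℝ := fun t => cosB m + ζ t with hUdef
  have hU : ∀ t, embed (cosMode m + z t) = U t := fun t => by
    rw [map_add, embed_cosMode hm]
  have hζd : DifferentiableAt ℝ ζ 0 := embed.differentiableAt.comp 0 hz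
  have hζ0 : ζ 0 = 0 := by simp only [hζdef, hz0, map_zero]
  have hζ : Tendsto ζ (𝓝[≠] 0) (𝓝 0) := by
    have := hζd.continuousAt.tendsto
    rw [hζ0] at this
    exact this.mono_left nhdsWithin_le_nhds
  have hζt : Tendsto (fun t => t⁻¹ • ζ t) (𝓝[≠] 0) (𝓝 (deriv ζ 0)) := by
    have := hasDerivAt_iff_tendsto_slope.1 hζd.hasDerivAt
    refine this.congr fun t => ?_
    rw [slope_def_module, hζ0, sub_zero, sub_zero]
  have hUt : Tendsto U (𝓝[≠] 0) (𝓝 (cosB m)) := by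
    have := hζ.const_add (cosB m)
    rwa [add_zero] at this
  have ht0 : Tendsto (fun t : ℝ => t) (𝓝[≠] 0) (𝓝 0) := tendsto_id.mono_left nhdsWithin_le_nhds
  have hlam : Tendsto (fun t => threshold m + μ t) (𝓝[≠] 0) (𝓝 (threshold m)) := by
    have := hμ.tendsto
    rw [hμ0] at this
    have := (this.mono_left (nhdsWithin_le_nhds (s := {0}ᶜ))).const_add (threshold m)
    rwa [add_zero] at this
  have hI : ∀ {F : ℝ → ℝ →ᵇ ℝ} {F0 : ℝ →ᵇ ℝ}, Tendsto F (𝓝[≠] 0) (𝓝 F0) →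
      Tendsto (fun t => integ (F t)) (𝓝[≠] 0) (𝓝 (integ F0)) := fun h =>
    (integ.continuous.tendsto _).comp h
  obtain ⟨R, hR, hexp⟩ := exists_exp_expansion hUt
  -- expansions of the normalisation and of the Fourier coefficients of `e^{-V}`
  have hUint : ∀ t, integ (U t) = 0 := fun t => by rw [← hU, integ_embed]
  have hZ : ∀ t, t ≠ 0 → integ (NormedSpace.exp (-(t • U t))) = 2 * π +
      t ^ 2 / 2 * integ (U t * U t) - t ^ 3 / 6 * integ (U t * U t * U t) +
      t ^ 3 * integ (R t) := fun t ht => by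
    rw [hexp t ht]
    simp only [map_add, map_sub, map_smul, smul_eq_mul, integ_one, hUint]
    ring
  have hC : ∀ j, j ≠ 0 → ∀ t, t ≠ 0 → integ (NormedSpace.exp (-(t • U t)) * cosB j) =
      -(t * (π * coeff j (cosMode m + z t))) + t ^ 2 / 2 * integ (U t * U t * cosB j) -
      t ^ 3 / 6 * integ (U t * U t * U t * cosB j) + t ^ 3 * integ (R t * cosB j) :=
    fun j hj t ht => by
    have e : integ (U t * cosB j) = π * coeff j (cosMode m + z t) := by
      rw [coeff_eq_integ, hU, mul_inv_cancel_left₀ Real.pi_ne_zero]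
    rw [hexp t ht]
    simp only [add_mul, sub_mul, smul_mul_assoc, map_add, map_sub, map_smul, smul_eq_mul, one_mul,
      integ_cosB hj, e]
    ring
  have hZlim : Tendsto (fun t => integ (NormedSpace.exp (-(t • U t)))) (𝓝[≠] 0)
      (𝓝 (2 * π)) := by
    have h1 : Tendsto (fun t => NormedSpace.exp (-(t • U t))) (𝓝[≠] 0) (𝓝 1) := by
      have h2 := (ht0.smul hUt).neg
      rw [zero_smul, neg_zero] at h2
      have h3 := (contDiff_exp_bcf (n := 0)).continuous.tendsto 0
      rw [NormedSpace.exp_zero] at h3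
      exact h3.comp h2
    rw [← integ_one]
    exact hI h1
  set T := threshold m with hT
  set T2 := threshold (2 * m) with hT2
  have hTpos : 0 < T := threshold_pos hm
  have hT2pos : 0 < T2 := threshold_pos h2m
  have hTT : 4 * T < T2 := four_mul_threshold_lt m
  have hπ := Real.pi_pos
  -- the mode `2m`
  set b : ℝ → ℝ := fun t => coeff (2 * m) (z t) with hb
  have hb2 : ∀ t, coeff (2 * m) (cosMode m + z t) = b t := fun t => by
    rw [map_add, coeff_cosMode hm, if_neg (by omega), zero_add]
  set D : ℝ → ℝ := fun t => integ (NormedSpace.exp (-(t • U t))) -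
    2 * T2⁻¹ * (T + μ t) * π with hD
  have hDlim : Tendsto D (𝓝[≠] 0) (𝓝 (2 * π - 2 * T2⁻¹ * T * π)) :=
    hZlim.sub ((hlam.const_mul _).mul_const _)
  have hDne : 2 * π - 2 * T2⁻¹ * T * π ≠ 0 := by
    have : T2⁻¹ * T < 1 := by
      rw [inv_mul_eq_div, div_lt_one hT2pos]
      linarith
    have : 0 < 2 * π * (1 - T2⁻¹ * T) := by
      have : 0 < 1 - T2⁻¹ * T := by linarith
      positivity
    intro h
    linarith
  have hblim : Tendsto (fun t => b t / t) (𝓝[≠] 0)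
      (𝓝 (-2 * T2⁻¹ * T * (2⁻¹ * (π / 2)) / (2 * π - 2 * T2⁻¹ * T * π))) := by
    have h1 : Tendsto (fun t => -2 * T2⁻¹ * (T + μ t) *
        (2⁻¹ * integ (U t * U t * cosB (2 * m)) -
          t * (6⁻¹ * integ (U t * U t * U t * cosB (2 * m))) +
          t * integ (R t * cosB (2 * m))) / D t) (𝓝[≠] 0)
        (𝓝 (-2 * T2⁻¹ * T * (2⁻¹ * integ (cosB m * cosB m * cosB (2 * m)) -
          0 * (6⁻¹ * integ (cosB m * cosB m * cosB m * cosB (2 * m))) +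
          0 * integ (0 * cosB (2 * m))) / (2 * π - 2 * T2⁻¹ * T * π))) :=
      (((hlam.const_mul _).mul ((((hI ((hUt.mul hUt).mul_const _)).const_mul _).sub
        (ht0.mul ((hI (((hUt.mul hUt).mul hUt).mul_const _)).const_mul _))).add
        (ht0.mul (hI (hR.mul_const _))))).div hDlim hDne)
    rw [integ_cosB_sq_mul_double hm, zero_mul, zero_mul, sub_zero, add_zero] at h1
    refine h1.congr' ?_
    filter_upwards [hsol, self_mem_nhdsWithin, hDlim.eventually_ne hDne] with t hs ht hDt
    have ht' : t ≠ 0 := ht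
    have h3 := coeff_of_solution h2m hs
    rw [hU, hb2, hC _ h2m t ht', hb2] at h3
    have h4 : t * (b t * D t) = t * (t * (-2 * T2⁻¹ * (T + μ t) *
        (2⁻¹ * integ (U t * U t * cosB (2 * m)) -
          t * (6⁻¹ * integ (U t * U t * U t * cosB (2 * m))) +
          t * integ (R t * cosB (2 * m))))) := by
      simp only [hD]
      linear_combination h3
    have h5 := mul_left_cancel₀ ht' h4
    rw [div_eq_div_iff hDt ht']
    linear_combination -h5
  -- the quadratic part of the mode `m`
  have hB2 : ∀ t, integ (U t * U t * cosB m) = π * b t + integ (ζ t * ζ t * cosB m) := by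
    intro t
    have e1 : U t * U t * cosB m = cosB m * cosB m * cosB m + (2 : ℝ) • (cosB m * cosB m * ζ t) +
        ζ t * ζ t * cosB m := by
      simp only [hUdef, two_smul]
      ring
    have e2 : integ (cosB (2 * m) * ζ t) = π * b t := by
      rw [hb, mul_comm]
      simp only
      rw [coeff_eq_integ, mul_inv_cancel_left₀ Real.pi_ne_zero]
    rw [e1, map_add, map_add, map_smul, integ_cosB_pow_three hm, integ_cosB_sq_mul, e2, integ_embed,
      smul_eq_mul]
    ring
  have hB2lim : Tendsto (fun t => integ (U t * U t * cosB m) / t) (𝓝[≠] 0) (𝓝 (π *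
      (-2 * T2⁻¹ * T * (2⁻¹ * (π / 2)) / (2 * π - 2 * T2⁻¹ * T * π)))) := by
    have h1 := (hblim.const_mul π).add (hI ((hζt.mul hζ).mul_const (cosB m)))
    rw [mul_zero, zero_mul, map_zero, add_zero] at h1
    refine h1.congr fun t => ?_
    rw [hB2, smul_mul_assoc, smul_mul_assoc, map_smul, smul_eq_mul]
    ring
  -- the mode `m`
  set J : ℝ → ℝ := fun t => -π + t * (2⁻¹ * integ (U t * U t * cosB m)) -
    t * (t * (6⁻¹ * integ (U t * U t * U t * cosB m))) + t * (t * integ (R t * cosB m)) with hJ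
  have hJlim : Tendsto J (𝓝[≠] 0) (𝓝 (-π)) := by
    have h1 := ((((ht0.mul ((hI ((hUt.mul hUt).mul_const (cosB m))).const_mul 2⁻¹)).const_add
      (-π)).sub (ht0.mul (ht0.mul ((hI (((hUt.mul hUt).mul hUt).mul_const (cosB m))).const_mul
      6⁻¹)))).add (ht0.mul (ht0.mul (hI (hR.mul_const (cosB m))))))
    simpa only [zero_mul, add_zero, sub_zero] using h1
  set Q : ℝ → ℝ := fun t => 2⁻¹ * integ (U t * U t) - t * (6⁻¹ * integ (U t * U t * U t)) +
    t * integ (R t) + integ (U t * U t * cosB m) / t -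
    3⁻¹ * integ (U t * U t * U t * cosB m) + 2 * integ (R t * cosB m) with hQ
  have hQlim : Tendsto Q (𝓝[≠] 0) (𝓝 (2⁻¹ * π + π * (-2 * T2⁻¹ * T * (2⁻¹ * (π / 2)) /
      (2 * π - 2 * T2⁻¹ * T * π)) - 3⁻¹ * (3 * π / 4))) := by
    have h1 := ((((((hI (hUt.mul hUt)).const_mul 2⁻¹).sub (ht0.mul
      ((hI ((hUt.mul hUt).mul hUt)).const_mul 6⁻¹))).add (ht0.mul (hI hR))).add hB2lim).sub
      ((hI (((hUt.mul hUt).mul hUt).mul_const (cosB m))).const_mul 3⁻¹)).add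
      ((hI (hR.mul_const (cosB m))).const_mul 2)
    rw [integ_cosB_pow_four hm, integ_cosB_mul_cosB hm, if_pos rfl] at h1
    simpa only [zero_mul, mul_zero, map_zero, add_zero, sub_zero] using h1
  have hfin := ((hQlim.div hJlim (neg_ne_zero.2 hπ.ne')).const_mul (-(T / 2)))
  have hval : -(T / 2) * ((2⁻¹ * π + π * (-2 * T2⁻¹ * T * (2⁻¹ * (π / 2)) /
      (2 * π - 2 * T2⁻¹ * T * π)) - 3⁻¹ * (3 * π / 4)) / -π) = curvature m := by
    have h1 : T2 - T ≠ 0 := by linarith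
    have h2 : 2 * π - 2 * T2⁻¹ * T * π = 2 * π * ((T2 - T) / T2) := by
      field_simp
    rw [h2, curvature, ← hT, ← hT2]
    field_simp
    ring
  rw [hval] at hfin
  refine hfin.congr' ?_
  filter_upwards [hsol, self_mem_nhdsWithin, hJlim.eventually_ne (neg_ne_zero.2 hπ.ne')]
    with t hs ht hJt
  have ht' : t ≠ 0 := ht
  have h3 := coeff_of_solution hm hs
  have h1m : coeff m (cosMode m + z t) = 1 := by
    rw [map_add, coeff_cosMode hm, if_pos rfl, ← coord_cosMode hm, coord_eq_zero (horth t),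
      add_zero]
  rw [hU, hC _ hm t ht', h1m, hZ t ht', ← hT] at h3
  have h4 : 2 * π + t ^ 2 / 2 * integ (U t * U t) - t ^ 3 / 6 * integ (U t * U t * U t) +
      t ^ 3 * integ (R t) + 2 * J t = t ^ 2 * Q t := by
    simp only [hQ, hJ]
    field_simp
    ring
  have h5 : t * (T * (2 * π + t ^ 2 / 2 * integ (U t * U t) -
      t ^ 3 / 6 * integ (U t * U t * U t) + t ^ 3 * integ (R t))) =
      t * (-2 * (T + μ t) * J t) := by
    have e : T * T⁻¹ = 1 := mul_inv_cancel₀ hTpos.ne'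
    simp only [hJ]
    linear_combination T * h3 + (-2 * (T + μ t) * (-(t * (π * 1)) +
      t ^ 2 / 2 * integ (U t * U t * cosB m) - t ^ 3 / 6 * integ (U t * U t * U t * cosB m) +
      t ^ 3 * integ (R t * cosB m))) * e
  have h6 := mul_left_cancel₀ ht' h5
  have h7 : T * (t ^ 2 * Q t) = -2 * μ t * J t := by
    rw [← h4]
    linear_combination h6
  rw [Pi.div_apply, mul_div_assoc', div_eq_div_iff hJt (pow_ne_zero 2 ht')]
  linear_combination -(1 / 2) * h7

/-- The branch at `threshold m`: it exhausts the small nontrivial solutions, and the parameter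
moves away from `threshold m` to the right on both sides. -/
theorem exists_supercritical_branch {m : ℕ} (hm : m ≠ 0) :
    ∃ δ > 0, ∃ (μ : ℝ → ℝ) (z : ℝ → H),
    (∀ t ∈ Ioo (-δ) δ, ContDiffAt ℝ 2 μ t ∧ ContDiffAt ℝ 2 z t) ∧ μ 0 = 0 ∧ z 0 = 0 ∧
    (∀ t, inner ℝ (cosMode m) (z t) = 0) ∧
    (∀ t ∈ Ioo (-δ) δ, t • (cosMode m + z t) =
      (threshold m + μ t) • Γ (t • (cosMode m + z t))) ∧
    (∀ t ∈ Ioo (-δ) δ, t ≠ 0 → 0 < t * deriv μ t) ∧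
    ∀ δ' > 0, ∃ U ∈ 𝓝 ((threshold m, 0) : ℝ × H), ∀ p ∈ U, p.2 = p.1 • Γ p.2 → p.2 ≠ 0 →
      ∃ t ∈ Ioo (-δ') δ', t ≠ 0 ∧ p = (threshold m + μ t, t • (cosMode m + z t)) := by
  obtain ⟨δ, hδ, μ, z, hsm, hμ0, hz0, horth, hN, hall⟩ := (simpleEigen hm).exists_branch
  have hsol : ∀ t ∈ Ioo (-δ) δ, t • (cosMode m + z t) =
      (threshold m + μ t) • Γ (t • (cosMode m + z t)) := fun t ht => by
    rw [Γ_smul, smul_comm, ← hN t ht]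
  have h0 : (0 : ℝ) ∈ Ioo (-δ) δ := ⟨neg_neg_of_pos hδ, hδ⟩
  have hlim := tendsto_branch_parameter hm ((hsm 0 h0).2.differentiableAt (by simp)) hz0
    (hsm 0 h0).1.continuousAt hμ0 horth
    (eventually_nhdsWithin_of_eventually_nhds (mem_of_superset (Ioo_mem_nhds h0.1 h0.2) hsol))
  have hev := eventually_mul_deriv_pos (hsm 0 h0).1 hμ0 (curvature_pos hm) hlim
  obtain ⟨ε, hε, hball⟩ := Metric.eventually_nhds_iff.1 (eventually_nhdsWithin_iff.1 hev)
  have hsub : Ioo (-min δ ε) (min δ ε) ⊆ Ioo (-δ) δ :=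
    Ioo_subset_Ioo (neg_le_neg (min_le_left _ _)) (min_le_left _ _)
  refine ⟨min δ ε, lt_min hδ hε, μ, z, fun t ht => hsm t (hsub ht), hμ0, hz0, horth,
    fun t ht => hsol t (hsub ht), fun t ht hne => hball ?_ hne, hall⟩
  rw [Real.dist_eq, sub_zero]
  exact (abs_lt.2 ht).trans_le (min_le_right _ _)

lemma strictMono_of_mul_deriv_pos {μ : ℝ → ℝ} {δ : ℝ} (hc : ContinuousOn μ (Ioo (-δ) δ))
    (hδ : 0 < δ) (hd : ∀ t ∈ Ioo (-δ) δ, t ≠ 0 → 0 < t * deriv μ t) :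
    StrictMonoOn μ (Ico 0 δ) ∧ StrictAntiOn μ (Ioc (-δ) 0) := by
  constructor
  · refine strictMonoOn_of_deriv_pos (convex_Ico 0 δ)
      (hc.mono fun t ht => ⟨by linarith [ht.1], ht.2⟩) fun t ht => ?_
    rw [interior_Ico] at ht
    exact (pos_iff_pos_of_mul_pos (hd t ⟨by linarith [ht.1], ht.2⟩ ht.1.ne')).1 ht.1
  · refine strictAntiOn_of_deriv_neg (convex_Ioc (-δ) 0)
      (hc.mono fun t ht => ⟨ht.1, by linarith [ht.2]⟩) fun t ht => ?_
    rw [interior_Ioc] at ht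
    exact (neg_iff_neg_of_mul_pos (hd t ⟨ht.1, by linarith [ht.2]⟩ ht.2.ne)).1 ht.2

/-! ### Spectrum and quadratic forms -/

section spectrum

variable {X : Type*} [NormedAddCommGroup X] [InnerProductSpace ℝ X]

/-- Cauchy–Schwarz for a nonnegative symmetric form. -/
lemma norm_sq_le_of_symmetric_nonneg {P : X →L[ℝ] X} {K : ℝ} (hK : 0 < K) (hPK : ‖P‖ ≤ K)
    (hsymm : ∀ x y, inner ℝ (P x) y = inner ℝ (P y) x) (hnn : ∀ x, 0 ≤ inner ℝ (P x) x) (x : X) :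
    ‖P x‖ ^ 2 ≤ K * inner ℝ (P x) x := by
  have h1 := hnn (x - K⁻¹ • P x)
  have h2 : inner ℝ (P (P x)) (P x) ≤ K * ‖P x‖ ^ 2 := by
    refine (real_inner_le_norm _ _).trans ?_
    rw [pow_two, ← mul_assoc]
    refine mul_le_mul_of_nonneg_right ?_ (norm_nonneg _)
    exact (P.le_opNorm _).trans (mul_le_mul_of_nonneg_right hPK (norm_nonneg _))
  have h3 := hsymm (P x) x
  rw [real_inner_self_eq_norm_sq] at h3
  rw [map_sub, map_smul, inner_sub_left, inner_sub_right, inner_sub_right, real_inner_smul_left,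
    real_inner_smul_left, real_inner_smul_right, real_inner_smul_right, h3,
    real_inner_self_eq_norm_sq] at h1
  have h4 : K⁻¹ * (K⁻¹ * inner ℝ (P (P x)) (P x)) ≤ K⁻¹ * ‖P x‖ ^ 2 := by
    refine mul_le_mul_of_nonneg_left ?_ (by positivity)
    rw [inv_mul_le_iff₀ hK]
    exact h2
  have h5 : K⁻¹ * ‖P x‖ ^ 2 ≤ inner ℝ (P x) x := by linarith
  rwa [inv_mul_le_iff₀ hK] at h5

/-- If `S` is a positive definite symmetric operator, `S A` is symmetric and its form takes a
negative value, then `A` has a negative point in its spectrum: the infimum of the `s ≥ 0` for which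
`S (A + s)` is nonnegative is attained at such a point with the opposite sign. -/
lemma exists_not_isUnit_add {S A : X →L[ℝ] X} {c : ℝ} (hc : 0 < c)
    (hS : ∀ x, c * ‖x‖ ^ 2 ≤ inner ℝ (S x) x)
    (hSs : ∀ x y, inner ℝ (S x) y = inner ℝ (S y) x)
    (hA : ∀ x y, inner ℝ (S (A x)) y = inner ℝ (S (A y)) x) {x₀ : X}
    (hneg : inner ℝ (S (A x₀)) x₀ < 0) : ∃ α : ℝ, 0 < α ∧ ¬ IsUnit (A + α • (1 : X →L[ℝ] X)) := by
  set I : Set ℝ := {s | 0 ≤ s ∧ ∀ x, 0 ≤ inner ℝ (S (A x)) x + s * inner ℝ (S x) x} with hI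
  have hne : I.Nonempty := by
    refine ⟨‖S * A‖ / c, by positivity, fun x => ?_⟩
    have h1 : |inner ℝ (S (A x)) x| ≤ ‖S * A‖ * ‖x‖ ^ 2 := by
      refine (abs_real_inner_le_norm _ _).trans ?_
      rw [pow_two, ← mul_assoc]
      exact mul_le_mul_of_nonneg_right ((S * A).le_opNorm x) (norm_nonneg _)
    have h2 : ‖S * A‖ / c * (c * ‖x‖ ^ 2) ≤ ‖S * A‖ / c * inner ℝ (S x) x :=
      mul_le_mul_of_nonneg_left (hS x) (by positivity)
    have h3 : ‖S * A‖ / c * (c * ‖x‖ ^ 2) = ‖S * A‖ * ‖x‖ ^ 2 := by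
      field_simp
    have := neg_le_of_abs_le h1
    linarith
  have hbdd : BddBelow I := ⟨0, fun s hs => hs.1⟩
  set α := sInf I with hα
  have hα0 : 0 ≤ α := le_csInf hne fun s hs => hs.1
  have hSpos : ∀ x, 0 ≤ inner ℝ (S x) x := fun x => le_trans (by positivity) (hS x)
  have hαI : ∀ x, 0 ≤ inner ℝ (S (A x)) x + α * inner ℝ (S x) x := by
    intro x
    obtain ⟨u, -, hu, hus⟩ := exists_seq_tendsto_sInf hne hbdd
    exact ge_of_tendsto' ((hu.mul_const _).const_add _) fun n => (hus n).2 x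
  have hαpos : 0 < α := by
    refine lt_of_le_of_ne hα0 fun h => ?_
    have := hαI x₀
    rw [← h] at this
    linarith
  refine ⟨α, hαpos, fun hu => ?_⟩
  set M := A + α • (1 : X →L[ℝ] X) with hM
  have hMx : ∀ x, M x = A x + α • x := fun x => by
    simp [hM]
  have hform : ∀ x y, inner ℝ ((S * M) x) y = inner ℝ (S (A x)) y + α * inner ℝ (S x) y := by
    intro x y
    rw [mul_apply_eq_comp, hMx, map_add, map_smul, inner_add_left, real_inner_smul_left]
  -- an invertible nonnegative symmetric form is bounded below
  set K := ‖S * M‖ + 1 with hK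
  have hKpos : 0 < K := by positivity
  have hCS := norm_sq_le_of_symmetric_nonneg hKpos (P := S * M) (by linarith)
    (fun x y => by rw [hform, hform, hA x y, hSs x y]) (fun x => by rw [hform]; exact hαI x)
  obtain ⟨u, hu⟩ := hu
  set L := ‖((u⁻¹ : (X →L[ℝ] X)ˣ) : X →L[ℝ] X)‖ + 1 with hL
  have hLpos : 0 < L := by positivity
  have hlow : ∀ x, ‖x‖ ≤ L * ‖M x‖ := by
    intro x
    have h1 : ((u⁻¹ : (X →L[ℝ] X)ˣ) : X →L[ℝ] X) (M x) = x := by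
      rw [← hu, ← mul_apply_eq_comp, Units.inv_mul]
      rfl
    calc ‖x‖ = ‖((u⁻¹ : (X →L[ℝ] X)ˣ) : X →L[ℝ] X) (M x)‖ := by rw [h1]
      _ ≤ ‖((u⁻¹ : (X →L[ℝ] X)ˣ) : X →L[ℝ] X)‖ * ‖M x‖ := ContinuousLinearMap.le_opNorm _ _
      _ ≤ L * ‖M x‖ := mul_le_mul_of_nonneg_right (by linarith) (norm_nonneg _)
  have hSlow : ∀ x, c * ‖x‖ ≤ ‖S x‖ := by
    intro x
    rcases (norm_nonneg x).eq_or_lt with h0 | h0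
    · rw [← h0, mul_zero]
      exact norm_nonneg _
    · refine le_of_mul_le_mul_right ?_ h0
      calc c * ‖x‖ * ‖x‖ = c * ‖x‖ ^ 2 := by ring
        _ ≤ inner ℝ (S x) x := hS x
        _ ≤ ‖S x‖ * ‖x‖ := real_inner_le_norm _ _
  set d := c ^ 2 / (L ^ 2 * K) with hd
  have hdpos : 0 < d := by positivity
  have hcoer : ∀ x, d * ‖x‖ ^ 2 ≤ inner ℝ (S (A x)) x + α * inner ℝ (S x) x := by
    intro x
    have h1 := hCS x
    rw [hform] at h1
    have h2 : c * ‖x‖ ≤ L * ‖(S * M) x‖ := by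
      calc c * ‖x‖ ≤ c * (L * ‖M x‖) := mul_le_mul_of_nonneg_left (hlow x) hc.le
        _ = L * (c * ‖M x‖) := by ring
        _ ≤ L * ‖(S * M) x‖ := mul_le_mul_of_nonneg_left (hSlow _) hLpos.le
    have h3 : (c * ‖x‖) ^ 2 ≤ (L * ‖(S * M) x‖) ^ 2 := pow_le_pow_left₀ (by positivity) h2 2
    have h4 : L ^ 2 * ‖(S * M) x‖ ^ 2 ≤ L ^ 2 * (K * (inner ℝ (S (A x)) x +
        α * inner ℝ (S x) x)) := mul_le_mul_of_nonneg_left h1 (by positivity)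
    rw [hd, div_mul_eq_mul_div, div_le_iff₀ (by positivity)]
    nlinarith
  set ε := min α (d / (‖S‖ + 1)) with hε
  have hεpos : 0 < ε := lt_min hαpos (by positivity)
  have hmem : α - ε ∈ I := by
    refine ⟨sub_nonneg.2 (min_le_left _ _), fun x => ?_⟩
    have h1 : inner ℝ (S x) x ≤ (‖S‖ + 1) * ‖x‖ ^ 2 := by
      refine (real_inner_le_norm _ _).trans ?_
      rw [pow_two, ← mul_assoc]
      refine mul_le_mul_of_nonneg_right ((S.le_opNorm x).trans ?_) (norm_nonneg _)
      exact mul_le_mul_of_nonneg_right (by linarith) (norm_nonneg _)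
    have h2 : ε * inner ℝ (S x) x ≤ d * ‖x‖ ^ 2 := by
      calc ε * inner ℝ (S x) x ≤ d / (‖S‖ + 1) * ((‖S‖ + 1) * ‖x‖ ^ 2) :=
            mul_le_mul (min_le_right _ _) h1 (hSpos x) (by positivity)
        _ = d * ‖x‖ ^ 2 := by
            field_simp
    have := hcoer x
    linarith
  have := csInf_le hbdd hmem
  linarith

lemma complexShift_apply (A : X →L[ℝ] X) (w : ℂ) (p : X × X) : complexShift A w p =
    (A p.1 - w.re • p.1 + w.im • p.2, A p.2 - w.re • p.2 - w.im • p.1) := rfl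

/-- Coercivity of a symmetric form, from estimates on a line `ℝ v` and on a complement `ker κ` that
is almost orthogonal to it. -/
lemma exists_coercive_of_splitting {P : X →L[ℝ] X}
    (hP : ∀ x y, inner ℝ (P x) y = inner ℝ (P y) x) {κ : X →L[ℝ] ℝ} {v : X} (hκ : κ v = 1)
    {a c ν η : ℝ} (ha : 0 < a) (hc : 0 < c) (hν : 0 < ν) (hv : a * ν ≤ inner ℝ (P v) v)
    (hvw : ∀ w, κ w = 0 → |inner ℝ (P v) w| ≤ ν * η * ‖w‖)
    (hw : ∀ w, κ w = 0 → c * ‖w‖ ^ 2 ≤ inner ℝ (P w) w) (hη : 4 * ν * η ^ 2 ≤ a * c) :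
    ∃ c' > 0, ∀ x, c' * ‖x‖ ^ 2 ≤ inner ℝ (P x) x := by
  refine ⟨min (a * ν) c / 2 / (2 * (‖v‖ ^ 2 + 1)), by positivity, fun x => ?_⟩
  set s := κ x with hs
  set w := x - s • v with hwdef
  have hκw : κ w = 0 := by
    rw [hwdef, map_sub, map_smul, hκ, smul_eq_mul, mul_one, sub_self]
  have hx : x = s • v + w := by
    rw [hwdef, add_sub_cancel]
  have hexp : inner ℝ (P x) x =
      s ^ 2 * inner ℝ (P v) v + 2 * s * inner ℝ (P v) w + inner ℝ (P w) w := by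
    rw [hx, map_add, map_smul, inner_add_left, inner_add_right, inner_add_right,
      real_inner_smul_left, real_inner_smul_left, real_inner_smul_right, real_inner_smul_right,
      hP w v]
    ring
  have h1 := abs_le.1 (hvw w hκw)
  have h2 := hw w hκw
  have h3 : s ^ 2 * (a * ν) ≤ s ^ 2 * inner ℝ (P v) v :=
    mul_le_mul_of_nonneg_left hv (sq_nonneg s)
  have h4 : -(2 * |s| * (ν * η * ‖w‖)) ≤ 2 * s * inner ℝ (P v) w := by
    have := mul_le_mul_of_nonneg_left (hvw w hκw) (abs_nonneg s)
    rw [← abs_mul] at this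
    linarith [neg_le_of_abs_le this]
  -- the cross term is absorbed by the arithmetic-geometric mean inequality
  have h5 : 2 * |s| * (ν * η * ‖w‖) ≤ a * ν / 2 * s ^ 2 + c / 2 * ‖w‖ ^ 2 := by
    have e1 : 0 ≤ ν * (a * |s| - 2 * η * ‖w‖) ^ 2 := by positivity
    have e2 : 4 * ν * η ^ 2 * ‖w‖ ^ 2 ≤ a * c * ‖w‖ ^ 2 :=
      mul_le_mul_of_nonneg_right hη (sq_nonneg _)
    have e3 : |s| ^ 2 = s ^ 2 := sq_abs s
    refine le_of_mul_le_mul_left ?_ ha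
    have e4 : ν * (a * |s| - 2 * η * ‖w‖) ^ 2 = a ^ 2 * ν * s ^ 2 -
        4 * a * |s| * (ν * η * ‖w‖) + 4 * ν * η ^ 2 * ‖w‖ ^ 2 := by
      rw [← e3]
      ring
    linarith
  have h6 : min (a * ν) c / 2 * (s ^ 2 + ‖w‖ ^ 2) ≤ a * ν / 2 * s ^ 2 + c / 2 * ‖w‖ ^ 2 := by
    rw [mul_add]
    exact add_le_add (mul_le_mul_of_nonneg_right (by linarith [min_le_left (a * ν) c])
      (sq_nonneg _)) (mul_le_mul_of_nonneg_right (by linarith [min_le_right (a * ν) c])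
      (sq_nonneg _))
  have h7 : ‖x‖ ^ 2 ≤ 2 * (‖v‖ ^ 2 + 1) * (s ^ 2 + ‖w‖ ^ 2) := by
    have e1 : ‖x‖ ≤ |s| * ‖v‖ + ‖w‖ := by
      conv_lhs => rw [hx]
      refine (norm_add_le _ _).trans ?_
      rw [norm_smul, Real.norm_eq_abs]
    have e2 : ‖x‖ ^ 2 ≤ (|s| * ‖v‖ + ‖w‖) ^ 2 := pow_le_pow_left₀ (norm_nonneg _) e1 2
    have e3 : (|s| * ‖v‖ + ‖w‖) ^ 2 ≤ 2 * ((|s| * ‖v‖) ^ 2 + ‖w‖ ^ 2) := add_sq_le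
    rw [mul_pow, sq_abs] at e3
    have e4 : 0 ≤ ‖v‖ ^ 2 * ‖w‖ ^ 2 := by positivity
    have e5 := sq_nonneg s
    linarith
  rw [div_mul_eq_mul_div, div_le_iff₀ (by positivity)]
  have h8 : min (a * ν) c / 2 * ‖x‖ ^ 2 ≤
      min (a * ν) c / 2 * (2 * (‖v‖ ^ 2 + 1) * (s ^ 2 + ‖w‖ ^ 2)) :=
    mul_le_mul_of_nonneg_left h7 (by positivity)
  have h9 : min (a * ν) c / 2 * (s ^ 2 + ‖w‖ ^ 2) ≤ inner ℝ (P x) x := by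
    rw [hexp]
    linarith
  have h10 := mul_le_mul_of_nonneg_right h9 (by positivity : 0 ≤ 2 * (‖v‖ ^ 2 + 1))
  linarith

lemma tendsto_opNorm_sub {ι : Type*} {l : Filter ι} {A : ι → X →L[ℝ] X} {A₀ : X →L[ℝ] X}
    (h : Tendsto A l (𝓝 A₀)) : Tendsto (fun t => ‖A t - A₀‖) l (𝓝 0) :=
  tendsto_iff_norm_sub_tendsto_zero.1 h

variable [CompleteSpace X]

lemma isUnit_of_complexShift {A : X →L[ℝ] X} {α : ℝ} (h : IsUnit (complexShift A (-α : ℝ))) :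
    IsUnit (A + α • (1 : X →L[ℝ] X)) := by
  rw [ContinuousLinearMap.isUnit_iff_bijective] at h ⊢
  have e : ∀ p : X × X, complexShift A (-α : ℝ) p =
      ((A + α • (1 : X →L[ℝ] X)) p.1, (A + α • (1 : X →L[ℝ] X)) p.2) := fun p => by
    rw [complexShift_apply]
    simp
  refine ⟨fun x y hxy => ?_, fun y => ?_⟩
  · have : (x, (0 : X)) = (y, 0) := h.1 (by rw [e, e]; simp only [hxy])
    exact congrArg Prod.fst this
  · obtain ⟨p, hp⟩ := h.2 (y, 0)
    rw [e] at hp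
    exact ⟨p.1, congrArg Prod.fst hp⟩

/-- If the form of `S A` is coercive, the spectrum of `A` lies in the open right half plane. -/
lemma isUnit_complexShift {S A : X →L[ℝ] X} {c c' : ℝ} (hc : 0 < c) (hc' : 0 < c')
    (hS : ∀ x, c * ‖x‖ ^ 2 ≤ inner ℝ (S x) x)
    (hSs : ∀ x y, inner ℝ (S x) y = inner ℝ (S y) x)
    (hA : ∀ x, c' * ‖x‖ ^ 2 ≤ inner ℝ (S (A x)) x) {w : ℂ} (hw : w.re ≤ 0) :
    IsUnit (complexShift A w) := by
  have hSu : Function.Injective S :=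
    (ContinuousLinearMap.isUnit_iff_bijective.1 (isUnit_of_coercive hc hS)).1
  set e := WithLp.prodContinuousLinearEquiv 2 ℝ X X with he
  set P : WithLp 2 (X × X) →L[ℝ] WithLp 2 (X × X) :=
    (e.symm : X × X →L[ℝ] WithLp 2 (X × X)) ∘L (S.prodMap S) ∘L complexShift A w ∘L
      (e : WithLp 2 (X × X) →L[ℝ] X × X) with hP
  have hPu : IsUnit P := by
    refine isUnit_of_coercive hc' fun p => ?_
    have h1 : inner ℝ (P p) p =
        inner ℝ (S (A p.fst - w.re • p.fst + w.im • p.snd)) p.fst +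
        inner ℝ (S (A p.snd - w.re • p.snd - w.im • p.fst)) p.snd :=
      WithLp.prod_inner_apply _ _
    have h2 := hA p.fst
    have h3 := hA p.snd
    have h4 : 0 ≤ -w.re * inner ℝ (S p.fst) p.fst :=
      mul_nonneg (by linarith) (le_trans (by positivity) (hS _))
    have h5 : 0 ≤ -w.re * inner ℝ (S p.snd) p.snd :=
      mul_nonneg (by linarith) (le_trans (by positivity) (hS _))
    rw [h1, WithLp.prod_norm_sq_eq_of_L2, map_add, map_sub, map_sub, map_sub, map_smul, map_smul,
      map_smul, map_smul, inner_add_left, inner_sub_left, inner_sub_left, inner_sub_left,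
      real_inner_smul_left, real_inner_smul_left, real_inner_smul_left, real_inner_smul_left,
      hSs p.snd p.fst]
    linarith
  rw [ContinuousLinearMap.isUnit_iff_bijective] at hPu ⊢
  have hPe : ∀ q : X × X, P (e.symm q) =
      e.symm (S (complexShift A w q).1, S (complexShift A w q).2) := fun q => rfl
  refine ⟨fun p q hpq => ?_, fun q => ?_⟩
  · exact e.symm.injective (hPu.1 (by rw [hPe, hPe, hpq]))
  · obtain ⟨p, hp⟩ := hPu.2 (e.symm (S q.1, S q.2))
    refine ⟨e p, ?_⟩
    rw [← e.symm_apply_apply p, hPe] at hp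
    have h := e.symm.injective hp
    exact Prod.ext (hSu (congrArg Prod.fst h)) (hSu (congrArg Prod.snd h))

end spectrum

/-! ### Stability along the branches -/

lemma contDiffAt_deriv {F : Type*} [NormedAddCommGroup F] [NormedSpace ℝ F] {f : ℝ → F} {t : ℝ}
    (hf : ContDiffAt ℝ 2 f t) : ContDiffAt ℝ 1 (deriv f) t :=
  (hf.fderiv_right (m := 1) (by norm_num)).clm_apply contDiffAt_const

lemma hasFDerivAt_sub_Γ (lam : ℝ) (V : H) :
    HasFDerivAt (fun W : H => W - lam • Γ W) (1 - lam • Γderiv V) V :=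
  (hasFDerivAt_id V).sub ((hasFDerivAt_Γ V).const_smul lam)

lemma inner_energyOp_symm (V W : H) : inner ℝ (energyOp V) W = inner ℝ (energyOp W) V := by
  rw [inner_energyOp_comm, real_inner_comm]

/-- The linearisation is symmetric in the energy form. -/
lemma inner_energyOp_one_sub_symm (lam : ℝ) (V W W' : H) :
    inner ℝ (energyOp ((1 - lam • Γderiv V) W)) W' =
      inner ℝ (energyOp ((1 - lam • Γderiv V) W')) W := by
  have e : ∀ W W' : H, inner ℝ (energyOp ((1 - lam • Γderiv V) W)) W' =
      inner ℝ (energyOp W) W' - lam * inner ℝ (energyOp (Γderiv V W)) W' := by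
    intro W W'
    have h1 : energyOp ((1 - lam • Γderiv V) W) =
        energyOp W - lam • energyOp (Γderiv V W) := by
      rw [sub_apply, one_apply_eq_self, smul_apply, map_sub, map_smul]
    have h2 := real_inner_smul_left (energyOp (Γderiv V W)) W' lam
    rw [h1, inner_sub_left, h2]
  rw [e, e, inner_energyOp_symm W W', inner_energyOp_Γderiv, inner_energyOp_Γderiv,
    mul_right_comm _ (embed W)]
  ring

lemma isStable_of_coercive {lam : ℝ} {V : H} {c : ℝ} (hc : 0 < c)
    (h : ∀ W, c * ‖W‖ ^ 2 ≤ inner ℝ (energyOp ((1 - lam • Γderiv V) W)) W) : IsStable lam V := by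
  refine ⟨_, hasFDerivAt_sub_Γ lam V, fun w hw => ?_⟩
  by_contra hre
  exact hw (isUnit_complexShift (by norm_num) hc energyOp_coercive inner_energyOp_symm h
    (not_lt.1 hre))

lemma isUnstable_of_neg {lam : ℝ} {V W : H}
    (h : inner ℝ (energyOp ((1 - lam • Γderiv V) W)) W < 0) : IsUnstable lam V := by
  obtain ⟨α, hα, hu⟩ := exists_not_isUnit_add (by norm_num) energyOp_coercive inner_energyOp_symm
    (inner_energyOp_one_sub_symm lam V) h
  refine ⟨_, hasFDerivAt_sub_Γ lam V, ((-α : ℝ) : ℂ), fun h1 => hu (isUnit_of_complexShift h1), ?_⟩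
  rw [Complex.ofReal_re]
  linarith

section branch

variable {m : ℕ} {μ : ℝ → ℝ} {z : ℝ → H}

/-- The linearisation depends continuously on the point of the branch. -/
lemma tendsto_linearisation (hz : ContinuousAt z 0) (hμ : ContinuousAt μ 0) (hμ0 : μ 0 = 0) :
    Tendsto (fun t => 1 - (threshold m + μ t) • Γderiv (t • (cosMode m + z t))) (𝓝 0)
      (𝓝 (1 - threshold m • Γderiv 0)) := by
  have h1 : Tendsto (fun t => t • (cosMode m + z t)) (𝓝 0) (𝓝 0) := by
    have := (tendsto_id (x := 𝓝 (0 : ℝ))).smul (hz.tendsto.const_add (cosMode m))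
    rwa [zero_smul] at this
  have h2 := hμ.tendsto.const_add (threshold m)
  rw [hμ0, add_zero] at h2
  exact (h2.smul ((continuous_Γderiv.tendsto 0).comp h1)).const_sub 1

lemma eventually_isUnstable (hm : 2 ≤ m) (hz : ContinuousAt z 0) (hμ : ContinuousAt μ 0)
    (hμ0 : μ 0 = 0) :
    ∀ᶠ t in 𝓝 0, IsUnstable (threshold m + μ t) (t • (cosMode m + z t)) := by
  have hlim : Tendsto (fun t => inner ℝ (energyOp ((1 - (threshold m + μ t) •
      Γderiv (t • (cosMode m + z t))) (cosMode 1))) (cosMode 1)) (𝓝 0)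
      (𝓝 (inner ℝ (energyOp ((1 - threshold m • Γderiv 0) (cosMode 1))) (cosMode 1))) := by
    have hc : Continuous fun A : H →L[ℝ] H => inner ℝ (energyOp (A (cosMode 1))) (cosMode 1) :=
      (energyOp.continuous.comp (ContinuousLinearMap.apply ℝ H (cosMode 1)).continuous).inner
        continuous_const
    exact (hc.tendsto _).comp (tendsto_linearisation hz hμ hμ0)
  have hneg : inner ℝ (energyOp ((1 - threshold m • Γderiv 0) (cosMode 1))) (cosMode 1) < 0 := by
    have h1 := energyOp_coercive (cosMode 1)
    have h2 := norm_cosMode_pos one_ne_zero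
    have h3 : 0 < inner ℝ (energyOp (cosMode 1)) (cosMode 1) :=
      lt_of_lt_of_le (by positivity) h1
    have h4 : threshold 1 < threshold m := by
      have : (2 : ℝ) ≤ m := by exact_mod_cast hm
      have := Real.pi_pos
      unfold threshold
      have : (1 : ℝ) ^ 2 < (m : ℝ) ^ 2 := pow_lt_pow_left₀ (by linarith) zero_le_one two_ne_zero
      push_cast
      have : (4 * (1 : ℝ) ^ 2 - 1) * π < (4 * (m : ℝ) ^ 2 - 1) * π :=
        mul_lt_mul_of_pos_right (by linarith) (by linarith)
      linarith
    have h5 : 1 - threshold m * (threshold 1)⁻¹ < 0 := by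
      have h6 := threshold_pos one_ne_zero
      rw [sub_neg, ← div_eq_mul_inv, one_lt_div h6]
      exact h4
    have e := real_inner_smul_left (energyOp (cosMode 1)) (cosMode 1)
      (1 - threshold m * (threshold 1)⁻¹)
    rw [(isDiagonal_one_sub (threshold m)).apply_cosMode one_ne_zero, map_smul, e]
    exact mul_neg_of_neg_of_pos h5 h3
  filter_upwards [hlim.eventually_lt_const hneg] with t ht
  exact isUnstable_of_neg ht

lemma threshold_two_le {j : ℕ} (hj : 2 ≤ j) : threshold 2 ≤ threshold j := by
  have h1 : (2 : ℝ) ^ 2 ≤ (j : ℝ) ^ 2 :=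
    pow_le_pow_left₀ zero_le_two (by exact_mod_cast hj) 2
  have := Real.pi_pos
  unfold threshold
  push_cast
  have : (4 * (2 : ℝ) ^ 2 - 1) * π ≤ (4 * (j : ℝ) ^ 2 - 1) * π :=
    mul_le_mul_of_nonneg_right (by linarith) this.le
  linarith

/-- At the first threshold the linearisation is coercive off its kernel. -/
lemma exists_coercive_off_kernel : ∃ c > 0, ∀ w : H, coeff 1 w = 0 →
    c * ‖w‖ ^ 2 ≤ inner ℝ (energyOp ((1 - threshold 1 • Γderiv 0) w)) w := by
  have h1 := threshold_pos one_ne_zero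
  have h2 := four_mul_threshold_lt 1
  rw [mul_one] at h2
  refine ⟨3 / 5 * (3 / 4), by norm_num, fun w hw => ?_⟩
  refine (isDiagonal_energyOp.comp (isDiagonal_one_sub (threshold 1))).le_inner fun j hj hjw => ?_
  have hj2 : 2 ≤ j := by
    rcases Nat.lt_or_ge j 2 with h | h
    · have : j = 1 := by omega
      rw [this] at hjw
      exact absurd hw hjw
    · exact h
  have h3 := threshold_two_le hj2
  have h4 : threshold 1 * (threshold j)⁻¹ ≤ 1 / 4 := by
    rw [← div_eq_mul_inv, div_le_iff₀ (by linarith)]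
    linarith
  exact mul_le_mul (le_energyOp_entry hj) (by linarith) (by norm_num)
    (le_trans (by norm_num) (le_energyOp_entry hj))

/-- Along the first branch the linearisation maps the tangent of the branch to a small multiple of
the solution, whose sign is that of `t μ'(t)`; on the complement it stays coercive. -/
lemma eventually_isStable (hz : ∀ᶠ t in 𝓝 0, ContDiffAt ℝ 2 z t)
    (hμ : ∀ᶠ t in 𝓝 0, ContDiffAt ℝ 2 μ t) (hz0 : z 0 = 0) (hμ0 : μ 0 = 0)
    (horth : ∀ t, inner ℝ (cosMode 1) (z t) = 0)
    (hsol : ∀ᶠ t in 𝓝 0, t • (cosMode 1 + z t) =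
      (threshold 1 + μ t) • Γ (t • (cosMode 1 + z t)))
    (hpos : ∀ᶠ t in 𝓝[≠] 0, 0 < t * deriv μ t) :
    ∀ᶠ t in 𝓝[≠] 0, IsStable (threshold 1 + μ t) (t • (cosMode 1 + z t)) := by
  obtain ⟨c, hc, hcoer⟩ := exists_coercive_off_kernel
  set φ := cosMode 1 with hφ
  set T := threshold 1 with hT
  have hTpos : 0 < T := threshold_pos one_ne_zero
  set v : ℝ → H := fun t => φ + z t + t • deriv z t with hv
  set A : ℝ → H →L[ℝ] H := fun t => 1 - (T + μ t) • Γderiv (t • (φ + z t)) with hA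
  have hzc := hz.self_of_nhds.continuousAt
  have hμc := hμ.self_of_nhds.continuousAt
  have hAlim : Tendsto A (𝓝 0) (𝓝 (1 - T • Γderiv 0)) := tendsto_linearisation hzc hμc hμ0
  have hzlim : Tendsto z (𝓝 0) (𝓝 0) := by
    have := hzc.tendsto
    rwa [hz0] at this
  have hid : Tendsto (fun t : ℝ => t) (𝓝 0) (𝓝 0) := tendsto_id
  have hdz : ContinuousAt (deriv z) 0 :=
    (contDiffAt_deriv hz.self_of_nhds).continuousAt
  have hdμ : ContinuousAt (deriv μ) 0 :=
    (contDiffAt_deriv hμ.self_of_nhds).continuousAt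
  have hvlim : Tendsto v (𝓝 0) (𝓝 φ) := by
    have := (hzlim.const_add φ).add (hid.smul hdz.tendsto)
    rwa [zero_smul, add_zero, add_zero] at this
  have hlam : Tendsto (fun t => T + μ t) (𝓝 0) (𝓝 T) := by
    have := hμc.tendsto.const_add T
    rwa [hμ0, add_zero] at this
  -- `ν` measures the form on the tangent, `η` its coupling to the complement
  set ν : ℝ → ℝ := fun t => t * deriv μ t / (T + μ t) with hν
  have hνlim : Tendsto ν (𝓝 0) (𝓝 0) := by
    have := (hid.mul hdμ.tendsto).div hlam hTpos.ne'
    rwa [zero_mul, zero_div] at this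
  set η : ℝ → ℝ := fun t => ‖energyOp (z t)‖ with hη
  have hηlim : Tendsto η (𝓝 0) (𝓝 0) := by
    have := ((energyOp.continuous.tendsto 0).comp hzlim).norm
    rwa [map_zero, norm_zero] at this
  have hcoeffz : ∀ t, coeff 1 (z t) = 0 := fun t => by
    rw [← coord_cosMode one_ne_zero, coord_eq_zero (horth t)]
  -- the energy of the tangent stays away from zero
  set a := inner ℝ (energyOp φ) φ / 2 with ha
  have hapos : 0 < a := by
    have h1 := energyOp_coercive φ
    have h2 : 0 < ‖φ‖ := norm_cosMode_pos one_ne_zero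
    have : 0 < inner ℝ (energyOp φ) φ := lt_of_lt_of_le (by positivity) h1
    rw [ha]
    linarith
  have e1 : ∀ᶠ t in 𝓝 0, a < inner ℝ (energyOp (φ + z t)) (v t) := by
    have h1 : Tendsto (fun t => inner ℝ (energyOp (φ + z t)) (v t)) (𝓝 0)
        (𝓝 (inner ℝ (energyOp (φ + 0)) φ)) :=
      ((energyOp.continuous.tendsto _).comp (hzlim.const_add φ)).inner hvlim
    rw [add_zero] at h1
    refine h1.eventually_const_lt ?_
    rw [ha] at hapos ⊢
    linarith
  have e2 : ∀ᶠ t in 𝓝 0, 4 * ν t * η t ^ 2 < a * (c / 2) := by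
    have h1 := (hνlim.const_mul 4).mul (hηlim.pow 2)
    rw [mul_zero, zero_mul] at h1
    exact h1.eventually_lt_const (by positivity)
  have e3 : ∀ᶠ t in 𝓝 0, ‖energyOp‖ * ‖A t - (1 - T • Γderiv 0)‖ < c / 2 := by
    have h1 := (tendsto_opNorm_sub hAlim).const_mul ‖energyOp‖
    rw [mul_zero] at h1
    exact h1.eventually_lt_const (by positivity)
  refine eventually_nhdsWithin_iff.2 ?_
  filter_upwards [e1, e2, e3, hz, hμ, hsol.eventually_nhds, hlam.eventually_const_lt hTpos,
    eventually_nhdsWithin_iff.1 hpos] with t h1 h2 h3 hzt hμt hs hl hpt hne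
  have hs0 := hs.self_of_nhds
  have hνpos : 0 < ν t := div_pos (hpt hne) hl
  have hdzt := (hzt.differentiableAt (by simp)).hasDerivAt
  have hdμt := (hμt.differentiableAt (by simp)).hasDerivAt
  have hcv : coeff 1 (v t) = 1 := by
    have h4 : coeff 1 (deriv z t) = 0 := by
      have h5 := (coeff 1).hasFDerivAt.comp_hasDerivAt t hdzt
      have h6 : ⇑(coeff 1) ∘ z = fun _ => 0 := funext hcoeffz
      rw [h6] at h5
      exact h5.unique (hasDerivAt_const t 0)
    rw [hv]
    simp only [map_add, map_smul, h4, hcoeffz, hφ, coeff_cosMode one_ne_zero, if_true, smul_zero,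
      add_zero]
  -- differentiating the equation along the branch
  have hAv : A t (v t) = (deriv μ t / (T + μ t)) • t • (φ + z t) := by
    have h4 : HasDerivAt (fun s => s • (φ + z s)) (v t) t := by
      refine ((hasDerivAt_id t).smul (hdzt.const_add φ)).congr_deriv ?_
      simp only [hv, id_eq, one_smul]
      abel
    have h5 := (hdμt.const_add T).smul ((hasFDerivAt_Γ _).comp_hasDerivAt t h4)
    have h6 := h4.unique (h5.congr_of_eventuallyEq hs)
    have h7 : Γ (t • (φ + z t)) = (T + μ t)⁻¹ • t • (φ + z t) := by
      rw [eq_inv_smul_iff₀ hl.ne']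
      exact hs0.symm
    simp only [Function.comp_apply, h7] at h6
    simp only [hA]
    rw [sub_apply, one_apply_eq_self, smul_apply, div_eq_mul_inv, mul_smul]
    exact sub_eq_of_eq_add' h6
  have hAform : ∀ w, inner ℝ ((energyOp * A t) (v t)) w =
      ν t * inner ℝ (energyOp (φ + z t)) w := by
    intro w
    have e := real_inner_smul_left (energyOp (φ + z t)) w (deriv μ t / (T + μ t) * t)
    rw [mul_apply_eq_comp, hAv, ← mul_smul, map_smul, e, hν]
    ring
  suffices h : ∃ c' > 0, ∀ x, c' * ‖x‖ ^ 2 ≤ inner ℝ ((energyOp * A t) x) x by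
    obtain ⟨c', hc', hfin⟩ := h
    exact isStable_of_coercive hc' hfin
  refine exists_coercive_of_splitting (P := energyOp * A t) (κ := coeff 1)
    (v := v t) (a := a) (c := c / 2) (ν := ν t) (η := η t)
    (fun x y => inner_energyOp_one_sub_symm _ _ x y) hcv hapos (by positivity) hνpos ?_ ?_ ?_ h2.le
  · rw [hAform, mul_comm a]
    exact mul_le_mul_of_nonneg_left h1.le hνpos.le
  · intro w hw
    have h4 : inner ℝ (energyOp φ) w = 0 := by
      have e := real_inner_smul_left φ w ((4 * ((1 : ℕ) : ℝ) ^ 2 - 1) / (4 * ((1 : ℕ) : ℝ) ^ 2 + 1))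
      rw [hφ, isDiagonal_energyOp.apply_cosMode one_ne_zero, ← hφ, e, hφ, inner_cosMode one_ne_zero,
        hw, mul_zero, mul_zero]
    rw [hAform, map_add, inner_add_left, h4, zero_add, abs_mul, abs_of_pos hνpos, mul_assoc]
    exact mul_le_mul_of_nonneg_left (abs_real_inner_le_norm _ _) hνpos.le
  · intro w hw
    have h4 := hcoer w hw
    have h5 : inner ℝ ((energyOp * A t) w) w =
        inner ℝ (energyOp ((1 - T • Γderiv 0) w)) w +
          inner ℝ ((energyOp * (A t - (1 - T • Γderiv 0))) w) w := by
      have e : (A t - (1 - T • Γderiv 0)) w = A t w - (1 - T • Γderiv 0) w := rfl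
      rw [← inner_add_left, mul_apply_eq_comp, mul_apply_eq_comp, ← map_add, e, add_sub_cancel]
    have h6 : |inner ℝ ((energyOp * (A t - (1 - T • Γderiv 0))) w) w| ≤ c / 2 * ‖w‖ ^ 2 := by
      refine (abs_real_inner_le_norm _ _).trans ?_
      rw [pow_two, ← mul_assoc]
      refine mul_le_mul_of_nonneg_right ((ContinuousLinearMap.le_opNorm _ _).trans ?_)
        (norm_nonneg _)
      exact mul_le_mul_of_nonneg_right ((ContinuousLinearMap.opNorm_comp_le _ _).trans h3.le)
        (norm_nonneg _)
    rw [h5]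
    linarith [neg_le_of_abs_le h6]

end branch

/-! ### Equilibrium densities and solutions of the fixed point equation -/

lemma integrable_intervalIntegrable {f : ℝ → ℝ} (hf : Integrable f per) :
    IntervalIntegrable f volume 0 (2 * π) :=
  (intervalIntegrable_iff_integrableOn_Ioc_of_le period_nonneg).2 hf

/-- The mean part of the potential cancels in the Boltzmann factor. -/
lemma exp_neg_potential_div {f : ℝ → ℝ} (hf : Integrable f per) (lam θ : ℝ) :
    Real.exp (-potential kernel lam f θ) /
      ∫ s in (0 : ℝ)..2 * π, Real.exp (-potential kernel lam f s) =
    Real.exp (-(lam * conv f θ)) / ∫ s in (0 : ℝ)..2 * π, Real.exp (-(lam * conv f s)) := by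
  simp only [potential_eq hf lam, neg_add, Real.exp_add, intervalIntegral.integral_mul_const]
  rw [mul_div_mul_right _ _ (Real.exp_pos _).ne']

lemma conv_add_pi (g : ℝ → ℝ) (θ : ℝ) : conv g (θ + π) = conv g θ := by
  unfold conv
  congr 1
  funext s
  rw [← kernelC_add_pi (θ - s)]
  congr 2
  ring

lemma conv_two_pi_sub {g : ℝ → ℝ}
    (heven : ∀ᵐ θ ∂(volume.restrict (Ioo 0 (2 * π))), g (2 * π - θ) = g θ) (θ : ℝ) :
    conv g (2 * π - θ) = conv g θ := by
  unfold conv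
  have h := intervalIntegral.integral_comp_sub_left (a := 0) (b := 2 * π)
    (fun s => kernelC (2 * π - θ - s) * g s) (2 * π)
  simp only [sub_self, sub_zero] at h
  rw [← h, intervalIntegral.integral_of_le period_nonneg,
    intervalIntegral.integral_of_le period_nonneg, integral_Ioc_eq_integral_Ioo,
    integral_Ioc_eq_integral_Ioo]
  refine integral_congr_ae ?_
  filter_upwards [heven] with s hs
  rw [hs, ← kernelC_neg (θ - s)]
  congr 2
  ring

lemma gammaFun_eq_conv {f : ℝ → ℝ} {V : H} (h : IsDensityOf f V) (θ : ℝ) :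
    gammaFun V.fn θ = conv f θ := by
  rw [conv_congr h, gammaFun, conv, conv, ← intervalIntegral.integral_div]
  simp only [mul_div_assoc]

lemma H.fn_smul (c : ℝ) (V : H) : (c • V).fn =ᵐ[per] fun θ => c * V.fn θ :=
  Lp.coeFn_smul c (fstL V)

lemma solves_iff_fn {lam : ℝ} {V : H} :
    Solves lam V ↔ V.fn =ᵐ[per] fun θ => lam * gammaFun V.fn θ := by
  have h1 : (lam • Γ V).fn =ᵐ[per] fun θ => lam * gammaFun V.fn θ := by
    filter_upwards [H.fn_smul lam (Γ V), Γ_fn V] with θ h1 h2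
    rw [h1, h2]
  constructor
  · intro h
    have h2 : V.fn = (lam • Γ V).fn := congrArg H.fn h
    rw [h2] at h1 ⊢
    rwa [← h2] at h1 ⊢
  · exact fun h => H.eq_of_fn (h.trans h1.symm)

lemma existsUnique_solution_of_equilibrium {lam : ℝ} {f : ℝ → ℝ}
    (hf : IsEquilibrium kernel lam f) (heven : ∀ θ, f (2 * π - θ) = f θ) :
    ∃! V : H, Solves lam V ∧ IsDensityOf f V := by
  have hi := hf.integrable_per
  obtain ⟨B, hB⟩ := exists_kernelC_bound
  set V := H.mk (fun θ => lam * conv f θ) (fun θ => lam * convD f θ)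
    ((memLp_conv continuous_kernelC.measurable hB hi).const_mul lam)
    ((memLp_conv measurable_kernelD abs_kernelD_le hi).const_mul lam)
    ((isAdmissible_conv hi (Eventually.of_forall heven)).smul lam) with hV
  have hfn : V.fn =ᵐ[per] fun θ => lam * conv f θ := H.fn_mk ..
  have hdens : IsDensityOf f V := by
    have h1 : (fun θ => Real.exp (-V.fn θ)) =ᵐ[per] fun θ => Real.exp (-(lam * conv f θ)) := by
      filter_upwards [hfn] with θ hθ
      rw [hθ]
    filter_upwards [h1] with θ hθ
    rw [hθ, integral_congr_per h1, hf.eq, exp_neg_potential_div hi]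
  refine ⟨V, ⟨solves_iff_fn.2 ?_, hdens⟩, fun W ⟨hW, hWd⟩ => H.eq_of_fn ?_⟩
  · filter_upwards [hfn] with θ hθ
    rw [hθ, gammaFun_eq_conv hdens]
  · filter_upwards [hfn, solves_iff_fn.1 hW] with θ h1 h2
    rw [h1, h2, gammaFun_eq_conv hWd]

lemma existsUnique_equilibrium_of_solution {lam : ℝ} {V : H} (hV : Solves lam V) :
    ∃! f : ℝ → ℝ, (IsEquilibrium kernel lam f ∧ ∀ θ, f (2 * π - θ) = f θ) ∧ IsDensityOf f V := by
  set Z := ∫ s in (0 : ℝ)..2 * π, Real.exp (-V.fn s) with hZ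
  have hZpos : 0 < Z := by
    rw [hZ, partition_eq]
    exact partition_pos V
  set g : ℝ → ℝ := fun θ => Real.exp (-V.fn θ) / Z with hg
  have hgd : IsDensityOf g V := Eventually.of_forall fun θ => rfl
  have hgi : Integrable g per := V.integrable_exp.div_const Z
  -- the representative of the density that is defined everywhere by the equation
  set f : ℝ → ℝ := fun θ => Real.exp (-(lam * conv g θ)) /
    ∫ s in (0 : ℝ)..2 * π, Real.exp (-(lam * conv g s)) with hf
  have h1 : (fun θ => Real.exp (-(lam * conv g θ))) =ᵐ[per] fun θ => Real.exp (-V.fn θ) := by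
    filter_upwards [solves_iff_fn.1 hV] with θ hθ
    rw [hθ, gammaFun_eq_conv hgd]
  have hfg : f =ᵐ[per] g := by
    filter_upwards [h1] with θ hθ
    simp only [hf, hg]
    rw [hθ, integral_congr_per h1]
  have hfi : Integrable f per := hgi.congr hfg.symm
  have heq : IsEquilibrium kernel lam f := by
    refine ⟨fun θ => div_nonneg (Real.exp_pos _).le (intervalIntegral.integral_nonneg
      period_nonneg fun s _ => (Real.exp_pos _).le), fun θ => ?_,
      integrable_intervalIntegrable hfi, ?_, fun θ => ?_⟩
    · simp only [hf, conv_add_pi]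
    · rw [integral_congr_per hfg, hg, intervalIntegral.integral_div, ← hZ, div_self hZpos.ne']
    · rw [exp_neg_potential_div hfi]
      simp only [conv_congr hfg]
      rfl
  refine ⟨f, ⟨⟨heq, fun θ => ?_⟩, ?_⟩, fun f' ⟨⟨h2, _⟩, h3⟩ => h2.eq_of_ae heq ?_⟩
  · have : ∀ᵐ θ ∂(volume.restrict (Ioo 0 (2 * π))), g (2 * π - θ) = g θ := by
      filter_upwards [(V.2 : IsAdmissible _ _).even] with θ hθ
      simp only [hg, H.fn]
      rw [hθ]
    simp only [hf, conv_two_pi_sub this]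
  · exact hfg.trans hgd
  · exact EventuallyEq.trans h3 hfg.symm

/-! ### The bifurcation values -/

lemma isBifurcationValue_threshold {m : ℕ} (hm : m ≠ 0) : IsBifurcationValue (threshold m) := by
  obtain ⟨δ, hδ, μ, z, hsm, hμ0, hz0, horth, hsol, -, -⟩ := exists_supercritical_branch hm
  intro U hU
  have h0 : (0 : ℝ) ∈ Ioo (-δ) δ := ⟨neg_neg_of_pos hδ, hδ⟩
  have hlim : Tendsto (fun t => (threshold m + μ t, t • (cosMode m + z t))) (𝓝 0)
      (𝓝 ((threshold m, 0) : ℝ × H)) := by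
    have h1 := (hsm 0 h0).1.continuousAt.tendsto.const_add (threshold m)
    have h2 := (tendsto_id (x := 𝓝 (0 : ℝ))).smul
      ((hsm 0 h0).2.continuousAt.tendsto.const_add (cosMode m))
    rw [hμ0, add_zero] at h1
    rw [zero_smul] at h2
    exact h1.prodMk_nhds h2
  obtain ⟨t, ⟨h1, h2⟩, hne⟩ := (((hlim.eventually hU).and
    (Ioo_mem_nhds h0.1 h0.2)).filter_mono nhdsWithin_le_nhds |>.and
    (self_mem_nhdsWithin (s := {(0 : ℝ)}ᶜ))).exists
  refine ⟨_, h1, smul_ne_zero hne fun h => ?_, hsol t h2⟩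
  have h3 := congrArg (coeff m) h
  rw [map_add, coeff_cosMode hm, if_pos rfl, ← coord_cosMode hm, coord_eq_zero (horth t),
    map_zero] at h3
  norm_num at h3

/-- Away from the thresholds the linearisation is bounded below, which excludes small nontrivial
solutions. -/
lemma eq_threshold_of_isBifurcationValue {lam0 : ℝ} (h : IsBifurcationValue lam0) :
    ∃ m, m ≠ 0 ∧ lam0 = threshold m := by
  by_contra! hne
  obtain ⟨c, hc, hb⟩ := exists_entry_bound lam0
  have hlow : ∀ W : H, c * ‖W‖ ≤ ‖(1 - lam0 • Γderiv 0) W‖ := fun W =>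
    (isDiagonal_one_sub lam0).norm_ge hc.le fun j hj _ => hb j hj (hne j hj).symm
  have hd := (hasFDerivAt_Γ 0).isLittleO.def (c := c / (4 * (|lam0| + 1))) (by positivity)
  simp only [Γ_zero, sub_zero] at hd
  have e1 : ∀ᶠ p in 𝓝 ((lam0, 0) : ℝ × H), |p.1| < |lam0| + 1 :=
    Tendsto.eventually_lt_const (v := |lam0|) (by linarith)
      (continuous_fst.abs.tendsto ((lam0, 0) : ℝ × H))
  have e2 : ∀ᶠ p in 𝓝 ((lam0, 0) : ℝ × H), |p.1 - lam0| * ‖Γderiv 0‖ < c / 2 := by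
    have : Tendsto (fun p : ℝ × H => |p.1 - lam0| * ‖Γderiv 0‖) (𝓝 (lam0, 0))
        (𝓝 (|lam0 - lam0| * ‖Γderiv 0‖)) :=
      ((continuous_fst.sub continuous_const).abs.mul continuous_const).tendsto _
    rw [sub_self, abs_zero, zero_mul] at this
    exact this.eventually_lt_const (by positivity)
  obtain ⟨p, ⟨h1, h2, h3⟩, hp0, hp⟩ := h _ (e1.and (e2.and
    ((continuous_snd.tendsto ((lam0, 0) : ℝ × H)).eventually hd)))
  have hp' : p.2 = p.1 • Γ p.2 := hp
  have h4 : (1 - lam0 • Γderiv 0) p.2 =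
      p.1 • (Γ p.2 - Γderiv 0 p.2) + (p.1 - lam0) • Γderiv 0 p.2 := by
    rw [smul_sub, ← hp', sub_smul, sub_apply, one_apply_eq_self, smul_apply]
    abel
  have hpos : 0 < ‖p.2‖ := norm_pos_iff.2 hp0
  have h5 : ‖(1 - lam0 • Γderiv 0) p.2‖ ≤ |p.1| * ‖Γ p.2 - Γderiv 0 p.2‖ +
      |p.1 - lam0| * ‖Γderiv 0 p.2‖ := by
    rw [h4]
    refine (norm_add_le _ _).trans ?_
    rw [norm_smul, norm_smul, Real.norm_eq_abs, Real.norm_eq_abs]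
  have h6 : |p.1| * ‖Γ p.2 - Γderiv 0 p.2‖ ≤ c / 4 * ‖p.2‖ := by
    calc |p.1| * ‖Γ p.2 - Γderiv 0 p.2‖
        ≤ (|lam0| + 1) * (c / (4 * (|lam0| + 1)) * ‖p.2‖) :=
          mul_le_mul h1.le h3 (norm_nonneg _) (by positivity)
      _ = c / 4 * ‖p.2‖ := by
          field_simp
  have h7 : |p.1 - lam0| * ‖Γderiv 0 p.2‖ ≤ c / 2 * ‖p.2‖ := by
    calc |p.1 - lam0| * ‖Γderiv 0 p.2‖ ≤ |p.1 - lam0| * (‖Γderiv 0‖ * ‖p.2‖) :=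
          mul_le_mul_of_nonneg_left ((Γderiv 0).le_opNorm _) (abs_nonneg _)
      _ = |p.1 - lam0| * ‖Γderiv 0‖ * ‖p.2‖ := by ring
      _ ≤ c / 2 * ‖p.2‖ := mul_le_mul_of_nonneg_right h2.le hpos.le
  have h8 := hlow p.2
  have h9 : 0 < c * ‖p.2‖ := by positivity
  linarith

/-! ### The bifurcating pairs -/

/-- The branch through a set that contains all small nontrivial solutions satisfies the local
description of the zero set: the neighbourhood is enlarged by the points of the branch. -/
lemma isBranch_of_exhausts {lam0 δ : ℝ} {φ : H} {μ : ℝ → ℝ} {z : ℝ → H} (hδ : 0 < δ)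
    (hμ : ContinuousOn μ (Ioo (-δ) δ)) (hz : ContinuousOn z (Ioo (-δ) δ)) (hμ0 : μ 0 = 0)
    (hz0 : z 0 = 0) (horth : ∀ t, inner ℝ φ (z t) = 0)
    (hsol : ∀ t ∈ Ioo (-δ) δ, t • (φ + z t) = (lam0 + μ t) • Γ (t • (φ + z t)))
    (hall : ∃ U ∈ 𝓝 ((lam0, 0) : ℝ × H), ∀ p ∈ U, p.2 = p.1 • Γ p.2 → p.2 ≠ 0 →
      ∃ t ∈ Ioo (-δ) δ, t ≠ 0 ∧ p = (lam0 + μ t, t • (φ + z t))) :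
    IsBranch lam0 φ δ μ z := by
  obtain ⟨U, hU, h⟩ := hall
  refine ⟨hδ, hμ, hz, hμ0, hz0, fun t _ => horth t,
    U ∪ {p | ∃ t ∈ Ioo (-δ) δ, p = (lam0 + μ t, t • (φ + z t))},
    mem_of_superset hU subset_union_left, ?_⟩
  ext p
  constructor
  · rintro ⟨hp | hp, hs⟩
    · by_cases h0 : p.2 = 0
      · exact Or.inr ⟨Or.inl hp, h0⟩
      · obtain ⟨t, ht, -, e⟩ := h p hp hs h0
        exact Or.inl ⟨t, ht, e⟩
    · exact Or.inl hp
  · rintro (⟨t, ht, rfl⟩ | ⟨hp, h0⟩)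
    · exact ⟨Or.inr ⟨t, ht, rfl⟩, hsol t ht⟩
    · refine ⟨hp, ?_⟩
      change p.2 = p.1 • Γ p.2
      rw [h0, Γ_zero, smul_zero]

lemma exists_stable_branch {m : ℕ} (hm : m ≠ 0) :
    (∃ r₀ > 0, ∀ r : ℝ, 0 < r → r < r₀ → ∃ ε > 0,
      (∀ lam ∈ Ioc (threshold m - ε) (threshold m),
        {V : H | ‖V‖ < r ∧ V ≠ 0 ∧ Solves lam V} = ∅) ∧
      (∀ lam ∈ Ioo (threshold m) (threshold m + ε),
        {V : H | ‖V‖ < r ∧ V ≠ 0 ∧ Solves lam V}.ncard = 2)) ∧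
    ∃ (δ : ℝ) (μ : ℝ → ℝ) (z : ℝ → H), IsBranch (threshold m) (cosMode m) δ μ z ∧
      ∀ t : ℝ, 0 < |t| → |t| < δ → 0 < μ t ∧
        (m = 1 → IsStable (threshold m + μ t) (t • (cosMode m + z t))) ∧
        (2 ≤ m → IsUnstable (threshold m + μ t) (t • (cosMode m + z t))) := by
  obtain ⟨δ, hδ, μ, z, hsm, hμ0, hz0, horth, hsol, hpos, hall⟩ := exists_supercritical_branch hm
  have hμc : ContinuousOn μ (Ioo (-δ) δ) := fun t ht =>
    (hsm t ht).1.continuousAt.continuousWithinAt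
  have hzc : ContinuousOn z (Ioo (-δ) δ) := fun t ht =>
    (hsm t ht).2.continuousAt.continuousWithinAt
  obtain ⟨hinc, hdec⟩ := strictMono_of_mul_deriv_pos hμc hδ hpos
  refine ⟨exactly_two_of_branch (cosMode_ne_zero hm) hδ hμc hzc hμ0 hinc hdec horth hsol
    (hall δ hδ), ?_⟩
  have h0 : (0 : ℝ) ∈ Ioo (-δ) δ := ⟨neg_neg_of_pos hδ, hδ⟩
  have hI : Ioo (-δ) δ ∈ 𝓝 (0 : ℝ) := Ioo_mem_nhds h0.1 h0.2
  have hstab : ∀ᶠ t in 𝓝[≠] 0,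
      (m = 1 → IsStable (threshold m + μ t) (t • (cosMode m + z t))) ∧
      (2 ≤ m → IsUnstable (threshold m + μ t) (t • (cosMode m + z t))) := by
    rcases Nat.lt_or_ge m 2 with h2 | h2
    · have h1 : m = 1 := by omega
      subst h1
      have := eventually_isStable (mem_of_superset hI fun t ht => (hsm t ht).2)
        (mem_of_superset hI fun t ht => (hsm t ht).1) hz0 hμ0 horth (mem_of_superset hI hsol)
        (eventually_nhdsWithin_iff.2 (mem_of_superset hI hpos))
      filter_upwards [this] with t ht
      exact ⟨fun _ => ht, fun h => absurd h (by omega)⟩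
    · have := eventually_isUnstable h2 (hsm 0 h0).2.continuousAt (hsm 0 h0).1.continuousAt hμ0
      filter_upwards [this.filter_mono nhdsWithin_le_nhds] with t ht
      exact ⟨fun h => absurd h (by omega), fun _ => ht⟩
  obtain ⟨ε, hε, hball⟩ := Metric.eventually_nhds_iff.1 (eventually_nhdsWithin_iff.1 hstab)
  have hsub : Ioo (-min δ ε) (min δ ε) ⊆ Ioo (-δ) δ :=
    Ioo_subset_Ioo (neg_le_neg (min_le_left _ _)) (min_le_left _ _)
  have hδ' : 0 < min δ ε := lt_min hδ hε
  refine ⟨min δ ε, μ, z, isBranch_of_exhausts hδ' (hμc.mono hsub) (hzc.mono hsub) hμ0 hz0 horth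
    (fun t ht => hsol t (hsub ht)) (hall _ hδ'), fun t ht1 ht2 => ⟨?_, ?_⟩⟩
  · have ht := hsub (abs_lt.1 ht2)
    rcases lt_or_gt_of_ne (abs_pos.1 ht1) with h | h
    · rw [← hμ0]
      exact hdec ⟨ht.1, h.le⟩ ⟨h0.1, le_rfl⟩ h
    · rw [← hμ0]
      exact hinc ⟨le_rfl, h0.2⟩ ⟨h.le, ht.2⟩ h
  · refine hball ?_ (abs_pos.1 ht1)
    rw [Real.dist_eq, sub_zero]
    exact ht2.trans_le (min_le_right _ _)

end Onsager

end

theorem mainTheorem3 :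
    -- the cosine coefficients of the Onsager kernel, and the threshold `π / 2`
    (Onsager.fourierCos Onsager.kernel 0 = 2 / π ∧
      (∀ m : ℕ, 1 ≤ m →
        Onsager.fourierCos Onsager.kernel m = -(4 / (π * (4 * (m : ℝ) ^ 2 - 1))) ∧
        -2 / Onsager.fourierCos Onsager.kernel m = (4 * (m : ℝ) ^ 2 - 1) * π / 2) ∧
      (∀ θ : ℝ, HasSum
        (fun m : ℕ => Onsager.fourierCos Onsager.kernel m * Real.cos (2 * m * θ)) |Real.sin θ|) ∧
      HasSum (fun m : ℕ => |Onsager.fourierCos Onsager.kernel (m + 1)|) (π / 2)⁻¹) ∧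
    -- uniqueness of the trivial solution
    (∀ lam : ℝ, 0 < lam → lam < π / 2 → ∀ f : ℝ → ℝ,
      Onsager.IsEquilibrium Onsager.kernel lam f ↔ f = fun _ => 1 / (2 * π)) ∧
    -- axisymmetric equilibrium densities correspond to the solutions of `V = lam Γ(V)` in `H`
    (∀ lam : ℝ, 0 < lam →
      (∀ f : ℝ → ℝ, Onsager.IsEquilibrium Onsager.kernel lam f → (∀ θ, f (2 * π - θ) = f θ) →
        ∃! V : Onsager.H, Onsager.Solves lam V ∧ Onsager.IsDensityOf f V) ∧
      (∀ V : Onsager.H, Onsager.Solves lam V →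
        ∃! f : ℝ → ℝ, (Onsager.IsEquilibrium Onsager.kernel lam f ∧ ∀ θ, f (2 * π - θ) = f θ) ∧
          Onsager.IsDensityOf f V)) ∧
    -- the bifurcation values
    (∀ lam0 : ℝ, 0 < lam0 → (Onsager.IsBifurcationValue lam0 ↔
      ∃ m : ℕ, 1 ≤ m ∧ lam0 = (4 * (m : ℝ) ^ 2 - 1) * π / 2)) ∧
    -- the bifurcating pairs: structure, supercriticality, stability
    (∀ m : ℕ, 1 ≤ m → ∀ lam0 : ℝ, lam0 = (4 * (m : ℝ) ^ 2 - 1) * π / 2 →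
      (∃ r₀ > 0, ∀ r : ℝ, 0 < r → r < r₀ → ∃ ε > 0,
        (∀ lam ∈ Ioc (lam0 - ε) lam0,
          {V : Onsager.H | ‖V‖ < r ∧ V ≠ 0 ∧ Onsager.Solves lam V} = ∅) ∧
        (∀ lam ∈ Ioo lam0 (lam0 + ε),
          {V : Onsager.H | ‖V‖ < r ∧ V ≠ 0 ∧ Onsager.Solves lam V}.ncard = 2)) ∧
      ∃ (δ : ℝ) (μ : ℝ → ℝ) (z : ℝ → Onsager.H),
        Onsager.IsBranch lam0 (Onsager.cosMode m) δ μ z ∧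
        ∀ t : ℝ, 0 < |t| → |t| < δ →
          0 < μ t ∧
          (m = 1 → Onsager.IsStable (lam0 + μ t) (t • (Onsager.cosMode m + z t))) ∧
          (2 ≤ m → Onsager.IsUnstable (lam0 + μ t) (t • (Onsager.cosMode m + z t)))) := by
  have hne : ∀ {m : ℕ}, 1 ≤ m → m ≠ 0 := fun h => by omega
  refine ⟨⟨Onsager.fourierCos_kernel_zero, fun m hm => ⟨Onsager.fourierCos_kernel hm,
    Onsager.neg_two_div_fourierCos hm⟩, Onsager.hasSum_abs_sin, Onsager.hasSum_abs_fourierCos⟩,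
    fun lam h0 h1 f => ⟨fun h => ?_, ?_⟩, fun lam _ => ⟨fun f hf heven =>
      Onsager.existsUnique_solution_of_equilibrium hf heven, fun V hV =>
      Onsager.existsUnique_equilibrium_of_solution hV⟩, fun lam0 _ => ⟨fun h => ?_, ?_⟩, ?_⟩
  · exact h.eq_const h0 (by linarith [Real.pi_lt_four])
  · rintro rfl
    exact Onsager.isEquilibrium_const
  · obtain ⟨m, hm, rfl⟩ := Onsager.eq_threshold_of_isBifurcationValue h
    exact ⟨m, by omega, rfl⟩
  · rintro ⟨m, hm, rfl⟩
    exact Onsager.isBifurcationValue_threshold (hne hm)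
  · rintro m hm _ rfl
    exact Onsager.exists_stable_branch (hne hm)
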